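/- Let $\square=[-\pi,\pi)^2$ and $\square^*=[-\tfrac12,\tfrac12)^2$, let $\epsilon_0>1$, $\gamma=\epsilon_0-1$, and let $R\subset\mathbb{R}^2$ be a non-empty open set with $\overline R\subset\square$. For $\theta\in\square^*$ let $H^1_\theta(\square;\mathbb{C}^2)=\{e^{i\theta\cdot y}v : v\in H^1(\square;\mathbb{C}^2)\ \square\text{-periodic}\}$ and $$V(\theta)=\{v\in H^1_\theta(\square;\mathbb{C}^2): \operatorname{div}v=0,\ \operatorname{curl}v=0\ \text{a.e. in }\square\setminus R\},\qquad \operatorname{div}u=\partial_1u_1+\partial_2u_2,\quad \operatorname{curl}u=\partial_1u_2-\partial_2u_1 .$$ With $\nabla^\perp p=(-\partial_2p,\partial_1p)$ and $X(u,\phi)=\nabla^\perp u_1\cdot\overline{\nabla\phi_2}+\nabla u_2\cdot\overline{\nabla^\perp\phi_1}$, put $$c(u,\phi)=\int_\square u\cdot\overline\phi+\gamma\int_R u_2\overline{\phi_2},\qquad a(u,\phi)=\int_{\square\setminus R}\operatorname{div}u\,\overline{\operatorname{div}\phi}+\operatorname{curl}u\,\overline{\operatorname{curl}\phi},$$ $$b(u,\phi)=-\frac12\int_{\square\setminus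 R}X(u,\phi)+\frac1\gamma\int_R\Big(\nabla u_1\cdot\overline{\nabla\phi_1}+\epsilon_0\nabla u_2\cdot\overline{\nabla\phi_2}+X(u,\phi)\Big),$$ and, for $0<\varepsilon<1$, $$b_\varepsilon(u,\phi)=\frac{\sqrt{1-\varepsilon}-1}{\varepsilon}\int_{\square\setminus R}X(u,\phi)+\frac1{\gamma+\varepsilon}\int_R\Big(\nabla u_1\cdot\overline{\nabla\phi_1}+\epsilon_0\nabla u_2\cdot\overline{\nabla\phi_2}+\sqrt{1-\varepsilon}\,X(u,\phi)\Big).$$ Let $\mathcal B(\theta)$ be the operator generated by the form $b$ with form domain $V(\theta)$ in the Hilbert space (closure of $V(\theta)$ in $L^2(\square;\mathbb{C}^2)$, with inner product $c$), and let $\mathcal B_\varepsilon(\theta)$ be the operator generated by $\varepsilon^{-1}a+b_\varepsilon$ with form domain $H^1_\theta(\square;\mathbb{C}^2)$ in $(L^2(\square;\mathbb{C}^2),c)$. (They describe the Maxwell system of the photonic crystal fibre with inclusion cross-section $R$ on the critical light line $k=1$ and on the line $k=\sqrt{1-\varepsilon}$ respectively.) Let $\sigma_0$ and $\sigma_\varepsilon$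 be the closures in $\mathbb{R}$ of the union over $\theta\in\square^*$ of the sets of eigenvalues of $\mathcal B(\theta)$ and of $\mathcal B_\varepsilon(\theta)$. For $X,Y\subset\mathbb{R}$ let $\operatorname{dist}(X,Y)=\sup_{x\in X}\operatorname{dist}(x,Y)$, with $\operatorname{dist}(\emptyset,Y)=\operatorname{dist}(X,\emptyset)=0$, and $$d_{[a,b]}(X,Y)=\max\{\operatorname{dist}([a,b]\cap X,Y),\ \operatorname{dist}([a,b]\cap Y,X)\}.$$ Then the following hold. 1. For all $\theta\in\square^*$ and $0<\varepsilon<1$ the eigenvalues of $\mathcal B(\theta)$ and of $\mathcal B_\varepsilon(\theta)$ have finite multiplicity and, repeated according to multiplicity, form sequences $0\le\lambda_1(\theta)\le\lambda_2(\theta)\le\dots\to\infty$ and $0\le\lambda_{1,\varepsilon}(\theta)\le\lambda_{2,\varepsilon}(\theta)\le\dots\to\infty$; and there is a constant $C>0$, independent of $n$, $\theta$ and $\varepsilon$, such that $$\Big|\frac1{\lambda_{n,\varepsilon}(\theta)+1}-\frac1{\lambda_n(\theta)+1}\Big|\le C\varepsilon\qquad\text{for all }n\ge1,\ \theta\in\square^*,\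 0<\varepsilon<1 .$$ 2. For every $b\in\mathbb{R}$ there is a constant $C_b>0$ such that $d_{[a,b]}(\sigma_\varepsilon,\sigma_0)\le C_b\,\varepsilon$ for all $a\le b$ and all $0<\varepsilon<1$. -/

import Mathlib

open MeasureTheory Filter Topology
open scoped ENNReal ContDiff ComplexConjugate

noncomputable section

namespace PCF

/-- The plane of transverse variables `(y₁, y₂)` (indices `0`, `1` below). -/
abbrev Plane : Type := EuclideanSpace ℝ (Fin 2)

/-- The periodicity cell `□ = [-π, π)²`. -/
def cell : Set Plane := {y | ∀ i, y i ∈ Set.Ico (-Real.pi) Real.pi}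

/-- The dual cell (Brillouin zone) `□* = [-1/2, 1/2)²`. -/
def dualCell : Set Plane := {t | ∀ i, t i ∈ Set.Ico (-(1 / 2) : ℝ) (1 / 2)}

/-- Lebesgue measure on the cell. -/
def cellMeasure : Measure Plane := volume.restrict cell

/-- `L²(□)`, complex valued. -/
abbrev L2 : Type := Lp ℂ 2 cellMeasure

/-- `L²(□; ℂ²)`, as pairs of components. Only its vector space structure and its topology
are used, and the latter is that of the usual `L²` norm. -/
abbrev L2V : Type := Fin 2 → L2

/-- The partial derivative `∂φ/∂y_j` of a differentiable function. -/
def partialD (j : Fin 2) (φ : Plane → ℂ) (y : Plane) : ℂ :=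
  fderiv ℝ φ y (EuclideanSpace.single j 1)

theorem integrable_mul_conj (p q : L2) :
    Integrable (fun y => p y * conj (q y)) cellMeasure := by
  have h := L2.integrable_inner (𝕜 := ℂ) q p
  refine h.congr (ae_of_all _ fun y => ?_)
  simp [RCLike.inner_apply]

/-- The sesquilinear pairing `(p, q) ↦ ∫_{□ ∩ S} p q̄`, linear in `p`. -/
def pairing (S : Set Plane) : L2 →ₗ[ℂ] L2 →ₗ⋆[ℂ] ℂ :=
  LinearMap.mk₂'ₛₗ (RingHom.id ℂ) (starRingEnd ℂ)
    (fun p q => ∫ y in S, p y * conj (q y) ∂cellMeasure)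
    (fun p p' q => by
      rw [← integral_add (integrable_mul_conj p q).integrableOn
        (integrable_mul_conj p' q).integrableOn]
      refine integral_congr_ae (ae_restrict_of_ae ?_)
      filter_upwards [Lp.coeFn_add p p'] with y hy
      simp only [hy, Pi.add_apply, add_mul])
    (fun z p q => by
      rw [RingHom.id_apply, smul_eq_mul, ← integral_const_mul]
      refine integral_congr_ae (ae_restrict_of_ae ?_)
      filter_upwards [Lp.coeFn_smul z p] with y hy
      simp [hy, mul_assoc])
    (fun p q q' => by
      rw [← integral_add (integrable_mul_conj p q).integrableOn
        (integrable_mul_conj p q').integrableOn]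
      refine integral_congr_ae (ae_restrict_of_ae ?_)
      filter_upwards [Lp.coeFn_add q q'] with y hy
      simp only [hy, Pi.add_apply, map_add, mul_add])
    (fun z p q => by
      rw [smul_eq_mul, ← integral_const_mul]
      refine integral_congr_ae (ae_restrict_of_ae ?_)
      filter_upwards [Lp.coeFn_smul z q] with y hy
      simp [hy]; ring)

/-! ### Sobolev spaces on the cell -/

/-- `g ∈ L²(□)` is the weak partial derivative `∂u/∂y_j` of `u ∈ L²(□)` in (the interior
of) the cell. -/
def HasWeakPartial (j : Fin 2) (u g : L2) : Prop :=
  ∀ φ : Plane → ℂ, ContDiff ℝ ∞ φ → HasCompactSupport φ → tsupport φ ⊆ interior cell →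
    ∫ y, u y * partialD j φ y ∂cellMeasure = - ∫ y, g y * φ y ∂cellMeasure

theorem memLp_of_test {φ : Plane → ℂ} (h : Continuous φ) (hc : HasCompactSupport φ) :
    MemLp φ 2 cellMeasure :=
  (h.memLp_of_hasCompactSupport (μ := volume) hc).restrict _

theorem integrable_mul_test (u : L2) {φ : Plane → ℂ} (h : Continuous φ)
    (hc : HasCompactSupport φ) : Integrable (fun y => u y * φ y) cellMeasure :=
  (Lp.memLp u).integrable_mul (memLp_of_test h hc)

theorem continuous_partialD {j : Fin 2} {φ : Plane → ℂ} (h : ContDiff ℝ ∞ φ) :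
    Continuous (partialD j φ) :=
  (h.continuous_fderiv (by simp)).clm_apply continuous_const

theorem hasCompactSupport_partialD {j : Fin 2} {φ : Plane → ℂ} (h : HasCompactSupport φ) :
    HasCompactSupport (partialD j φ) :=
  h.fderiv_apply ℝ _

theorem HasWeakPartial.add {j : Fin 2} {u u' g g' : L2} (h : HasWeakPartial j u g)
    (h' : HasWeakPartial j u' g') : HasWeakPartial j (u + u') (g + g') := by
  intro φ h1 h2 h3
  have e1 : ∫ y, (u + u') y * partialD j φ y ∂cellMeasure
      = ∫ y, (u y * partialD j φ y + u' y * partialD j φ y) ∂cellMeasure := by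
    refine integral_congr_ae ?_
    filter_upwards [Lp.coeFn_add u u'] with y hy
    simp only [hy, Pi.add_apply, add_mul]
  have e2 : ∫ y, (g + g') y * φ y ∂cellMeasure
      = ∫ y, (g y * φ y + g' y * φ y) ∂cellMeasure := by
    refine integral_congr_ae ?_
    filter_upwards [Lp.coeFn_add g g'] with y hy
    simp only [hy, Pi.add_apply, add_mul]
  rw [e1, e2, integral_add, integral_add, h φ h1 h2 h3, h' φ h1 h2 h3]
  · ring
  · exact integrable_mul_test _ h1.continuous h2
  · exact integrable_mul_test _ h1.continuous h2
  · exact integrable_mul_test _ (continuous_partialD h1) (hasCompactSupport_partialD h2)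
  · exact integrable_mul_test _ (continuous_partialD h1) (hasCompactSupport_partialD h2)

theorem HasWeakPartial.smul {j : Fin 2} {u g : L2} (z : ℂ) (h : HasWeakPartial j u g) :
    HasWeakPartial j (z • u) (z • g) := by
  intro φ h1 h2 h3
  have e1 : ∫ y, (z • u) y * partialD j φ y ∂cellMeasure
      = ∫ y, z * (u y * partialD j φ y) ∂cellMeasure := by
    refine integral_congr_ae ?_
    filter_upwards [Lp.coeFn_smul z u] with y hy
    simp [hy, mul_assoc]
  have e2 : ∫ y, (z • g) y * φ y ∂cellMeasure = ∫ y, z * (g y * φ y) ∂cellMeasure := by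
    refine integral_congr_ae ?_
    filter_upwards [Lp.coeFn_smul z g] with y hy
    simp [hy, mul_assoc]
  rw [e1, e2, integral_const_mul, integral_const_mul, h φ h1 h2 h3]
  ring

theorem integral_zero_mul (ψ : Plane → ℂ) :
    ∫ y, (0 : L2) y * ψ y ∂cellMeasure = 0 := by
  rw [← integral_zero Plane ℂ (μ := cellMeasure)]
  refine integral_congr_ae ?_
  filter_upwards [Lp.coeFn_zero ℂ 2 cellMeasure] with y hy
  simp only [hy, Pi.zero_apply, zero_mul]

theorem hasWeakPartial_zero (j : Fin 2) : HasWeakPartial j 0 0 := by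
  intro φ _ _ _
  rw [integral_zero_mul, integral_zero_mul, neg_zero]

theorem convex_cell : Convex ℝ cell := by
  have : cell = ⋂ i, (fun y : Plane => y i) ⁻¹' Set.Ico (-Real.pi) Real.pi := by
    ext y; simp [cell]
  rw [this]
  refine convex_iInter fun i => ?_
  exact (convex_Ico _ _).linear_preimage (EuclideanSpace.proj (𝕜 := ℝ) i).toLinearMap

theorem isBounded_cell : Bornology.IsBounded cell := by
  refine (Metric.isBounded_iff_subset_closedBall 0).2 ⟨2 * Real.pi, fun y hy => ?_⟩
  have hpi := Real.pi_pos
  rw [mem_closedBall_zero_iff, EuclideanSpace.norm_eq]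
  refine Real.sqrt_le_iff.2 ⟨by positivity, ?_⟩
  have h1 : ∀ i, ‖y i‖ ^ 2 ≤ Real.pi ^ 2 := fun i => by
    rw [Real.norm_eq_abs, sq_abs]
    exact sq_le_sq' (hy i).1 (hy i).2.le
  rw [Fin.sum_univ_two]
  nlinarith [h1 0, h1 1, sq_nonneg Real.pi]

instance isFiniteMeasure_cellMeasure : IsFiniteMeasure cellMeasure := by
  refine ⟨?_⟩
  rw [cellMeasure, Measure.restrict_apply_univ]
  exact isBounded_cell.measure_lt_top

theorem cellMeasure_eq : cellMeasure = volume.restrict (interior cell) := by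
  unfold cellMeasure
  refine (Measure.restrict_congr_set ?_).symm
  exact interior_ae_eq_of_null_frontier (convex_cell.addHaar_frontier volume)

theorem ae_zero_of_test {f : Plane → ℂ} (hf : Integrable f cellMeasure)
    (h : ∀ φ : Plane → ℝ, ContDiff ℝ ∞ φ → HasCompactSupport φ →
      tsupport φ ⊆ interior cell → ∫ y, f y * (φ y : ℂ) ∂cellMeasure = 0) :
    ∀ᵐ y ∂cellMeasure, f y = 0 := by
  rw [cellMeasure_eq] at hf ⊢
  refine (ae_restrict_iff' isOpen_interior.measurableSet).2 ?_
  refine isOpen_interior.ae_eq_zero_of_integral_contDiff_smul_eq_zero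
    (IntegrableOn.locallyIntegrableOn hf) fun φ h1 h2 h3 => ?_
  have e := h φ h1 h2 h3
  rw [cellMeasure_eq] at e
  rw [← setIntegral_eq_integral_of_forall_compl_eq_zero (s := interior cell), ← e]
  · refine integral_congr_ae (ae_of_all _ fun y => ?_)
    simp [mul_comm]
  · intro y hy
    have : φ y = 0 := by
      by_contra hne
      exact hy (h3 (subset_tsupport φ hne))
    simp [this]

/-- Weak partial derivatives are unique. -/
theorem HasWeakPartial.unique {j : Fin 2} {u g g' : L2} (h : HasWeakPartial j u g)
    (h' : HasWeakPartial j u g') : g = g' := by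
  have hd : HasWeakPartial j 0 (g + (-1 : ℂ) • g') := by
    have := h.add (h'.smul (-1))
    simpa using this
  have key : ∀ᵐ y ∂cellMeasure, (g + (-1 : ℂ) • g' : L2) y = 0 := by
    refine ae_zero_of_test ((Lp.memLp _).integrable (by norm_num)) fun φ h1 h2 h3 => ?_
    have hs : Function.support (fun y => (φ y : ℂ)) = Function.support φ := by
      ext y; simp
    have e := hd (fun y => (φ y : ℂ)) (Complex.ofRealCLM.contDiff.comp h1)
      (by rw [HasCompactSupport, tsupport, hs]; exact h2)
      (by rw [tsupport, hs]; exact h3)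
    rwa [integral_zero_mul, eq_comm, neg_eq_zero] at e
  have h3 : g + (-1 : ℂ) • g' = 0 := (Lp.eq_zero_iff_ae_eq_zero).2 key
  have h4 : g - g' = 0 := by simpa [sub_eq_add_neg] using h3
  exact sub_eq_zero.1 h4

/-- `H¹(□)`. -/
def H1 : Submodule ℂ L2 where
  carrier := {u | ∀ j, ∃ g, HasWeakPartial j u g}
  add_mem' hu hv j := by
    obtain ⟨g, hg⟩ := hu j
    obtain ⟨g', hg'⟩ := hv j
    exact ⟨_, hg.add hg'⟩
  zero_mem' j := ⟨0, hasWeakPartial_zero j⟩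
  smul_mem' z u hu j := by
    obtain ⟨g, hg⟩ := hu j
    exact ⟨_, hg.smul z⟩

/-- The weak partial derivative `∂/∂y_j : H¹(□) → L²(□)`. -/
def weakD (j : Fin 2) : H1 →ₗ[ℂ] L2 where
  toFun u := (u.2 j).choose
  map_add' u v := ((u + v).2 j).choose_spec.unique
    ((u.2 j).choose_spec.add (v.2 j).choose_spec)
  map_smul' z u := ((z • u).2 j).choose_spec.unique ((u.2 j).choose_spec.smul z)

/-- `H¹(□; ℂ²)`. -/
abbrev H1V : Type := Fin 2 → H1

/-- The inclusion of `H¹(□; ℂ²)` into `L²(□; ℂ²)`. -/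
def inclV : H1V →ₗ[ℂ] L2V :=
  LinearMap.pi fun i => H1.subtype ∘ₗ LinearMap.proj i

/-- `φ` is `□`-periodic, i.e. has period `2π` in each variable. -/
def IsPeriodic (φ : Plane → ℂ) : Prop :=
  ∀ i y, φ (y + EuclideanSpace.single i (2 * Real.pi)) = φ y

/-- `v ∈ H¹(□)` is `□`-periodic: its values on opposite sides of the cell agree, i.e. no
boundary term appears when one integrates by parts against smooth periodic functions. -/
def IsPeriodicH1 (v : H1) : Prop :=
  ∀ j, ∀ φ : Plane → ℂ, ContDiff ℝ ∞ φ → IsPeriodic φ →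
    ∫ y, (v : L2) y * partialD j φ y ∂cellMeasure = - ∫ y, weakD j v y * φ y ∂cellMeasure

/-- `u ∈ H¹_θ(□)`: `u(y) = e^{iθ·y} v(y)` for some periodic `v ∈ H¹(□)`. -/
def IsQuasiPeriodicH1 (θ : Plane) (u : H1) : Prop :=
  ∃ v : H1, IsPeriodicH1 v ∧
    ∀ᵐ y ∂cellMeasure, (u : L2) y =
      Complex.exp (Complex.I * ((∑ i, θ i * y i : ℝ) : ℂ)) * (v : L2) y

theorem measurableSet_cell : MeasurableSet cell := by
  have : cell = ⋂ i, (fun y : Plane => y i) ⁻¹' Set.Ico (-Real.pi) Real.pi := by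
    ext y; simp [cell]
  rw [this]
  exact MeasurableSet.iInter fun i =>
    (EuclideanSpace.proj (𝕜 := ℝ) i).continuous.measurable measurableSet_Ico

theorem integrable_mul_continuous (u : L2) {φ : Plane → ℂ} (h : Continuous φ) :
    Integrable (fun y => u y * φ y) cellMeasure := by
  obtain ⟨K, hK⟩ := isBounded_cell.isCompact_closure.exists_bound_of_continuousOn
    h.continuousOn
  have hmem : MemLp φ 2 cellMeasure := by
    refine MemLp.of_bound h.aestronglyMeasurable K ?_
    exact (ae_restrict_iff' measurableSet_cell).2
      (ae_of_all _ fun y hy => hK y (subset_closure hy))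
  exact (Lp.memLp u).integrable_mul hmem

theorem IsPeriodicH1.add {u v : H1} (hu : IsPeriodicH1 u) (hv : IsPeriodicH1 v) :
    IsPeriodicH1 (u + v) := by
  intro j φ h1 h2
  have e1 : ∫ y, ((u + v : H1) : L2) y * partialD j φ y ∂cellMeasure
      = ∫ y, ((u : L2) y * partialD j φ y + (v : L2) y * partialD j φ y) ∂cellMeasure := by
    refine integral_congr_ae ?_
    filter_upwards [Lp.coeFn_add (u : L2) (v : L2)] with y hy
    simp only [Submodule.coe_add, hy, Pi.add_apply, add_mul]
  have e2 : ∫ y, weakD j (u + v) y * φ y ∂cellMeasure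
      = ∫ y, (weakD j u y * φ y + weakD j v y * φ y) ∂cellMeasure := by
    refine integral_congr_ae ?_
    filter_upwards [Lp.coeFn_add (weakD j u) (weakD j v)] with y hy
    simp only [map_add, hy, Pi.add_apply, add_mul]
  rw [e1, e2, integral_add, integral_add, hu j φ h1 h2, hv j φ h1 h2]
  · ring
  · exact integrable_mul_continuous _ h1.continuous
  · exact integrable_mul_continuous _ h1.continuous
  · exact integrable_mul_continuous _ (continuous_partialD h1)
  · exact integrable_mul_continuous _ (continuous_partialD h1)

theorem IsPeriodicH1.smul {u : H1} (z : ℂ) (hu : IsPeriodicH1 u) :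
    IsPeriodicH1 (z • u) := by
  intro j φ h1 h2
  have e1 : ∫ y, ((z • u : H1) : L2) y * partialD j φ y ∂cellMeasure
      = ∫ y, z * ((u : L2) y * partialD j φ y) ∂cellMeasure := by
    refine integral_congr_ae ?_
    filter_upwards [Lp.coeFn_smul z (u : L2)] with y hy
    simp only [Submodule.coe_smul, hy, Pi.smul_apply, smul_eq_mul, mul_assoc]
  have e2 : ∫ y, weakD j (z • u) y * φ y ∂cellMeasure
      = ∫ y, z * (weakD j u y * φ y) ∂cellMeasure := by
    refine integral_congr_ae ?_
    filter_upwards [Lp.coeFn_smul z (weakD j u)] with y hy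
    simp only [map_smul, hy, Pi.smul_apply, smul_eq_mul, mul_assoc]
  rw [e1, e2, integral_const_mul, integral_const_mul, hu j φ h1 h2]
  ring

/-- `H¹_θ(□; ℂ²)`, the `θ`-quasi-periodic fields in `H¹(□; ℂ²)`. -/
def H1qp (θ : Plane) : Submodule ℂ H1V where
  carrier := {u | ∀ i, IsQuasiPeriodicH1 θ (u i)}
  add_mem' := by
    intro u u' hu hu' i
    obtain ⟨v, hv, h⟩ := hu i
    obtain ⟨v', hv', h'⟩ := hu' i
    refine ⟨v + v', hv.add hv', ?_⟩
    filter_upwards [h, h', Lp.coeFn_add (u i : L2) (u' i : L2),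
      Lp.coeFn_add (v : L2) (v' : L2)] with y h1 h2 h3 h4
    simp only [Pi.add_apply, Submodule.coe_add, h3, h4, h1, h2, mul_add]
  zero_mem' := by
    intro i
    refine ⟨0, ?_, ?_⟩
    · intro j φ _ _
      rw [map_zero, ZeroMemClass.coe_zero, integral_zero_mul, integral_zero_mul, neg_zero]
    · filter_upwards [Lp.coeFn_zero ℂ 2 cellMeasure] with y hy
      change (0 : L2) y = _ * (0 : L2) y
      rw [hy, Pi.zero_apply, mul_zero]
  smul_mem' := by
    intro z u hu i
    obtain ⟨v, hv, h⟩ := hu i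
    refine ⟨z • v, hv.smul z, ?_⟩
    filter_upwards [h, Lp.coeFn_smul z (u i : L2), Lp.coeFn_smul z (v : L2)] with y h1 h2 h3
    simp only [Pi.smul_apply, Submodule.coe_smul, h2, h3, h1, smul_eq_mul]
    ring

/-! ### Divergence, curl and the sesquilinear forms -/

/-- `div u = ∂₁ u₁ + ∂₂ u₂`. -/
def divV : H1V →ₗ[ℂ] L2 :=
  weakD 0 ∘ₗ LinearMap.proj 0 + weakD 1 ∘ₗ LinearMap.proj 1

/-- `curl u = ∂₁ u₂ - ∂₂ u₁`. -/
def curlV : H1V →ₗ[ℂ] L2 :=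
  weakD 0 ∘ₗ LinearMap.proj 1 - weakD 1 ∘ₗ LinearMap.proj 0

/-- The gradient `∇p = (∂₁ p, ∂₂ p)`. -/
def grad (p : H1) : L2V := ![weakD 0 p, weakD 1 p]

/-- The rotated gradient `∇^⊥ p = (-∂₂ p, ∂₁ p)`. -/
def gradPerp (p : H1) : L2V := ![-weakD 1 p, weakD 0 p]

/-- `∫_{□ ∩ S} f · ḡ` for `f, g ∈ L²(□; ℂ²)`. -/
def dotOn (S : Set Plane) (f g : L2V) : ℂ := pairing S (f 0) (g 0) + pairing S (f 1) (g 1)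

/-- `∫_{□ ∩ S} (∇^⊥ u₁ · conj ∇φ₂ + ∇u₂ · conj ∇^⊥ φ₁)`. -/
def crossOn (S : Set Plane) (u φ : H1V) : ℂ :=
  dotOn S (gradPerp (u 0)) (grad (φ 1)) + dotOn S (grad (u 1)) (gradPerp (φ 0))

section Forms

variable (R : Set Plane) (ε₀ : ℝ)

/-- `c(u, φ) = ∫_□ u · φ̄ + γ ∫_R u₂ φ̄₂`, with `γ = ε₀ - 1`. -/
def cForm (u φ : L2V) : ℂ :=
  dotOn cell u φ + ((ε₀ - 1 : ℝ) : ℂ) * pairing R (u 1) (φ 1)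

/-- `a(u, φ) = ∫_{□ \ R} (div u conj (div φ) + curl u conj (curl φ))`. -/
def aForm (u φ : H1V) : ℂ :=
  pairing (cell \ R) (divV u) (divV φ) + pairing (cell \ R) (curlV u) (curlV φ)

/-- The form on the critical line,
`b(u, φ) = -1/2 ∫_{□ \ R} (∇^⊥ u₁ · conj ∇φ₂ + ∇u₂ · conj ∇^⊥ φ₁)
  + 1/γ ∫_R (∇u₁ · conj ∇φ₁ + ε₀ ∇u₂ · conj ∇φ₂
      + ∇^⊥ u₁ · conj ∇φ₂ + ∇u₂ · conj ∇^⊥ φ₁)`. -/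
def bForm (u φ : H1V) : ℂ :=
  -(1 / 2) * crossOn (cell \ R) u φ +
    1 / ((ε₀ - 1 : ℝ) : ℂ) *
      (dotOn R (grad (u 0)) (grad (φ 0)) + (ε₀ : ℂ) * dotOn R (grad (u 1)) (grad (φ 1))
        + crossOn R u φ)

/-- `b_ε(u, φ) = (√(1-ε) - 1)/ε ∫_{□ \ R} (∇^⊥ u₁ · conj ∇φ₂ + ∇u₂ · conj ∇^⊥ φ₁)
  + 1/(γ+ε) ∫_R (∇u₁ · conj ∇φ₁ + ε₀ ∇u₂ · conj ∇φ₂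
      + √(1-ε) (∇^⊥ u₁ · conj ∇φ₂ + ∇u₂ · conj ∇^⊥ φ₁))`. -/
def bEpsForm (ε : ℝ) (u φ : H1V) : ℂ :=
  (((Real.sqrt (1 - ε) - 1) / ε : ℝ) : ℂ) * crossOn (cell \ R) u φ +
    1 / ((ε₀ - 1 + ε : ℝ) : ℂ) *
      (dotOn R (grad (u 0)) (grad (φ 0)) + (ε₀ : ℂ) * dotOn R (grad (u 1)) (grad (φ 1))
        + (Real.sqrt (1 - ε) : ℂ) * crossOn R u φ)

/-- The form above the critical line, `ε⁻¹ a + b_ε`. -/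
def aboveForm (ε : ℝ) (u φ : H1V) : ℂ :=
  (ε : ℂ)⁻¹ * aForm R u φ + bEpsForm R ε₀ ε u φ

/-- A form on `H¹(□; ℂ²)` that is linear in its first argument. -/
def IsLinearFst (β : H1V → H1V → ℂ) : Prop :=
  (∀ u u' w, β (u + u') w = β u w + β u' w) ∧ ∀ (z : ℂ) u w, β (z • u) w = z * β u w

theorem grad_add (p q : H1) : grad (p + q) = grad p + grad q := by
  ext1 i; fin_cases i <;> simp [grad]

theorem grad_smul (z : ℂ) (p : H1) : grad (z • p) = z • grad p := by
  ext1 i; fin_cases i <;> simp [grad]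

theorem gradPerp_add (p q : H1) : gradPerp (p + q) = gradPerp p + gradPerp q := by
  ext1 i
  fin_cases i
  · change -weakD 1 (p + q) = -weakD 1 p + -weakD 1 q
    rw [map_add, neg_add]
  · change weakD 0 (p + q) = weakD 0 p + weakD 0 q
    rw [map_add]

theorem gradPerp_smul (z : ℂ) (p : H1) : gradPerp (z • p) = z • gradPerp p := by
  ext1 i; fin_cases i <;> simp [gradPerp]

theorem dotOn_add (S : Set Plane) (f f' g : L2V) :
    dotOn S (f + f') g = dotOn S f g + dotOn S f' g := by
  simp [dotOn]; ring

theorem dotOn_smul (S : Set Plane) (z : ℂ) (f g : L2V) :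
    dotOn S (z • f) g = z * dotOn S f g := by
  simp [dotOn]; ring

theorem crossOn_add (S : Set Plane) (u u' w : H1V) :
    crossOn S (u + u') w = crossOn S u w + crossOn S u' w := by
  simp only [crossOn, Pi.add_apply, grad_add, gradPerp_add, dotOn_add]; ring

theorem crossOn_smul (S : Set Plane) (z : ℂ) (u w : H1V) :
    crossOn S (z • u) w = z * crossOn S u w := by
  simp only [crossOn, Pi.smul_apply, grad_smul, gradPerp_smul, dotOn_smul]; ring

theorem bForm_linear : IsLinearFst (bForm R ε₀) :=
  ⟨fun u u' w => by
    simp only [bForm, Pi.add_apply, grad_add, crossOn_add, dotOn_add]; ring,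
  fun z u w => by
    simp only [bForm, Pi.smul_apply, grad_smul, crossOn_smul, dotOn_smul]; ring⟩

theorem aboveForm_linear (ε : ℝ) : IsLinearFst (aboveForm R ε₀ ε) :=
  ⟨fun u u' w => by
    simp only [aboveForm, aForm, bEpsForm, Pi.add_apply, grad_add, crossOn_add, dotOn_add,
      map_add, LinearMap.add_apply]; ring,
  fun z u w => by
    simp only [aboveForm, aForm, bEpsForm, Pi.smul_apply, grad_smul, crossOn_smul,
      dotOn_smul, map_smul, LinearMap.smul_apply, smul_eq_mul]; ring⟩

/-- `V(θ)`, the fields in `H¹_θ(□; ℂ²)` with `div v = curl v = 0` in `□ \ R`. -/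
def constrained (θ : Plane) : Submodule ℂ H1V where
  carrier := {v | v ∈ H1qp θ ∧
    ∀ᵐ y ∂cellMeasure, y ∈ cell \ R → divV v y = 0 ∧ curlV v y = 0}
  add_mem' := by
    rintro u v ⟨hu, hu'⟩ ⟨hv, hv'⟩
    refine ⟨add_mem hu hv, ?_⟩
    filter_upwards [hu', hv', Lp.coeFn_add (divV u) (divV v),
      Lp.coeFn_add (curlV u) (curlV v)] with y h1 h2 h3 h4 hy
    simp only [map_add, h3, h4, Pi.add_apply, (h1 hy).1, (h1 hy).2, (h2 hy).1, (h2 hy).2,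
      add_zero, and_self]
  zero_mem' := by
    refine ⟨zero_mem _, ?_⟩
    filter_upwards [Lp.coeFn_zero ℂ 2 cellMeasure] with y h _
    simp only [map_zero, h, Pi.zero_apply, and_self]
  smul_mem' := by
    rintro z u ⟨hu, hu'⟩
    refine ⟨Submodule.smul_mem _ z hu, ?_⟩
    filter_upwards [hu', Lp.coeFn_smul z (divV u), Lp.coeFn_smul z (curlV u)]
      with y h1 h2 h3 hy
    simp [map_smul, h2, h3, h1 hy]

/-- The graph of the operator generated by the form `β` with form domain `D` in the Hilbert
space `(closure of D in L²(□; ℂ²), c)`: `(v, f)` belongs to it iff `v ∈ D`, `f` is in the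
closure of `D`, and `β(v, w) = c(f, w)` for all `w ∈ D`. -/
def formOperator (D : Submodule ℂ H1V) (β : H1V → H1V → ℂ) (hβ : IsLinearFst β) :
    Submodule ℂ (L2V × L2V) where
  carrier := {x | ∃ v ∈ D, inclV v = x.1 ∧ x.2 ∈ (D.map inclV).topologicalClosure ∧
    ∀ w ∈ D, β v w = cForm R ε₀ x.2 (inclV w)}
  add_mem' := by
    rintro x y ⟨v, hv, h1, h2, h3⟩ ⟨v', hv', h1', h2', h3'⟩
    refine ⟨v + v', add_mem hv hv', by simp [h1, h1'], add_mem h2 h2', fun w hw => ?_⟩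
    rw [hβ.1, h3 w hw, h3' w hw]
    simp only [cForm, Prod.snd_add, dotOn_add, Pi.add_apply, map_add, LinearMap.add_apply]
    ring
  zero_mem' := by
    refine ⟨0, zero_mem _, by simp, zero_mem _, fun w _ => ?_⟩
    have := hβ.2 0 0 w
    simp only [smul_zero, zero_mul] at this
    simp [this, cForm, dotOn]
  smul_mem' := by
    rintro z x ⟨v, hv, h1, h2, h3⟩
    refine ⟨z • v, Submodule.smul_mem _ z hv, by simp [h1],
      Submodule.smul_mem _ z h2, fun w hw => ?_⟩
    rw [hβ.2, h3 w hw]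
    simp only [cForm, Prod.smul_snd, dotOn_smul, Pi.smul_apply, map_smul,
      LinearMap.smul_apply, smul_eq_mul]
    ring

/-- The operator `𝓑(θ)` on the critical line `k = 1`: generated by `b` on `V(θ)`. -/
def opCritical (θ : Plane) : Submodule ℂ (L2V × L2V) :=
  formOperator R ε₀ (constrained R θ) (bForm R ε₀) (bForm_linear R ε₀)

/-- The operator `𝓑_ε(θ)` on the line `k = √(1-ε)`: generated by `ε⁻¹ a + b_ε` on
`H¹_θ(□; ℂ²)`. -/
def opAbove (ε : ℝ) (θ : Plane) : Submodule ℂ (L2V × L2V) :=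
  formOperator R ε₀ (H1qp θ) (aboveForm R ε₀ ε) (aboveForm_linear R ε₀ ε)

end Forms

/-! ### Eigenvalues and Bloch spectra -/

/-- The eigenspace `{u | T u = μ u}` of an operator given by its graph. -/
def eigenspace (T : Submodule ℂ (L2V × L2V)) (μ : ℝ) : Submodule ℂ L2V :=
  T.comap (LinearMap.prod LinearMap.id ((μ : ℂ) • LinearMap.id))

/-- `l 0 ≤ l 1 ≤ …` are the eigenvalues of `T`, listed in non-decreasing order and repeated
according to their (finite) multiplicities, and they tend to infinity. -/
structure IsEigenvalueSeq (T : Submodule ℂ (L2V × L2V)) (l : ℕ → ℝ) : Prop where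
  mono : Monotone l
  tendsto : Tendsto l atTop atTop
  finite : ∀ μ : ℝ, FiniteDimensional ℂ (eigenspace T μ)
  mult : ∀ μ : ℝ, {n | l n = μ}.ncard = Module.finrank ℂ (eigenspace T μ)

/-- The closure of the union over `θ ∈ □*` of the sets of eigenvalues of the `T θ`. -/
def blochSpectrum (T : Plane → Submodule ℂ (L2V × L2V)) : Set ℝ :=
  closure (⋃ θ ∈ dualCell, {μ : ℝ | eigenspace (T θ) μ ≠ ⊥})

/-- `dist(X, Y) = sup_{x ∈ X} dist(x, Y)`; it is `0` if `X` or `Y` is empty (note that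
`Metric.infDist x ∅ = 0`). -/
def distFrom (X Y : Set ℝ) : ℝ≥0∞ := ⨆ x ∈ X, ENNReal.ofReal (Metric.infDist x Y)

/-- `d_{[a,b]}(X, Y) = max {dist([a,b] ∩ X, Y), dist([a,b] ∩ Y, X)}`. -/
def localDist (a b : ℝ) (X Y : Set ℝ) : ℝ≥0∞ :=
  max (distFrom (Set.Icc a b ∩ X) Y) (distFrom (Set.Icc a b ∩ Y) X)

end PCF

end

/-!
The two eigenvalue problems are compared through the resolvents at `-1` of their operators.

*Reduction to bounded operators.* The Fourier basis of `L²(□)` gives an isometric parametrisation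
of `H¹_θ(□; ℂ²)`, with its `H¹` norm, by the Hilbert space `W = L²(□; ℂ²)` (`embedV`,
`mem_H1qp_iff`, `sq_norm_embedOp_add`). The embedding `J` into `L²` with the inner product `c`
becomes a compact operator, and `a`, `b`, `b_ε` become bounded symmetric operators `𝒜`, `B`, `B_ε`
on `W`; the space `V(θ)` becomes a closed subspace `K`, on which `𝒜` vanishes. For a coercive
operator `A` representing `β + c`, the solution operator `S = J A⁻¹ J†` is compact, positive, of
norm at most one, and its eigenspace at `1 / (μ + 1)` is the eigenspace at `μ` of the operator
generated by `β` (`IsFormRealization.map_eigenspace`).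

*Eigenvalues as approximation numbers.* The approximation numbers of a compact positive operator
are its positive eigenvalues in decreasing order with multiplicity (`ncard_approxNumber_eq`), and
they are `1`-Lipschitz in the operator norm (`abs_approxNumber_sub_le`). They do not vanish when
the form domain is infinite-dimensional, which for `V(θ)` holds because the divergence may be
prescribed in `R` up to a one-dimensional constraint (`not_finiteDimensional_constrainedSub`). So
everything about individual eigenvalues follows from `‖S_ε(θ) - S(θ)‖ ≤ C ε`, uniformly in `θ`.

*The norm estimate.* Two facts make the singular perturbation `ε⁻¹ a + b_ε` tractable
(`norm_solutionOp_sub_le`).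
First, coercivity is uniform (`le_re_inner_add_bOp`). Outside `R`, where `b` and `b_ε` contribute
`-s X` with `1/2 ≤ s ≤ 1`, the pointwise identity `|div u|² + |curl u|² = |∇u|² + X(u, u)` gives
`α (|div u|² + |curl u|²) - s X(u, u) ≥ s |∇u|²` for every `α ≥ s`, in particular for `α = ε⁻¹`;
on `V(θ)` the left-hand side is the contribution of `b` alone. Inside `R` the integrand is definite
because the quadratic form `x² + ε₀ y² - 2 x y` is, as `ε₀ > 1`.
Second, `a` controls the squared distance to `V(θ)` (`exists_constrained_near`). Given `h`, the
div-curl problem is solved on the torus with the divergence and curl of `h` outside `R` as data,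
extended into `R` by multiples of the lowest Bloch mode. The extension makes the lowest Fourier
coefficient of the data vanish; this is the only mode in which the problem is not solvable with
bounds uniform in `θ`, and it is here that `R` must have positive measure.
The energy estimate then shows that the solution of the perturbed problem is `O(ε)`-close to
`V(θ)`, and on `V(θ)` the two problems differ by `B - B_ε = O(ε)`.

*Bloch spectra.* The spectra are closures of the ranges of the eigenvalue sequences. Closeness of
the numbers `1 / (λ + 1)` gives closeness of the eigenvalues below a fixed `b` when `ε` is small.
For larger `ε` it is used that `0` belongs to both spectra, since constant fields are eigenvectors
at `θ = 0` (`infDist_closure_le`).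
-/

noncomputable section

namespace PCF

/-! ### Approximation numbers and eigenvalues of compact positive operators -/

section Spectral

variable {E : Type*} [NormedAddCommGroup E] [InnerProductSpace ℂ E]

/-- The admissible bounds in the definition of the `n`-th approximation number: `S` is bounded
by `q` on the orthogonal complement of a subspace of dimension at most `n`. -/
def approxSet (S : E →L[ℂ] E) (n : ℕ) : Set ℝ :=
  {q | 0 ≤ q ∧ ∃ K : Submodule ℂ E, FiniteDimensional ℂ K ∧ Module.finrank ℂ K ≤ n ∧
    ∀ x ∈ Kᗮ, ‖S x‖ ≤ q * ‖x‖}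

/-- The `n`-th approximation number of a bounded operator (counted from `0`). For a compact
positive operator it is the `n`-th eigenvalue in decreasing order. -/
def approxNumber (S : E →L[ℂ] E) (n : ℕ) : ℝ := sInf (approxSet S n)

theorem norm_mem_approxSet (S : E →L[ℂ] E) (n : ℕ) : ‖S‖ ∈ approxSet S n :=
  ⟨norm_nonneg _, ⊥, inferInstance, by simp, fun x _ => S.le_opNorm x⟩

theorem bddBelow_approxSet (S : E →L[ℂ] E) (n : ℕ) : BddBelow (approxSet S n) :=
  ⟨0, fun _ h => h.1⟩

theorem approxNumber_nonneg (S : E →L[ℂ] E) (n : ℕ) : 0 ≤ approxNumber S n :=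
  le_csInf ⟨_, norm_mem_approxSet S n⟩ fun _ h => h.1

theorem approxNumber_le_norm (S : E →L[ℂ] E) (n : ℕ) : approxNumber S n ≤ ‖S‖ :=
  csInf_le (bddBelow_approxSet S n) (norm_mem_approxSet S n)

theorem approxNumber_antitone (S : E →L[ℂ] E) : Antitone (approxNumber S) := by
  intro m n h
  refine csInf_le_csInf (bddBelow_approxSet S n) ⟨_, norm_mem_approxSet S m⟩ ?_
  rintro q ⟨h0, K, hK, hd, hq⟩
  exact ⟨h0, K, hK, hd.trans h, hq⟩

theorem approxNumber_le_add (S T : E →L[ℂ] E) (n : ℕ) :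
    approxNumber T n ≤ approxNumber S n + ‖T - S‖ := by
  rw [← sub_le_iff_le_add]
  refine le_csInf ⟨_, norm_mem_approxSet S n⟩ ?_
  rintro q ⟨h0, K, hK, hd, hq⟩
  rw [sub_le_iff_le_add]
  refine csInf_le (bddBelow_approxSet T n) ⟨by positivity, K, hK, hd, fun x hx => ?_⟩
  calc ‖T x‖ = ‖S x + (T - S) x‖ := by simp
    _ ≤ ‖S x‖ + ‖(T - S) x‖ := norm_add_le _ _
    _ ≤ q * ‖x‖ + ‖T - S‖ * ‖x‖ := add_le_add (hq x hx) ((T - S).le_opNorm x)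
    _ = _ := by ring

/-- Approximation numbers are Lipschitz in the operator norm. -/
theorem abs_approxNumber_sub_le (S T : E →L[ℂ] E) (n : ℕ) :
    |approxNumber S n - approxNumber T n| ≤ ‖S - T‖ := by
  rw [abs_sub_le_iff]
  constructor
  · linarith [approxNumber_le_add T S n]
  · have := approxNumber_le_add S T n
    rw [norm_sub_rev] at this
    linarith

/-- An operator bounded below on a subspace of dimension greater than `n` has a large `n`-th
approximation number: such a subspace meets every orthogonal complement of an `n`-dimensional
space. -/
theorem le_approxNumber (S : E →L[ℂ] E) {n : ℕ} {δ : ℝ} (M : Submodule ℂ E)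
    [FiniteDimensional ℂ M] (hn : n < Module.finrank ℂ M) (h : ∀ x ∈ M, δ * ‖x‖ ≤ ‖S x‖) :
    δ ≤ approxNumber S n := by
  refine le_csInf ⟨_, norm_mem_approxSet S n⟩ ?_
  rintro q ⟨-, K, hK, hd, hq⟩
  have hker := LinearMap.ker_ne_bot_of_finrank_lt
    (f := (K.orthogonalProjectionOnto.comp M.subtypeL).toLinearMap) (hd.trans_lt hn)
  obtain ⟨x, hx, hx0⟩ := Submodule.exists_mem_ne_zero_of_ne_bot hker
  have hxK : (x : E) ∈ Kᗮ := by
    rw [← Submodule.orthogonalProjectionOnto_eq_zero_iff]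
    exact hx
  have hpos : 0 < ‖(x : E)‖ := by simpa using hx0
  exact le_of_mul_le_mul_right ((h x x.2).trans (hq x hxK)) hpos

/-- The sum of the eigenspaces of `S` for the real eigenvalues in `I`. -/
def spectralSubspace (S : E →L[ℂ] E) (I : Set ℝ) : Submodule ℂ E :=
  ⨆ ν : I, Module.End.eigenspace (S : E →ₗ[ℂ] E) ((ν : ℝ) : ℂ)

theorem spectralSubspace_mono (S : E →L[ℂ] E) {I I' : Set ℝ} (h : I ⊆ I') :
    spectralSubspace S I ≤ spectralSubspace S I' :=
  iSup_le fun ν => le_iSup (fun ν : I' => Module.End.eigenspace (S : E →ₗ[ℂ] E) ((ν : ℝ) : ℂ))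
    ⟨ν, h ν.2⟩

theorem eigenspace_le_spectralSubspace (S : E →L[ℂ] E) {I : Set ℝ} {ν : ℝ} (h : ν ∈ I) :
    Module.End.eigenspace (S : E →ₗ[ℂ] E) (ν : ℂ) ≤ spectralSubspace S I :=
  le_iSup (fun ν : I => Module.End.eigenspace (S : E →ₗ[ℂ] E) ((ν : ℝ) : ℂ)) ⟨ν, h⟩

theorem spectralSubspace_invariant (S : E →L[ℂ] E) (I : Set ℝ) {x : E}
    (hx : x ∈ spectralSubspace S I) : S x ∈ spectralSubspace S I := by
  refine Submodule.iSup_induction _ (motive := fun x => S x ∈ spectralSubspace S I) hx ?_ ?_ ?_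
  · intro ν x hx
    have h := Module.End.mem_eigenspace_iff.1 hx
    have h' : S x = ((ν : ℝ) : ℂ) • x := h
    rw [h']
    exact Submodule.smul_mem _ _ (eigenspace_le_spectralSubspace S ν.2 hx)
  · simp
  · intro x y hx hy
    rw [map_add]
    exact add_mem hx hy

theorem orthogonalFamily_real (S : E →L[ℂ] E) (hS : S.toLinearMap.IsSymmetric) (I : Set ℝ) :
    OrthogonalFamily ℂ (fun ν : I => Module.End.eigenspace (S : E →ₗ[ℂ] E) ((ν : ℝ) : ℂ))
      fun ν => (Module.End.eigenspace (S : E →ₗ[ℂ] E) ((ν : ℝ) : ℂ)).subtypeₗᵢ :=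
  hS.orthogonalFamily_eigenspaces.comp (γ := I) (f := fun ν => ((ν : ℝ) : ℂ))
    (Complex.ofReal_injective.comp Subtype.val_injective)

theorem le_re_inner_of_mem_spectralSubspace (S : E →L[ℂ] E) (hS : S.toLinearMap.IsSymmetric)
    {I : Set ℝ} {t : ℝ} (hI : ∀ ν ∈ I, t ≤ ν) {x : E} (hx : x ∈ spectralSubspace S I) :
    t * ‖x‖ ^ 2 ≤ (inner ℂ (S x) x).re := by
  classical
  obtain ⟨f, hf, rfl⟩ := (Submodule.mem_iSup_iff_exists_finsupp _ _).1 hx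
  have hfam := orthogonalFamily_real S hS I
  have hsum : (f.sum fun _ x => x) = ∑ ν ∈ f.support,
      (Module.End.eigenspace (S : E →ₗ[ℂ] E) ((ν : ℝ) : ℂ)).subtypeₗᵢ ⟨f ν, hf ν⟩ := rfl
  have hSs : S (f.sum fun _ x => x) = ∑ ν ∈ f.support,
      (Module.End.eigenspace (S : E →ₗ[ℂ] E) ((ν : ℝ) : ℂ)).subtypeₗᵢ
        (((ν : ℝ) : ℂ) • ⟨f ν, hf ν⟩) := by
    rw [hsum, map_sum]
    refine Finset.sum_congr rfl fun ν _ => ?_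
    exact Module.End.mem_eigenspace_iff.1 (hf ν)
  have h1 := hfam.norm_sum (fun ν => ⟨f ν, hf ν⟩) f.support
  have h2 := hfam.inner_sum (fun ν => ((ν : ℝ) : ℂ) • ⟨f ν, hf ν⟩) (fun ν => ⟨f ν, hf ν⟩) f.support
  rw [hSs, hsum, h1, h2, Complex.re_sum, Finset.mul_sum]
  refine Finset.sum_le_sum fun ν _ => ?_
  rw [inner_smul_left, inner_self_eq_norm_sq_to_K, Complex.conj_ofReal]
  have e : (((ν : ℝ) : ℂ) * ((‖(⟨f ν, hf ν⟩ : Module.End.eigenspace (S : E →ₗ[ℂ] E)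
      ((ν : ℝ) : ℂ))‖ : ℂ)) ^ 2).re = ν * ‖f ν‖ ^ 2 := by
    rw [Submodule.coe_norm]
    norm_cast
  refine le_trans ?_ e.ge
  exact mul_le_mul_of_nonneg_right (hI ν ν.2) (sq_nonneg _)

theorem le_norm_of_mem_spectralSubspace (S : E →L[ℂ] E) (hS : S.toLinearMap.IsSymmetric)
    {I : Set ℝ} {t : ℝ} (hI : ∀ ν ∈ I, t ≤ ν) {x : E} (hx : x ∈ spectralSubspace S I) :
    t * ‖x‖ ≤ ‖S x‖ := by
  rcases eq_or_ne x 0 with rfl | h0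
  · simp
  have hpos : 0 < ‖x‖ := norm_pos_iff.2 h0
  refine le_of_mul_le_mul_right ?_ hpos
  calc t * ‖x‖ * ‖x‖ = t * ‖x‖ ^ 2 := by ring
    _ ≤ (inner ℂ (S x) x).re := le_re_inner_of_mem_spectralSubspace S hS hI hx
    _ ≤ ‖inner ℂ (S x) x‖ := Complex.re_le_norm _
    _ ≤ ‖S x‖ * ‖x‖ := norm_inner_le_norm _ _

theorem approxNumber_pos (S : E →L[ℂ] E) {n : ℕ} (M : Submodule ℂ E)
    [FiniteDimensional ℂ M] (hn : n < Module.finrank ℂ M) (h : ∀ x ∈ M, S x = 0 → x = 0) :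
    0 < approxNumber S n := by
  have hker : LinearMap.ker (S.toLinearMap ∘ₗ M.subtype) = ⊥ := by
    rw [LinearMap.ker_eq_bot']
    intro x hx
    exact Subtype.ext (h x x.2 hx)
  obtain ⟨K, hK, hanti⟩ := LinearMap.exists_antilipschitzWith _ hker
  refine lt_of_lt_of_le (inv_pos.2 (NNReal.coe_pos.2 hK)) (le_approxNumber S M hn fun x hx => ?_)
  have := hanti.le_mul_dist ⟨x, hx⟩ 0
  rw [map_zero, dist_zero_right, dist_zero_right] at this
  rw [inv_mul_le_iff₀ (NNReal.coe_pos.2 hK)]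
  exact this

variable [CompleteSpace E]

/-- On the closure of a spectral subspace for eigenvalues `≥ t > 0` the compact operator `S` is
invertible, so that subspace is finite-dimensional. -/
theorem finiteDimensional_spectralSubspace (S : E →L[ℂ] E) (hS : S.toLinearMap.IsSymmetric)
    (hc : IsCompactOperator S) {I : Set ℝ} {t : ℝ} (ht : 0 < t) (hI : ∀ ν ∈ I, t ≤ ν) :
    FiniteDimensional ℂ (spectralSubspace S I) := by
  set F := (spectralSubspace S I).topologicalClosure with hF
  have hFcl : IsClosed (F : Set E) := Submodule.isClosed_topologicalClosure _
  have : CompleteSpace F := hFcl.completeSpace_coe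
  have hinv : ∀ x ∈ F, S x ∈ F := by
    intro x hx
    exact map_mem_closure S.continuous hx fun y hy => spectralSubspace_invariant S I hy
  have hlow : ∀ x ∈ F, t * ‖x‖ ^ 2 ≤ (inner ℂ (S x) x).re := by
    intro x hx
    have hcl : IsClosed {x : E | t * ‖x‖ ^ 2 ≤ (inner ℂ (S x) x).re} :=
      isClosed_le (by fun_prop)
        (Complex.continuous_re.comp (S.continuous.inner continuous_id))
    exact closure_minimal (fun y hy => le_re_inner_of_mem_spectralSubspace S hS hI hy) hcl hx
  let T : F →L[ℂ] F := S.restrict hinv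
  have hT : IsCompactOperator T := hc.restrict' hinv
  have hu : IsUnit T := by
    refine ContinuousLinearMap.isUnit_of_forall_le_norm_inner_map T (c := ⟨t, ht.le⟩)
      (by exact_mod_cast ht) fun x => ?_
    have := hlow x x.2
    refine le_trans ?_ (Complex.re_le_norm _)
    change ‖(x : E)‖ ^ 2 * t ≤ _
    rw [mul_comm]
    exact this
  obtain ⟨u, hu⟩ := hu
  have hid : IsCompactOperator (id : F → F) := by
    have h1 := hT.comp_clm (↑u⁻¹ : F →L[ℂ] F)
    have h2 : (T ∘ (↑u⁻¹ : F →L[ℂ] F) : F → F) = id := by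
      funext x
      have : (T * (↑u⁻¹ : F →L[ℂ] F)) x = x := by rw [← hu, Units.mul_inv]; rfl
      exact this
    rwa [h2] at h1
  have hfd : FiniteDimensional ℂ F := FiniteDimensional.of_isCompactOperator_id (𝕜 := ℂ) hid
  exact Submodule.finiteDimensional_of_le (Submodule.le_topologicalClosure _)

/-- On the complement of the spectral subspace for `[t, ∞)`, the norm of a compact positive
operator is less than `t`, since it is attained at an eigenvalue. -/
theorem exists_lt_norm_le_on_orthogonal (S : E →L[ℂ] E) (hS : S.toLinearMap.IsSymmetric)
    (hc : IsCompactOperator S) (hp : ∀ x, 0 ≤ (inner ℂ (S x) x).re) {t : ℝ} (ht : 0 < t) :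
    ∃ q, 0 ≤ q ∧ q < t ∧ ∀ x ∈ (spectralSubspace S (Set.Ici t))ᗮ, ‖S x‖ ≤ q * ‖x‖ := by
  set F := (spectralSubspace S (Set.Ici t))ᗮ with hF
  have hinv : ∀ x ∈ F, S x ∈ F := by
    intro x hx y hy
    have h1 : inner ℂ y (S x) = inner ℂ (S y) x := (hS y x).symm
    rw [h1]
    exact hx _ (spectralSubspace_invariant S _ hy)
  let T : F →L[ℂ] F := S.restrict hinv
  have hT : IsCompactOperator T := hc.restrict' hinv
  have hTs : T.toLinearMap.IsSymmetric := fun x y => hS x y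
  refine ⟨‖T‖, T.opNorm_nonneg, ?_, fun x hx => T.le_opNorm ⟨x, hx⟩⟩
  rcases subsingleton_or_nontrivial F with h | h
  · have : T = 0 := Subsingleton.elim _ _
    rw [this]
    exact ContinuousLinearMap.opNorm_zero.trans_lt ht
  obtain ⟨k, hk, hk'⟩ := spectrum.exists_nnnorm_eq_spectralRadius T
  rw [T.spectralRadius_eq_nnnorm hTs.isSelfAdjoint] at hk'
  have hnorm : ‖k‖ = ‖T‖ := by
    have : ‖k‖₊ = ‖T‖₊ := by exact_mod_cast hk'
    exact congrArg NNReal.toReal this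
  rcases eq_or_ne k 0 with rfl | hk0
  · rw [← hnorm, norm_zero]; exact ht
  have hev : Module.End.HasEigenvalue (T : Module.End ℂ F) k :=
    (hT.hasEigenvalue_iff_mem_spectrum hk0).2 hk
  have hreal : conj k = k := hTs.conj_eigenvalue_eq_self hev
  obtain ⟨r, rfl⟩ : ∃ r : ℝ, (r : ℂ) = k := ⟨k.re, Complex.conj_eq_iff_re.1 hreal⟩
  obtain ⟨x, hx, hx0⟩ := hev.exists_hasEigenvector
  have hSx : S (x : E) = (r : ℂ) • (x : E) := congrArg Subtype.val (Module.End.mem_eigenspace_iff.1 hx)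
  have hr0 : 0 ≤ r := by
    have := hp x
    rw [hSx, inner_smul_left, inner_self_eq_norm_sq_to_K, Complex.conj_ofReal] at this
    have e : ((r : ℂ) * ((‖(x : E)‖ : ℂ)) ^ 2).re = r * ‖(x : E)‖ ^ 2 := by norm_cast
    have h2 : 0 ≤ r * ‖(x : E)‖ ^ 2 := this.trans_eq e
    have h3 : 0 < ‖(x : E)‖ ^ 2 := by
      have : 0 < ‖(x : E)‖ := by simpa using hx0
      positivity
    exact nonneg_of_mul_nonneg_left h2 h3
  rw [← hnorm, Complex.norm_real, Real.norm_of_nonneg hr0]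
  by_contra! hlt
  have hmem : (x : E) ∈ spectralSubspace S (Set.Ici t) :=
    eigenspace_le_spectralSubspace S (Set.mem_Ici.2 hlt) (Module.End.mem_eigenspace_iff.2 hSx)
  have := x.2 _ hmem
  rw [inner_self_eq_zero] at this
  exact hx0 (Subtype.ext this)

theorem approxNumber_lt_iff (S : E →L[ℂ] E) (hS : S.toLinearMap.IsSymmetric)
    (hc : IsCompactOperator S) (hp : ∀ x, 0 ≤ (inner ℂ (S x) x).re) {t : ℝ} (ht : 0 < t) (n : ℕ) :
    approxNumber S n < t ↔ Module.finrank ℂ (spectralSubspace S (Set.Ici t)) ≤ n := by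
  have := finiteDimensional_spectralSubspace S hS hc ht (I := Set.Ici t) fun ν h => h
  constructor
  · intro h
    by_contra! hn
    exact h.not_ge (le_approxNumber S _ hn fun x hx =>
      le_norm_of_mem_spectralSubspace S hS (fun ν h => h) hx)
  · intro hn
    obtain ⟨q, hq0, hqt, hq⟩ := exists_lt_norm_le_on_orthogonal S hS hc hp ht
    exact (csInf_le (bddBelow_approxSet S n) ⟨hq0, _, this, hn, hq⟩).trans_lt hqt

theorem tendsto_approxNumber (S : E →L[ℂ] E) (hS : S.toLinearMap.IsSymmetric)
    (hc : IsCompactOperator S) (hp : ∀ x, 0 ≤ (inner ℂ (S x) x).re) :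
    Tendsto (approxNumber S) atTop (𝓝 0) := by
  refine tendsto_order.2 ⟨fun a ha => Eventually.of_forall fun n =>
    ha.trans_le (approxNumber_nonneg S n), fun t ht => ?_⟩
  filter_upwards [eventually_ge_atTop (Module.finrank ℂ (spectralSubspace S (Set.Ici t)))] with n hn
  exact (approxNumber_lt_iff S hS hc hp ht n).2 hn

/-- The eigenvalues above `t > 0` stay away from `t`. -/
theorem exists_gt_spectralSubspace_Ioi_eq (S : E →L[ℂ] E) (hS : S.toLinearMap.IsSymmetric)
    (hc : IsCompactOperator S) {t : ℝ} (ht : 0 < t) :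
    ∃ t' > t, spectralSubspace S (Set.Ioi t) = spectralSubspace S (Set.Ici t') := by
  have := finiteDimensional_spectralSubspace S hS hc ht (I := Set.Ici t) fun ν h => h
  let D : Set ℕ := {d | ∃ t' > t, Module.finrank ℂ (spectralSubspace S (Set.Ici t')) = d}
  have hle : ∀ s, t ≤ s → spectralSubspace S (Set.Ici s) ≤ spectralSubspace S (Set.Ici t) :=
    fun s hs => spectralSubspace_mono S (Set.Ici_subset_Ici.2 hs)
  have hbdd : BddAbove D := by
    refine ⟨Module.finrank ℂ (spectralSubspace S (Set.Ici t)), ?_⟩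
    rintro d ⟨s, hs, rfl⟩
    exact Submodule.finrank_mono (hle s (le_of_lt hs))
  -- the level `t'` is chosen so that the dimension is maximal
  obtain ⟨t', ht', hmax⟩ : sSup D ∈ D := Nat.sSup_mem ⟨_, t + 1, lt_add_one t, rfl⟩ hbdd
  refine ⟨t', ht', le_antisymm (iSup_le fun ν => ?_)
    (spectralSubspace_mono S fun ν hν => lt_of_lt_of_le ht' hν)⟩
  have hm : t < min (ν : ℝ) t' := lt_min ν.2 ht'
  have : FiniteDimensional ℂ (spectralSubspace S (Set.Ici (min (ν : ℝ) t'))) :=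
    Submodule.finiteDimensional_of_le (hle _ hm.le)
  have heq := Submodule.eq_of_le_of_finrank_le
    (spectralSubspace_mono S (Set.Ici_subset_Ici.2 (min_le_right (ν : ℝ) t')))
    ((le_csSup hbdd ⟨_, hm, rfl⟩).trans hmax.ge)
  rw [heq]
  exact eigenspace_le_spectralSubspace S (Set.mem_Ici.2 (min_le_left _ _))

theorem finrank_spectralSubspace_Ici (S : E →L[ℂ] E) (hS : S.toLinearMap.IsSymmetric)
    (hc : IsCompactOperator S) {t : ℝ} (ht : 0 < t) :
    Module.finrank ℂ (spectralSubspace S (Set.Ici t)) =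
      Module.finrank ℂ (spectralSubspace S (Set.Ioi t)) +
        Module.finrank ℂ (Module.End.eigenspace (S : E →ₗ[ℂ] E) (t : ℂ)) := by
  have := finiteDimensional_spectralSubspace S hS hc ht (I := Set.Ici t) fun ν h => h
  have := finiteDimensional_spectralSubspace S hS hc ht (I := Set.Ioi t) fun ν h => le_of_lt h
  have : FiniteDimensional ℂ (Module.End.eigenspace (S : E →ₗ[ℂ] E) (t : ℂ)) :=
    ContinuousLinearMap.finite_dimensional_eigenspace hc _ (by exact_mod_cast ht.ne')
  have hsup : spectralSubspace S (Set.Ici t) = spectralSubspace S (Set.Ioi t) ⊔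
      Module.End.eigenspace (S : E →ₗ[ℂ] E) (t : ℂ) := by
    refine le_antisymm (iSup_le fun ν => ?_) (sup_le (spectralSubspace_mono S Set.Ioi_subset_Ici_self)
      (eigenspace_le_spectralSubspace S Set.self_mem_Ici))
    rcases eq_or_lt_of_le (show t ≤ ν from ν.2) with h | h
    · rw [← h]; exact le_sup_right
    · exact (eigenspace_le_spectralSubspace S (I := Set.Ioi t) h).trans le_sup_left
  have hdisj : spectralSubspace S (Set.Ioi t) ⊓
      Module.End.eigenspace (S : E →ₗ[ℂ] E) (t : ℂ) = ⊥ := by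
    rw [← disjoint_iff]
    refine Submodule.IsOrtho.disjoint ?_
    rw [Submodule.isOrtho_iff_le]
    refine iSup_le fun ν x hx y hy => ?_
    have hne : ((t : ℝ) : ℂ) ≠ ((ν : ℝ) : ℂ) := by
      exact_mod_cast (show t < ν from ν.2).ne
    exact hS.orthogonalFamily_eigenspaces hne ⟨y, hy⟩ ⟨x, hx⟩
  have := Submodule.finrank_sup_add_finrank_inf_eq (spectralSubspace S (Set.Ioi t))
    (Module.End.eigenspace (S : E →ₗ[ℂ] E) (t : ℂ))
  rw [hdisj, finrank_bot, add_zero] at this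
  rw [hsup, this]

/-- Every positive number is taken by the approximation numbers of a compact positive operator as
often as its multiplicity as an eigenvalue. -/
theorem ncard_approxNumber_eq (S : E →L[ℂ] E) (hS : S.toLinearMap.IsSymmetric)
    (hc : IsCompactOperator S) (hp : ∀ x, 0 ≤ (inner ℂ (S x) x).re) {t : ℝ} (ht : 0 < t) :
    {n | approxNumber S n = t}.ncard =
      Module.finrank ℂ (Module.End.eigenspace (S : E →ₗ[ℂ] E) (t : ℂ)) := by
  obtain ⟨t', ht', e⟩ := exists_gt_spectralSubspace_Ioi_eq S hS hc ht
  have hset : {n | approxNumber S n = t} =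
      (Finset.Ico (Module.finrank ℂ (spectralSubspace S (Set.Ioi t)))
        (Module.finrank ℂ (spectralSubspace S (Set.Ici t))) : Finset ℕ) := by
    ext n
    rw [Set.mem_ofPred_eq, Finset.coe_Ico, Set.mem_Ico]
    constructor
    · intro h
      refine ⟨?_, ?_⟩
      · rw [e, ← approxNumber_lt_iff S hS hc hp (ht.trans ht'), h]; exact ht'
      · rw [← not_le, ← approxNumber_lt_iff S hS hc hp ht, h]; exact lt_irrefl _
    · rintro ⟨h1, h2⟩
      refine le_antisymm ?_ ?_
      · by_contra! hlt
        have hm : t < min (approxNumber S n) t' := lt_min hlt ht'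
        have h3 : spectralSubspace S (Set.Ici (min (approxNumber S n) t')) ≤
            spectralSubspace S (Set.Ioi t) :=
          spectralSubspace_mono S fun ν hν => hm.trans_le hν
        have := finiteDimensional_spectralSubspace S hS hc ht (I := Set.Ioi t)
          fun ν h => le_of_lt h
        have h4 := (Submodule.finrank_mono h3).trans h1
        rw [← approxNumber_lt_iff S hS hc hp (ht.trans hm)] at h4
        exact absurd h4 (not_lt.2 (min_le_left _ _))
      · rw [← not_lt, approxNumber_lt_iff S hS hc hp ht]; exact not_le.2 h2
  rw [hset, Set.ncard_coe_finset, Nat.card_Ico, finrank_spectralSubspace_Ici S hS hc ht]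
  omega

end Spectral

/-! ### Solution operators of coercive forms -/

section Resolvent

variable {W E : Type*} [NormedAddCommGroup W] [InnerProductSpace ℂ W]
  [NormedAddCommGroup E] [InnerProductSpace ℂ E]

open ContinuousLinearMap (adjoint adjoint_inner_left adjoint_inner_right)

theorem re_inner_le (x y : W) : (inner ℂ x y).re ≤ ‖x‖ * ‖y‖ :=
  (Complex.re_le_norm _).trans (norm_inner_le_norm _ _)

theorem injective_of_isUnit {A : W →L[ℂ] W} (hA : IsUnit A) : Function.Injective A := by
  intro x y hxy
  have h : Ring.inverse A * A = 1 := Ring.inverse_mul_cancel A hA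
  have h1 : Ring.inverse A (A x) = x := congrArg (fun T : W →L[ℂ] W => T x) h
  have h2 : Ring.inverse A (A y) = y := congrArg (fun T : W →L[ℂ] W => T y) h
  rw [← h1, ← h2, hxy]

variable [CompleteSpace W]

theorem isUnit_of_coercive {A : W →L[ℂ] W} {κ : ℝ} (hκ : 0 < κ)
    (h : ∀ x, κ * ‖x‖ ^ 2 ≤ (inner ℂ x (A x)).re) : IsUnit A := by
  refine ContinuousLinearMap.isUnit_of_forall_le_norm_inner_map A (c := ⟨κ, hκ.le⟩)
    (by exact_mod_cast hκ) fun x => ?_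
  rw [norm_inner_symm]
  refine le_trans ?_ (Complex.re_le_norm _)
  change ‖x‖ ^ 2 * κ ≤ _
  rw [mul_comm]
  exact h x

/-- `A` is symmetric and coercive, it dominates `J† J`, and `J` is compact. -/
structure IsCoercivePair (J : W →L[ℂ] E) (A : W →L[ℂ] W) : Prop where
  compact : IsCompactOperator J
  symm : A.toLinearMap.IsSymmetric
  coercive : ∃ κ > 0, ∀ h, κ * ‖h‖ ^ 2 ≤ (inner ℂ h (A h)).re
  dominates : ∀ h, ‖J h‖ ^ 2 ≤ (inner ℂ h (A h)).re

theorem IsCoercivePair.isUnit {J : W →L[ℂ] E} {A : W →L[ℂ] W} (hJA : IsCoercivePair J A) :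
    IsUnit A := by
  obtain ⟨κ, hκ, h⟩ := hJA.coercive
  exact isUnit_of_coercive hκ h

variable [CompleteSpace E]

/-- The solution operator `f ↦ J h`, where `⟪g, A h⟫ = ⟪J g, f⟫` for all `g`. If `A` represents
the form `β + c` on a form domain parametrised by `W`, and `J` the embedding of the form domain,
this is the resolvent at `-1` of the operator generated by `β`. -/
def solutionOp (J : W →L[ℂ] E) (A : W →L[ℂ] W) : E →L[ℂ] E :=
  J ∘L Ring.inverse A ∘L adjoint J

theorem exists_solution (J : W →L[ℂ] E) {A : W →L[ℂ] W} (hA : IsUnit A) (f : E) :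
    ∃ h, A h = adjoint J f ∧ solutionOp J A f = J h := by
  refine ⟨Ring.inverse A (adjoint J f), ?_, rfl⟩
  have : A * Ring.inverse A = 1 := Ring.mul_inverse_cancel A hA
  exact congrArg (fun T : W →L[ℂ] W => T (adjoint J f)) this

theorem solutionOp_eq (J : W →L[ℂ] E) {A : W →L[ℂ] W} (hA : IsUnit A) {f : E} {h : W}
    (hh : A h = adjoint J f) : solutionOp J A f = J h := by
  obtain ⟨h', h1, h2⟩ := exists_solution J hA f
  rw [h2, injective_of_isUnit hA (h1.trans hh.symm)]

namespace IsCoercivePair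

variable {J : W →L[ℂ] E} {A : W →L[ℂ] W}

theorem isCompactOperator_solutionOp (hJA : IsCoercivePair J A) :
    IsCompactOperator (solutionOp J A) :=
  hJA.compact.comp_clm (Ring.inverse A ∘L adjoint J)

theorem isSymmetric_solutionOp (hJA : IsCoercivePair J A) :
    (solutionOp J A).toLinearMap.IsSymmetric := by
  intro f g
  obtain ⟨h, h1, h2⟩ := exists_solution J hJA.isUnit f
  obtain ⟨k, k1, k2⟩ := exists_solution J hJA.isUnit g
  change inner ℂ (solutionOp J A f) g = inner ℂ f (solutionOp J A g)
  rw [h2, k2, ← adjoint_inner_right, ← k1, ← adjoint_inner_left J k f, ← h1]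
  exact (hJA.symm h k).symm

theorem sq_norm_solutionOp_le (hJA : IsCoercivePair J A) (f : E) :
    ‖solutionOp J A f‖ ^ 2 ≤ (inner ℂ (solutionOp J A f) f).re := by
  obtain ⟨h, h1, h2⟩ := exists_solution J hJA.isUnit f
  rw [h2, ← adjoint_inner_right, ← h1]
  exact hJA.dominates h

theorem solutionOp_nonneg (hJA : IsCoercivePair J A) (f : E) :
    0 ≤ (inner ℂ (solutionOp J A f) f).re :=
  (sq_nonneg _).trans (hJA.sq_norm_solutionOp_le f)

theorem norm_solutionOp_le_one (hJA : IsCoercivePair J A) : ‖solutionOp J A‖ ≤ 1 := by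
  refine ContinuousLinearMap.opNorm_le_bound _ zero_le_one fun f => ?_
  have h1 := hJA.sq_norm_solutionOp_le f
  have h2 : (inner ℂ (solutionOp J A f) f).re ≤ ‖solutionOp J A f‖ * ‖f‖ :=
    (Complex.re_le_norm _).trans (norm_inner_le_norm _ _)
  rcases (norm_nonneg (solutionOp J A f)).eq_or_lt with h | h
  · rw [← h, one_mul]; exact norm_nonneg _
  · rw [one_mul]
    nlinarith

/-- Eigenvectors of the solution operator solve the form eigenvalue problem. -/
theorem mem_eigenspace_solutionOp (hJA : IsCoercivePair J A) {ν : ℂ} (hν : ν ≠ 0) {x : E} :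
    x ∈ Module.End.eigenspace (solutionOp J A : E →ₗ[ℂ] E) ν ↔
      ∃ h, x = J h ∧ ∀ g, inner ℂ g (A h) = ν⁻¹ * inner ℂ (J g) (J h) := by
  rw [Module.End.mem_eigenspace_iff]
  change solutionOp J A x = ν • x ↔ _
  constructor
  · intro hx
    obtain ⟨h, h1, h2⟩ := exists_solution J hJA.isUnit x
    have hx' : x = J (ν⁻¹ • h) := by
      rw [map_smul, ← h2, hx, smul_smul, inv_mul_cancel₀ hν, one_smul]
    refine ⟨ν⁻¹ • h, hx', fun g => ?_⟩
    rw [← hx', map_smul, h1, inner_smul_right, adjoint_inner_right]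
  · rintro ⟨h, rfl, hh⟩
    have : A (ν • h) = adjoint J (J h) := by
      refine ext_inner_left ℂ fun g => ?_
      rw [map_smul, inner_smul_right, hh, adjoint_inner_right, mul_inv_cancel_left₀ hν]
    rw [solutionOp_eq J hJA.isUnit this, map_smul]

/-- The solution operator is injective on the range of `J`. -/
theorem eq_zero_of_solutionOp_eq_zero (hJA : IsCoercivePair J A) (h : W)
    (h0 : solutionOp J A (J h) = 0) : J h = 0 := by
  obtain ⟨k, h1, h2⟩ := exists_solution J hJA.isUnit (J h)
  obtain ⟨κ, hκ, hA⟩ := hJA.coercive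
  have h3 : inner ℂ k (A k) = 0 := by
    rw [h1, adjoint_inner_right, ← h2, h0, inner_zero_left]
  have h4 := hA k
  rw [h3, Complex.zero_re] at h4
  have h5 : ‖k‖ ^ 2 ≤ 0 := nonpos_of_mul_nonpos_right h4 hκ
  have h6 : k = 0 := by simpa using le_antisymm h5 (sq_nonneg _)
  have h7 : adjoint J (J h) = 0 := by rw [← h1, h6, map_zero]
  rw [← inner_self_eq_zero (𝕜 := ℂ), ← adjoint_inner_left, h7, inner_zero_left]

/-- On an infinite-dimensional form domain the solution operator has infinite rank, so none of its
approximation numbers vanishes. -/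
theorem approxNumber_solutionOp_pos (hJA : IsCoercivePair J A) (hJ : Function.Injective J)
    (hW : ¬ FiniteDimensional ℂ W) (n : ℕ) : 0 < approxNumber (solutionOp J A) n := by
  obtain ⟨s, hs, hli⟩ : ∃ s : Finset W, s.card = n + 1 ∧ LinearIndependent ℂ ((↑) : s → W) := by
    refine exists_finset_linearIndependent_of_le_rank ?_
    exact (Cardinal.natCast_lt_aleph0.le).trans
      (not_lt.1 fun h => hW (Module.rank_lt_aleph0_iff.1 h))
  set M := (Submodule.span ℂ (s : Set W)).map J.toLinearMap with hM
  have hfd : FiniteDimensional ℂ (Submodule.span ℂ (s : Set W)) := inferInstance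
  have hrank : Module.finrank ℂ M = n + 1 := by
    rw [hM, (Submodule.equivMapOfInjective J.toLinearMap hJ _).symm.finrank_eq,
      finrank_span_finset_eq_card hli, hs]
  refine approxNumber_pos _ M (by omega) ?_
  rintro x ⟨h, -, rfl⟩ hx
  exact hJA.eq_zero_of_solutionOp_eq_zero h hx

end IsCoercivePair

theorem norm_adjoint_comp_self_apply_le {J : W →L[ℂ] E} {M : ℝ} (hJ : ‖J‖ ≤ M) (h : W) :
    ‖adjoint J (J h)‖ ≤ M ^ 2 * ‖h‖ := by
  have hM : 0 ≤ M := (norm_nonneg J).trans hJ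
  calc ‖adjoint J (J h)‖ ≤ ‖adjoint J‖ * (‖J‖ * ‖h‖) :=
        ((adjoint J).le_opNorm _).trans
          (mul_le_mul_of_nonneg_left (J.le_opNorm h) (norm_nonneg _))
    _ ≤ M * (M * ‖h‖) := by
        rw [LinearIsometryEquiv.norm_map]
        gcongr
    _ = M ^ 2 * ‖h‖ := by ring

/-- A constant for the singular perturbation estimate, in terms of the coercivity constant `κ`
and a common bound `M` for the other data. -/
def perturbationConst (κ M : ℝ) : ℝ :=
  let P := M + (M + M ^ 2) * (M / κ)
  M * (M * P + (M * (M / κ) + (M + M ^ 2) * (M * P)) / κ)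

/-- **Singular perturbation estimate.** If `a` controls the squared distance to the subspace `K`
on which it vanishes, the solution operator of `ε⁻¹ a + b_ε` on the whole space differs by `O(ε)`
from the solution operator of `b` on `K`. -/
theorem norm_solutionOp_sub_le (J : W →L[ℂ] E) (𝒜 B Bε : W →L[ℂ] W) (K : Submodule ℂ W)
    [CompleteSpace K] {κ M ε : ℝ} (hκ : 0 < κ) (hε : 0 < ε)
    (hsymm : 𝒜.toLinearMap.IsSymmetric) (hK : ∀ k ∈ K, 𝒜 k = 0)
    (hdec : ∀ h, ∃ k ∈ K, ‖h - k‖ ^ 2 ≤ M * (inner ℂ h (𝒜 h)).re)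
    (hcoer : ∀ h, κ * ‖h‖ ^ 2 ≤
      (inner ℂ h (((ε : ℂ)⁻¹ • 𝒜 + Bε + adjoint J ∘L J) h)).re)
    (hcoerK : ∀ k ∈ K, κ * ‖k‖ ^ 2 ≤ (inner ℂ k ((B + adjoint J ∘L J) k)).re)
    (hJ : ‖J‖ ≤ M) (hB : ‖B‖ ≤ M) (hBε : ‖Bε‖ ≤ M) (hdiff : ‖B - Bε‖ ≤ M * ε) :
    ‖solutionOp J ((ε : ℂ)⁻¹ • 𝒜 + Bε + adjoint J ∘L J) -
      solutionOp (J ∘L K.subtypeL)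
        (adjoint K.subtypeL ∘L (B + adjoint J ∘L J) ∘L K.subtypeL)‖ ≤
      perturbationConst κ M * ε := by
  have hM : 0 ≤ M := (norm_nonneg J).trans hJ
  have hu := isUnit_of_coercive hκ hcoer
  have huK : IsUnit (adjoint K.subtypeL ∘L (B + adjoint J ∘L J) ∘L K.subtypeL) := by
    refine isUnit_of_coercive hκ fun k => ?_
    have := hcoerK k k.2
    rw [ContinuousLinearMap.comp_apply, adjoint_inner_right]
    exact this
  set P := M + (M + M ^ 2) * (M / κ) with hP
  have hP0 : 0 ≤ P := by positivity
  refine ContinuousLinearMap.opNorm_le_bound _ ?_ fun f => ?_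
  · rw [perturbationConst]; positivity
  obtain ⟨h, h1, h2⟩ := exists_solution J hu f
  obtain ⟨h0, h01, h02⟩ := exists_solution (J ∘L K.subtypeL) huK f
  obtain ⟨k, hk, hw⟩ := hdec h
  set w := h - k with hwdef
  have hkw : h = k + w := by rw [hwdef]; abel
  have hN := norm_nonneg f
  have hJJ : ∀ x, ‖adjoint J (J x)‖ ≤ M ^ 2 * ‖x‖ := norm_adjoint_comp_self_apply_le hJ
  have hJf : ‖adjoint J f‖ ≤ M * ‖f‖ := by
    refine ((adjoint J).le_opNorm f).trans ?_
    rw [LinearIsometryEquiv.norm_map]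
    gcongr
  have hBapp : ∀ {T : W →L[ℂ] W} {m : ℝ}, ‖T‖ ≤ m → ∀ x, ‖T x‖ ≤ m * ‖x‖ := fun hT x =>
    (ContinuousLinearMap.le_opNorm _ x).trans (mul_le_mul_of_nonneg_right hT (norm_nonneg x))
  -- the energy estimate
  have hh : ‖h‖ ≤ M / κ * ‖f‖ := by
    have e := (hcoer h).trans_eq (by rw [h1])
    have e2 := e.trans (re_inner_le h (adjoint J f))
    rcases (norm_nonneg h).eq_or_lt with h0 | hpos
    · rw [← h0]; positivity
    · rw [div_mul_eq_mul_div, le_div_iff₀ hκ]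
      nlinarith
  have h1' : (ε : ℂ)⁻¹ • 𝒜 h = adjoint J f - Bε h - adjoint J (J h) := by
    rw [← h1]
    simp only [add_apply, smul_apply,
      ContinuousLinearMap.comp_apply]
    abel
  have horth : ∀ x ∈ K, inner ℂ x (𝒜 h) = 0 := fun x hx => by
    have : inner ℂ (𝒜 x) h = inner ℂ x (𝒜 h) := hsymm x h
    rw [← this, hK x hx, inner_zero_left]
  -- testing with the part of `h` outside `K` gains a factor `ε`
  have hwbd : ‖w‖ ≤ M * P * ‖f‖ * ε := by
    have e1 : inner ℂ h (𝒜 h) = inner ℂ w (𝒜 h) := by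
      conv_lhs => rw [hkw, inner_add_left, ← hkw, horth k hk, zero_add]
    have e2 : ε⁻¹ * (inner ℂ h (𝒜 h)).re ≤ ‖w‖ * (P * ‖f‖) := by
      have e3 : ε⁻¹ * (inner ℂ h (𝒜 h)).re = (inner ℂ w ((ε : ℂ)⁻¹ • 𝒜 h)).re := by
        rw [e1, inner_smul_right, ← Complex.ofReal_inv, Complex.re_ofReal_mul]
      rw [e3, h1']
      refine (re_inner_le _ _).trans (mul_le_mul_of_nonneg_left ?_ (norm_nonneg _))
      calc ‖adjoint J f - Bε h - adjoint J (J h)‖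
          ≤ ‖adjoint J f‖ + ‖Bε h‖ + ‖adjoint J (J h)‖ :=
            (norm_sub_le _ _).trans (add_le_add_left (norm_sub_le _ _) _)
        _ ≤ M * ‖f‖ + M * ‖h‖ + M ^ 2 * ‖h‖ := by
            gcongr
            · exact hBapp hBε h
            · exact hJJ h
        _ = M * ‖f‖ + (M + M ^ 2) * ‖h‖ := by ring
        _ ≤ M * ‖f‖ + (M + M ^ 2) * (M / κ * ‖f‖) := by gcongr
        _ = P * ‖f‖ := by rw [hP]; ring
    have e4 : (inner ℂ h (𝒜 h)).re ≤ ε * (‖w‖ * (P * ‖f‖)) := by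
      rwa [inv_mul_le_iff₀ hε] at e2
    have e5 : ‖w‖ ^ 2 ≤ M * (ε * (‖w‖ * (P * ‖f‖))) :=
      hw.trans (mul_le_mul_of_nonneg_left e4 hM)
    rcases (norm_nonneg w).eq_or_lt with h0 | hpos
    · rw [← h0]; positivity
    · refine le_of_mul_le_mul_left ?_ hpos
      calc ‖w‖ * ‖w‖ = ‖w‖ ^ 2 := by ring
        _ ≤ _ := e5
        _ = _ := by ring
  -- on `K` the two problems differ by a small right-hand side
  set d : W := k - h0 with hd
  have hdK : d ∈ K := sub_mem hk h0.2
  have hdbd : ‖d‖ ≤ (M * (M / κ) + (M + M ^ 2) * (M * P)) / κ * ‖f‖ * ε := by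
    have e1 : inner ℂ d ((B + adjoint J ∘L J) (h0 : W)) = inner ℂ d (adjoint J f) := by
      have e := congrArg (fun z : K => inner ℂ (⟨d, hdK⟩ : K) z) h01
      simp only [ContinuousLinearMap.comp_apply] at e
      rw [adjoint_inner_right, adjoint_inner_right] at e
      rw [adjoint_inner_right]
      exact e
    have e2 : inner ℂ d (Bε h + adjoint J (J h)) = inner ℂ d (adjoint J f) := by
      have e : Bε h + adjoint J (J h) = adjoint J f - (ε : ℂ)⁻¹ • 𝒜 h := by rw [h1']; abel
      rw [e, inner_sub_right, inner_smul_right, horth d hdK, mul_zero, sub_zero]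
    have e3 : inner ℂ d ((B + adjoint J ∘L J) d) =
        inner ℂ d ((B - Bε) h - (B + adjoint J ∘L J) w) := by
      have e : (B - Bε) h - (B + adjoint J ∘L J) w =
          (B + adjoint J ∘L J) k - (Bε h + adjoint J (J h)) := by
        rw [hwdef]
        simp only [add_apply, sub_apply,
          ContinuousLinearMap.comp_apply, map_sub]
        abel
      rw [e, inner_sub_right, e2, ← e1, ← inner_sub_right, ← map_sub, hd]
    have e4 := (hcoerK d hdK).trans_eq (by rw [e3])
    have e5 : ‖(B - Bε) h - (B + adjoint J ∘L J) w‖ ≤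
        (M * (M / κ) + (M + M ^ 2) * (M * P)) * ‖f‖ * ε := by
      calc ‖(B - Bε) h - (B + adjoint J ∘L J) w‖
          ≤ ‖(B - Bε) h‖ + (‖B w‖ + ‖adjoint J (J w)‖) :=
            (norm_sub_le _ _).trans (add_le_add_right (norm_add_le _ _) _)
        _ ≤ M * ε * ‖h‖ + (M * ‖w‖ + M ^ 2 * ‖w‖) := by
            gcongr
            · exact hBapp hdiff h
            · exact hBapp hB w
            · exact hJJ w
        _ ≤ M * ε * (M / κ * ‖f‖) + (M * (M * P * ‖f‖ * ε) + M ^ 2 * (M * P * ‖f‖ * ε)) := by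
            gcongr
        _ = _ := by ring
    have e6 := e4.trans ((re_inner_le _ _).trans (mul_le_mul_of_nonneg_left e5 (norm_nonneg d)))
    rw [div_mul_eq_mul_div, div_mul_eq_mul_div, le_div_iff₀ hκ]
    rcases (norm_nonneg d).eq_or_lt with h0 | hpos
    · rw [← h0, zero_mul]; positivity
    · refine le_of_mul_le_mul_left ?_ hpos
      calc ‖d‖ * (‖d‖ * κ) = κ * ‖d‖ ^ 2 := by ring
        _ ≤ _ := e6
  rw [sub_apply, h2, h02]
  have e : J h - (J ∘L K.subtypeL) h0 = J (w + d) := by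
    rw [hwdef, hd, ContinuousLinearMap.comp_apply, Submodule.subtypeL_apply, ← map_sub]
    congr 1
    abel
  rw [e]
  calc ‖J (w + d)‖ ≤ M * ‖w + d‖ :=
        (J.le_opNorm _).trans (mul_le_mul_of_nonneg_right hJ (norm_nonneg _))
    _ ≤ M * (M * P * ‖f‖ * ε + (M * (M / κ) + (M + M ^ 2) * (M * P)) / κ * ‖f‖ * ε) := by
        gcongr
        exact (norm_add_le _ _).trans (add_le_add hwbd hdbd)
    _ = _ := by rw [perturbationConst]; ring

end Resolvent

/-! ### Multipliers with respect to a Hilbert basis -/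

section Multiplier

variable {ι H : Type*} [NormedAddCommGroup H] [InnerProductSpace ℂ H]

theorem hasSum_sq_norm_repr (b : HilbertBasis ι ℂ H) (f : H) :
    HasSum (fun k => ‖b.repr f k‖ ^ 2) (‖f‖ ^ 2) := by
  have h := lp.hasSum_norm (p := 2) (by norm_num) (b.repr f)
  rw [LinearIsometryEquiv.norm_map] at h
  simpa using h

theorem ext_repr (b : HilbertBasis ι ℂ H) {f g : H} (h : ∀ k, b.repr f k = b.repr g k) :
    f = g :=
  b.repr.injective (lp.ext (funext h))

theorem exists_of_summable_sq (b : HilbertBasis ι ℂ H) (x : ι → ℂ)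
    (hx : Summable fun k => ‖x k‖ ^ 2) : ∃ f : H, ∀ k, b.repr f k = x k := by
  have hm : Memℓp x 2 := memℓp_gen (by simpa using hx)
  exact ⟨b.repr.symm ⟨x, hm⟩, fun k => by rw [LinearIsometryEquiv.apply_symm_apply]⟩

theorem exists_repr_eq_mul (b : HilbertBasis ι ℂ H) (m : ι → ℂ) {C : ℝ}
    (hC : ∀ k, ‖m k‖ ≤ C) (f : H) : ∃ g : H, ∀ k, b.repr g k = m k * b.repr f k := by
  refine exists_of_summable_sq b _ (Summable.of_nonneg_of_le (fun k => sq_nonneg _) (fun k => ?_)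
    ((hasSum_sq_norm_repr b f).summable.mul_left (C ^ 2)))
  rw [norm_mul, mul_pow]
  exact mul_le_mul_of_nonneg_right (pow_le_pow_left₀ (norm_nonneg _) (hC k) 2) (sq_nonneg _)

theorem norm_le_of_norm_repr_le (b : HilbertBasis ι ℂ H) {C : ℝ} (hC : 0 ≤ C) {f g : H}
    (h : ∀ k, ‖b.repr g k‖ ≤ C * ‖b.repr f k‖) : ‖g‖ ≤ C * ‖f‖ := by
  refine le_of_sq_le_sq ?_ (by positivity)
  rw [mul_pow]
  refine hasSum_le (fun k => ?_) (hasSum_sq_norm_repr b g)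
    ((hasSum_sq_norm_repr b f).mul_left (C ^ 2))
  rw [← mul_pow]
  exact pow_le_pow_left₀ (norm_nonneg _) (h k) 2

theorem exists_multiplier (b : HilbertBasis ι ℂ H) (m : ι → ℂ) {C : ℝ} (hC : ∀ k, ‖m k‖ ≤ C) :
    ∃ T : H →L[ℂ] H, ∀ f k, b.repr (T f) k = m k * b.repr f k := by
  choose T hT using exists_repr_eq_mul b m hC
  let L : H →ₗ[ℂ] H :=
    { toFun := T
      map_add' := fun f g => ext_repr b fun k => by
        simp only [hT, map_add, lp.coeFn_add, Pi.add_apply, mul_add]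
      map_smul' := fun z f => ext_repr b fun k => by
        simp only [hT, map_smul, lp.coeFn_smul, Pi.smul_apply, smul_eq_mul, RingHom.id_apply]
        ring }
  refine ⟨L.mkContinuous |C| fun f => norm_le_of_norm_repr_le b (abs_nonneg C) fun k => ?_, hT⟩
  change ‖b.repr (T f) k‖ ≤ _
  rw [hT, norm_mul]
  exact mul_le_mul_of_nonneg_right ((hC k).trans (le_abs_self C)) (norm_nonneg _)

open Classical in
/-- The operator multiplying the `k`-th coefficient by `m k`, for a bounded symbol `m` (and `0`
if `m` is unbounded). -/
def multiplier (b : HilbertBasis ι ℂ H) (m : ι → ℂ) : H →L[ℂ] H :=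
  if h : ∃ T : H →L[ℂ] H, ∀ f k, b.repr (T f) k = m k * b.repr f k then h.choose else 0

theorem repr_multiplier (b : HilbertBasis ι ℂ H) {m : ι → ℂ} {C : ℝ} (hC : ∀ k, ‖m k‖ ≤ C)
    (f : H) (k : ι) : b.repr (multiplier b m f) k = m k * b.repr f k := by
  have h := exists_multiplier b m hC
  rw [multiplier, dif_pos h]
  exact h.choose_spec f k

theorem norm_multiplier_le (b : HilbertBasis ι ℂ H) {m : ι → ℂ} {C : ℝ} (h0 : 0 ≤ C)
    (hC : ∀ k, ‖m k‖ ≤ C) : ‖multiplier b m‖ ≤ C := by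
  refine ContinuousLinearMap.opNorm_le_bound _ h0 fun f => ?_
  refine norm_le_of_norm_repr_le b h0 fun k => ?_
  rw [repr_multiplier b hC, norm_mul]
  exact mul_le_mul_of_nonneg_right (hC k) (norm_nonneg _)

/-- A multiplier whose symbol tends to zero is compact: it is the norm limit of its truncations
to finite sets of coefficients. -/
theorem isCompactOperator_multiplier [CompleteSpace H] (b : HilbertBasis ι ℂ H) {m : ι → ℂ}
    (hm : Tendsto m cofinite (𝓝 0)) : IsCompactOperator (multiplier b m) := by
  classical
  have hsmall : ∀ δ > 0, {k | ¬ ‖m k‖ < δ}.Finite := fun δ hδ =>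
    eventually_cofinite.1 ((tendsto_zero_iff_norm_tendsto_zero.1 hm).eventually_lt_const hδ)
  obtain ⟨C, hC⟩ : ∃ C, ∀ k, ‖m k‖ ≤ C := by
    obtain ⟨C, hC⟩ := ((hsmall 1 one_pos).image fun k => ‖m k‖).bddAbove
    refine ⟨max C 1, fun k => ?_⟩
    by_cases hk : ‖m k‖ < 1
    · exact hk.le.trans (le_max_right _ _)
    · exact (hC ⟨k, hk, rfl⟩).trans (le_max_left _ _)
  have hcl := isClosed_setOfPred_isCompactOperator (𝕜₁ := ℂ) (𝕜₂ := ℂ) (σ₁₂ := RingHom.id ℂ)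
    (M₁ := H) (M₂ := H)
  refine hcl.closure_subset_iff.2 subset_rfl ?_
  rw [Metric.mem_closure_iff]
  intro δ hδ
  let s := (hsmall (δ / 2) (half_pos hδ)).toFinset
  let T : H →L[ℂ] H := ∑ k ∈ s, (innerSL ℂ (b k)).smulRight (m k • b k)
  have hTapp : ∀ f, T f = ∑ k ∈ s, b.repr f k • m k • b k := by
    intro f
    simp only [T, sum_apply, ContinuousLinearMap.smulRight_apply,
      innerSL_apply_apply, HilbertBasis.repr_apply_apply]
  have hTrepr : ∀ f k, b.repr (T f) k = if k ∈ s then m k * b.repr f k else 0 := by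
    intro f k
    rw [hTapp, b.repr_apply_apply, inner_sum]
    have : ∀ j ∈ s, inner ℂ (b k) (b.repr f j • m j • b j) =
        if k = j then m j * b.repr f j else 0 := by
      intro j _
      rw [inner_smul_right, inner_smul_right, orthonormal_iff_ite.1 b.orthonormal k j]
      split_ifs <;> ring
    rw [Finset.sum_congr rfl this, Finset.sum_ite_eq]
  refine ⟨T, ?_, ?_⟩
  · have hfin : ∀ k, IsCompactOperator ((innerSL ℂ (b k)).smulRight (m k • b k) : H →L[ℂ] H) := by
      intro k
      have h1 : IsCompactOperator (innerSL ℂ (b k) : H → ℂ) :=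
        isCompactOperator_of_locallyCompactSpace_dom (innerSL ℂ (b k))
      exact h1.clm_comp ((ContinuousLinearMap.id ℂ ℂ).smulRight (m k • b k))
    change IsCompactOperator (T : H → H)
    have : ∀ s : Finset ι,
        IsCompactOperator (∑ k ∈ s, (innerSL ℂ (b k)).smulRight (m k • b k) : H →L[ℂ] H) := by
      intro s
      induction s using Finset.induction_on with
      | empty => rw [Finset.sum_empty]; exact isCompactOperator_zero
      | insert k s hk ih => rw [Finset.sum_insert hk]; exact (hfin k).add ih
    exact this s
  · rw [dist_eq_norm]
    refine lt_of_le_of_lt (ContinuousLinearMap.opNorm_le_bound _ (half_pos hδ).le fun f => ?_)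
      (half_lt_self hδ)
    refine norm_le_of_norm_repr_le b (half_pos hδ).le fun k => ?_
    rw [sub_apply, map_sub, lp.coeFn_sub, Pi.sub_apply, hTrepr,
      repr_multiplier b hC]
    split_ifs with hk
    · rw [sub_self, norm_zero]; positivity
    · rw [sub_zero, norm_mul]
      have : ‖m k‖ < δ / 2 := by simpa [s] using hk
      exact mul_le_mul_of_nonneg_right this.le (norm_nonneg _)

end Multiplier

/-! ### Integration by parts on the cell -/

theorem cell_eq_preimage :
    cell = WithLp.ofLp ⁻¹' (Set.univ.pi fun _ : Fin 2 => Set.Ico (-Real.pi) Real.pi) := by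
  ext y; simp [cell]

theorem setIntegral_cell (g : Plane → ℂ) :
    ∫ y, g y ∂cellMeasure =
      ∫ x in Set.Icc (fun _ : Fin 2 => -Real.pi) (fun _ => Real.pi), g (WithLp.toLp 2 x) := by
  have h := (PiLp.volume_preserving_ofLp (Fin 2)).setIntegral_preimage_emb
    (MeasurableEquiv.toLp 2 (Fin 2 → ℝ)).symm.measurableEmbedding
    (fun x => g (WithLp.toLp 2 x)) (Set.univ.pi fun _ : Fin 2 => Set.Ico (-Real.pi) Real.pi)
  rw [← cell_eq_preimage] at h
  have hae : (Set.univ.pi fun _ : Fin 2 => Set.Ico (-Real.pi) Real.pi) =ᵐ[volume]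
      Set.Icc (fun _ : Fin 2 => -Real.pi) (fun _ => Real.pi) :=
    Measure.univ_pi_Ico_ae_eq_Icc
  rw [← setIntegral_congr_set hae, ← h]
  rfl

theorem volume_real_cell : cellMeasure.real Set.univ = (2 * Real.pi) ^ 2 := by
  have h := (PiLp.volume_preserving_ofLp (Fin 2)).measure_preimage
    (MeasurableSet.univ_pi fun _ : Fin 2 => measurableSet_Ico (a := -Real.pi) (b := Real.pi)).nullMeasurableSet
  rw [← cell_eq_preimage] at h
  rw [measureReal_def, cellMeasure, Measure.restrict_apply_univ, h, Real.volume_pi_Ico]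
  have hpi := Real.pi_pos
  rw [Finset.prod_const, Finset.card_univ, Fintype.card_fin, ENNReal.toReal_pow,
    ENNReal.toReal_ofReal (by linarith)]
  ring

/-- The integral over the cell of a partial derivative vanishes if the boundary values on
opposite sides agree. -/
theorem integral_partialD_eq_zero {j : Fin 2} {ψ : Plane → ℂ} (hψ : ContDiff ℝ ∞ ψ)
    (hbd : ∀ y : Plane, y j = -Real.pi →
      ψ (y + EuclideanSpace.single j (2 * Real.pi)) = ψ y) :
    ∫ y, partialD j ψ y ∂cellMeasure = 0 := by
  rw [setIntegral_cell]
  set a : Fin 2 → ℝ := fun _ => -Real.pi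
  set b : Fin 2 → ℝ := fun _ => Real.pi
  have hpi := Real.pi_pos
  let τ : (Fin 2 → ℝ) →L[ℝ] Plane := (EuclideanSpace.equiv (Fin 2) ℝ).symm.toContinuousLinearMap
  have hτ : ∀ x, τ x = WithLp.toLp 2 x := fun x => rfl
  have hd : ∀ x, HasFDerivAt (fun x => ψ (τ x)) ((fderiv ℝ ψ (τ x)).comp τ) x := fun x =>
    ((hψ.differentiable (by simp)) (τ x)).hasFDerivAt.comp x τ.hasFDerivAt
  have hcont : Continuous fun x => ψ (τ x) := hψ.continuous.comp τ.continuous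
  have hτs : τ (Pi.single j 1) = EuclideanSpace.single j 1 := rfl
  have hsum : ∀ x, ∑ i, (if i = j then (fderiv ℝ ψ (τ x)).comp τ else 0) (Pi.single i 1) =
      partialD j ψ (WithLp.toLp 2 x) := by
    intro x
    rw [Finset.sum_eq_single j]
    · rw [if_pos rfl, ContinuousLinearMap.comp_apply, hτs]; rfl
    · intro i _ hi
      rw [if_neg hi]; rfl
    · simp
  have key := integral_divergence_of_hasFDerivAt_off_countable' a b (fun _ => by simp [a, b, hpi.le])
    (fun i => if i = j then fun x => ψ (τ x) else 0)
    (fun i x => if i = j then (fderiv ℝ ψ (τ x)).comp τ else 0) ∅ Set.countable_empty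
    (fun i => by
      split_ifs
      · exact hcont.continuousOn
      · exact continuousOn_const)
    (fun x _ i => by
      split_ifs
      · exact hd x
      · exact hasFDerivAt_const (0 : ℂ) x)
    (by
      simp only [hsum]
      refine Continuous.integrableOn_Icc ?_
      exact (continuous_partialD hψ).comp τ.continuous)
  simp only [hsum] at key
  rw [key]
  refine Finset.sum_eq_zero fun i _ => ?_
  rw [sub_eq_zero]
  split_ifs with hi
  · subst hi
    refine integral_congr_ae (ae_of_all _ fun x => ?_)
    have hadd : τ (i.insertNth (b i) x) =
        τ (i.insertNth (a i) x) + EuclideanSpace.single i (2 * Real.pi) := by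
      ext k
      rw [hτ, hτ, PiLp.add_apply]
      rcases eq_or_ne k i with rfl | hk
      · simp [a, b]; ring
      · obtain ⟨l, rfl⟩ := Fin.exists_succAbove_eq hk
        simp
    change ψ (τ (i.insertNth (b i) x)) = ψ (τ (i.insertNth (a i) x))
    rw [hadd]
    refine hbd _ ?_
    rw [hτ]
    simp [a]
  · rfl

theorem neg_pi_lt_of_mem_interior {y : Plane} (hy : y ∈ interior cell) (j : Fin 2) :
    -Real.pi < y j := by
  have hle : ∀ z ∈ cell, -Real.pi ≤ z j := fun z hz => (hz j).1
  have hsub : interior cell ⊆ interior {z : Plane | -Real.pi ≤ z j} := interior_mono hle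
  have hopen : IsOpenMap fun z : Plane => z j :=
    (EuclideanSpace.proj (𝕜 := ℝ) j).isOpenMap fun r => ⟨EuclideanSpace.single j r, by simp⟩
  have h1 : y ∈ (fun z : Plane => z j) ⁻¹' interior (Set.Ici (-Real.pi)) := by
    rw [hopen.preimage_interior_eq_interior_preimage (EuclideanSpace.proj (𝕜 := ℝ) j).continuous]
    exact hsub hy
  rw [interior_Ici] at h1
  exact h1

/-- Test functions supported in the interior of the cell vanish on its boundary. -/
theorem boundary_eq_of_tsupport {φ : Plane → ℂ} (hφ : tsupport φ ⊆ interior cell) (j : Fin 2)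
    {y : Plane} (hy : y j = -Real.pi) :
    φ (y + EuclideanSpace.single j (2 * Real.pi)) = φ y := by
  have h0 : ∀ z, z ∉ interior cell → φ z = 0 := fun z hz =>
    image_eq_zero_of_notMem_tsupport fun h => hz (hφ h)
  rw [h0 y fun h => (neg_pi_lt_of_mem_interior h j).ne' hy, h0]
  intro h
  have := (interior_subset h j).2
  simp [hy] at this
  linarith

/-! ### The Fourier basis of `L²` of the cell -/

/-- The function `e^{i ξ·y}`. -/
def expI (ξ : Plane) (y : Plane) : ℂ := Complex.exp (Complex.I * ((∑ i, ξ i * y i : ℝ) : ℂ))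

theorem contDiff_expI (ξ : Plane) : ContDiff ℝ ∞ (expI ξ) := by
  have h : ContDiff ℝ ∞ fun y : Plane => ∑ i, ξ i * y i := by
    refine ContDiff.sum fun i _ => contDiff_const.mul ?_
    exact (EuclideanSpace.proj (𝕜 := ℝ) i : Plane →L[ℝ] ℝ).contDiff
  exact (contDiff_const.mul (Complex.ofRealCLM.contDiff.comp h)).cexp

theorem norm_expI (ξ y : Plane) : ‖expI ξ y‖ = 1 := by
  rw [expI, mul_comm, Complex.norm_exp_ofReal_mul_I]

theorem expI_add (ξ η y : Plane) : expI (ξ + η) y = expI ξ y * expI η y := by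
  rw [expI, expI, expI, ← Complex.exp_add, ← mul_add, ← Complex.ofReal_add,
    ← Finset.sum_add_distrib]
  simp only [PiLp.add_apply, add_mul]

theorem expI_zero (y : Plane) : expI 0 y = 1 := by simp [expI]

theorem expI_neg (ξ y : Plane) : expI (-ξ) y = conj (expI ξ y) := by
  rw [expI, expI, ← Complex.exp_conj, map_mul, Complex.conj_I, Complex.conj_ofReal]
  congr 1
  simp only [PiLp.neg_apply, neg_mul, Finset.sum_neg_distrib, Complex.ofReal_neg, mul_neg]

theorem expI_neg_mul (ξ y : Plane) : expI (-ξ) y * expI ξ y = 1 := by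
  rw [← expI_add, neg_add_cancel, expI_zero]

theorem hasFDerivAt_expI (ξ y : Plane) : HasFDerivAt (expI ξ)
    (expI ξ y • (Complex.I • Complex.ofRealCLM.comp
      (∑ i, ξ i • (EuclideanSpace.proj (𝕜 := ℝ) i : Plane →L[ℝ] ℝ)))) y := by
  have h1 : HasFDerivAt (fun y : Plane => ∑ i, ξ i * y i)
      (∑ i, ξ i • (EuclideanSpace.proj (𝕜 := ℝ) i : Plane →L[ℝ] ℝ)) y :=
    HasFDerivAt.fun_sum fun i _ => (EuclideanSpace.proj (𝕜 := ℝ) i).hasFDerivAt.const_mul (ξ i)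
  exact ((Complex.ofRealCLM.hasFDerivAt.comp y h1).const_mul Complex.I).cexp

theorem partialD_expI (j : Fin 2) (ξ y : Plane) :
    partialD j (expI ξ) y = Complex.I * ξ j * expI ξ y := by
  rw [partialD, (hasFDerivAt_expI ξ y).fderiv]
  simp [Fin.sum_univ_two]
  fin_cases j <;> simp <;> ring

theorem partialD_mul {φ ψ : Plane → ℂ} (hφ : ContDiff ℝ ∞ φ) (hψ : ContDiff ℝ ∞ ψ) (j : Fin 2)
    (y : Plane) : partialD j (fun y => φ y * ψ y) y =
      partialD j φ y * ψ y + φ y * partialD j ψ y := by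
  have h1 := ((hφ.differentiable (by simp)) y).hasFDerivAt
  have h2 := ((hψ.differentiable (by simp)) y).hasFDerivAt
  have h3 : HasFDerivAt (fun y => φ y * ψ y) _ y := h1.mul h2
  rw [partialD, h3.fderiv]
  simp [partialD]
  ring

/-- Integer vectors as points of the plane. -/
def latticePoint (k : Fin 2 → ℤ) : Plane := WithLp.toLp 2 fun i => (k i : ℝ)

theorem expI_latticePoint_periodic (k : Fin 2 → ℤ) : IsPeriodic (expI (latticePoint k)) := by
  intro i y
  have h1 : (∑ l, latticePoint k l * (y + EuclideanSpace.single i (2 * Real.pi)) l : ℝ) =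
      (∑ l, latticePoint k l * y l) + k i * (2 * Real.pi) := by
    simp only [PiLp.add_apply, mul_add, Finset.sum_add_distrib]
    congr 1
    rw [Finset.sum_eq_single i]
    · simp [latticePoint]
    · intro l _ hl; simp [hl]
    · simp
  rw [expI, h1, expI]
  have h2 := Complex.exp_int_mul_two_pi_mul_I (k i)
  rw [Complex.ofReal_add, mul_add, Complex.exp_add]
  have h3 : Complex.I * (((k i : ℝ) * (2 * Real.pi) : ℝ) : ℂ) = k i * (2 * Real.pi * Complex.I) := by
    push_cast; ring
  rw [h3, h2, mul_one]

theorem memLp_bounded {g : Plane → ℂ} (hg : AEStronglyMeasurable g cellMeasure) {C : ℝ}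
    (hC : ∀ y, ‖g y‖ ≤ C) : MemLp g 2 cellMeasure :=
  MemLp.of_bound hg C (ae_of_all _ hC)

theorem memLp_fourierFun (k : Fin 2 → ℤ) :
    MemLp (fun y => ((2 * Real.pi : ℝ) : ℂ)⁻¹ * expI (latticePoint k) y) 2 cellMeasure := by
  refine memLp_bounded (C := (2 * Real.pi)⁻¹)
    (continuous_const.mul (contDiff_expI _).continuous).aestronglyMeasurable fun y => ?_
  rw [norm_mul, norm_expI, mul_one, norm_inv, Complex.norm_real,
    Real.norm_of_nonneg (by positivity)]

/-- The normalised exponential `(2π)⁻¹ e^{i k·y}` in `L²(□)`. -/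
def fourierFun (k : Fin 2 → ℤ) : L2 := (memLp_fourierFun k).toLp

theorem coeFn_fourierFun (k : Fin 2 → ℤ) :
    fourierFun k =ᵐ[cellMeasure] fun y => ((2 * Real.pi : ℝ) : ℂ)⁻¹ * expI (latticePoint k) y :=
  MemLp.coeFn_toLp _

theorem inner_L2_eq (f g : L2) : inner ℂ f g = ∫ y, g y * conj (f y) ∂cellMeasure := by
  rw [L2.inner_def]
  refine integral_congr_ae (ae_of_all _ fun y => ?_)
  simp [RCLike.inner_apply]

theorem inner_fourierFun (k : Fin 2 → ℤ) (f : L2) : inner ℂ (fourierFun k) f =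
    ((2 * Real.pi : ℝ) : ℂ)⁻¹ * ∫ y, f y * expI (-latticePoint k) y ∂cellMeasure := by
  rw [inner_L2_eq, ← integral_const_mul]
  refine integral_congr_ae ?_
  filter_upwards [coeFn_fourierFun k] with y hy
  rw [hy, map_mul, expI_neg, map_inv₀, Complex.conj_ofReal]
  ring

theorem latticePoint_sub (k l : Fin 2 → ℤ) :
    latticePoint (k - l) = latticePoint k - latticePoint l := by
  ext i; simp [latticePoint]

theorem integral_expI_latticePoint {k : Fin 2 → ℤ} (hk : k ≠ 0) :
    ∫ y, expI (latticePoint k) y ∂cellMeasure = 0 := by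
  obtain ⟨j, hj⟩ := Function.ne_iff.1 hk
  have h := integral_partialD_eq_zero (contDiff_expI (latticePoint k)) (j := j)
    fun y _ => expI_latticePoint_periodic k j y
  simp only [partialD_expI, integral_const_mul] at h
  refine (mul_eq_zero.1 h).resolve_left ?_
  simpa [latticePoint] using hj

theorem orthonormal_fourierFun : Orthonormal ℂ fourierFun := by
  rw [orthonormal_iff_ite]
  intro k l
  have e : inner ℂ (fourierFun k) (fourierFun l) = ((2 * Real.pi : ℝ) : ℂ)⁻¹ *
      (((2 * Real.pi : ℝ) : ℂ)⁻¹ * ∫ y, expI (latticePoint (l - k)) y ∂cellMeasure) := by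
    rw [inner_fourierFun, ← integral_const_mul _ fun y => expI (latticePoint (l - k)) y]
    congr 1
    refine integral_congr_ae ?_
    filter_upwards [coeFn_fourierFun l] with y hy
    rw [hy, latticePoint_sub, sub_eq_add_neg, expI_add, mul_assoc]
  rw [e]
  split_ifs with h
  · subst h
    have h0 : latticePoint (0 : Fin 2 → ℤ) = 0 := by ext i; simp [latticePoint]
    have hint : ∫ y, expI (latticePoint (k - k)) y ∂cellMeasure = ((2 * Real.pi) ^ 2 : ℝ) := by
      rw [sub_self, h0, ← volume_real_cell]
      simp only [expI_zero]
      rw [integral_const, Complex.real_smul, mul_one]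
    have hpi : (Real.pi : ℂ) ≠ 0 := by exact_mod_cast Real.pi_ne_zero
    rw [hint]
    push_cast
    field_simp
  · rw [integral_expI_latticePoint (sub_ne_zero.2 (Ne.symm h)), mul_zero, mul_zero]

/-- The projection of the plane to the torus. -/
def toTorus (y : Plane) : UnitAddTorus (Fin 2) := fun i => ((y i / (2 * Real.pi) : ℝ) : UnitAddCircle)

/-- The section of `toTorus` with values in the cell. -/
def torusSection (x : UnitAddTorus (Fin 2)) : Plane :=
  WithLp.toLp 2 fun i => 2 * Real.pi * (AddCircle.equivIco 1 (-(1 / 2) : ℝ) (x i) : ℝ)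

theorem measurable_toTorus : Measurable toTorus := by
  refine measurable_pi_lambda _ fun i => ?_
  refine AddCircle.measurable_mk'.comp ?_
  have h : Continuous fun y : Plane => y i / (2 * Real.pi) := by fun_prop
  exact h.measurable

theorem measurable_torusSection : Measurable torusSection := by
  refine (WithLp.measurable_toLp 2 (Fin 2 → ℝ)).comp (measurable_pi_lambda _ fun i => ?_)
  exact (measurable_subtype_coe.comp ((AddCircle.measurableEquivIco 1 (-(1 / 2) : ℝ)).measurable.comp
    (measurable_pi_apply i))).const_mul _

theorem torusSection_toTorus {y : Plane} (hy : y ∈ cell) : torusSection (toTorus y) = y := by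
  have hpi := Real.pi_pos
  ext i
  have hmem : y i / (2 * Real.pi) ∈ Set.Ico (-(1 / 2) : ℝ) (-(1 / 2) + 1) := by
    obtain ⟨h1, h2⟩ := hy i
    constructor
    · rw [le_div_iff₀ (by positivity)]; linarith
    · rw [div_lt_iff₀ (by positivity)]; linarith
  have h := AddCircle.equivIco_coe_eq hmem
  change 2 * Real.pi * (AddCircle.equivIco 1 (-(1 / 2) : ℝ) ((y i / (2 * Real.pi) : ℝ) : UnitAddCircle) : ℝ) = y i
  rw [h]
  field_simp

theorem mFourier_toTorus (k : Fin 2 → ℤ) (y : Plane) :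
    UnitAddTorus.mFourier k (toTorus y) = expI (latticePoint k) y := by
  have hpi : (Real.pi : ℂ) ≠ 0 := by exact_mod_cast Real.pi_ne_zero
  simp only [UnitAddTorus.mFourier, ContinuousMap.coe_mk, toTorus, expI, fourier_coe_apply,
    Fin.prod_univ_two, Fin.sum_univ_two, latticePoint, ← Complex.exp_add]
  congr 1
  push_cast
  field_simp

/-- Trigonometric polynomials are dense in the continuous functions on the torus, hence in `L²`
of the image of the measure of the cell. -/
theorem fourierFun_complete : (Submodule.span ℂ (Set.range fourierFun))ᗮ = ⊥ := by
  rw [Submodule.eq_bot_iff]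
  intro f hf
  have horth : ∀ k, ∫ y, f y * expI (-latticePoint k) y ∂cellMeasure = 0 := by
    intro k
    have h := hf (fourierFun k) (Submodule.subset_span ⟨k, rfl⟩)
    rw [inner_fourierFun] at h
    refine (mul_eq_zero.1 h).resolve_left (inv_ne_zero ?_)
    exact_mod_cast (by positivity : 2 * Real.pi ≠ 0)
  set ν := cellMeasure.map toTorus with hν
  have hfin : IsFiniteMeasure ν := inferInstance
  have hcell : ∀ᵐ y ∂cellMeasure, y ∈ cell := ae_restrict_mem measurableSet_cell
  have hsm : StronglyMeasurable fun x => f (torusSection x) :=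
    (Lp.stronglyMeasurable f).comp_measurable measurable_torusSection
  have hcomp : (fun x => f (torusSection x)) ∘ toTorus =ᵐ[cellMeasure] f := by
    filter_upwards [hcell] with y hy
    simp only [Function.comp_apply, torusSection_toTorus hy]
  have hmem : MemLp (fun x => f (torusSection x)) 2 ν :=
    (memLp_map_measure_iff hsm.aestronglyMeasurable measurable_toTorus.aemeasurable).2
      ((memLp_congr_ae hcomp).2 (Lp.memLp f))
  have hdense : (Submodule.span ℂ (Set.range fun k : Fin 2 → ℤ =>
      ContinuousMap.toLp (E := ℂ) 2 ν ℂ (UnitAddTorus.mFourier k))).topologicalClosure = ⊤ := by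
    simpa only [Submodule.map_span, ContinuousLinearMap.coe_coe, ← Set.range_comp,
      Function.comp_def] using
      (ContinuousMap.toLp_denseRange ℂ ν ℂ (by norm_num)).topologicalClosure_map_submodule
        UnitAddTorus.span_mFourier_closure_eq_top
  have hzero : hmem.toLp = 0 := by
    have : hmem.toLp ∈ (Submodule.span ℂ (Set.range fun k : Fin 2 → ℤ =>
        ContinuousMap.toLp (E := ℂ) 2 ν ℂ (UnitAddTorus.mFourier k)))ᗮ := by
      rw [Submodule.mem_orthogonal]
      intro g hg
      refine Submodule.span_induction (p := fun g _ => inner ℂ g hmem.toLp = 0) ?_ ?_ ?_ ?_ hg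
      · rintro _ ⟨k, rfl⟩
        rw [L2.inner_def]
        have e : ∫ x, inner ℂ (ContinuousMap.toLp (E := ℂ) 2 ν ℂ (UnitAddTorus.mFourier k) x)
            ((hmem.toLp _) x) ∂ν = ∫ x, f (torusSection x) * conj (UnitAddTorus.mFourier k x) ∂ν := by
          refine integral_congr_ae ?_
          filter_upwards [hmem.coeFn_toLp,
            ContinuousMap.coeFn_toLp (𝕜 := ℂ) (p := 2) ν (UnitAddTorus.mFourier k)] with x h1 h2
          rw [h1, h2, RCLike.inner_apply]
        have hsm' : StronglyMeasurable
            fun x => f (torusSection x) * conj (UnitAddTorus.mFourier k x) :=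
          hsm.mul (by fun_prop : Continuous fun x =>
            conj (UnitAddTorus.mFourier k x)).stronglyMeasurable
        rw [e, hν, integral_map measurable_toTorus.aemeasurable hsm'.aestronglyMeasurable,
          ← horth k]
        refine integral_congr_ae ?_
        filter_upwards [hcell] with y hy
        rw [torusSection_toTorus hy, mFourier_toTorus, expI_neg]
      · exact inner_zero_left _
      · intro g g' _ _ h h'
        rw [inner_add_left, h, h', add_zero]
      · intro z g _ h
        rw [inner_smul_left, h, mul_zero]
    rw [← Submodule.orthogonal_closure, hdense, Submodule.top_orthogonal_eq_bot] at this
    exact this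
  have hae : ∀ᵐ x ∂ν, f (torusSection x) = 0 := by
    have h1 := hmem.coeFn_toLp
    rw [hzero] at h1
    filter_upwards [h1, Lp.coeFn_zero ℂ 2 ν] with x h2 h3
    rw [← h2, h3]; rfl
  have hae' := ae_of_ae_map measurable_toTorus.aemeasurable hae
  refine Lp.eq_zero_iff_ae_eq_zero.2 ?_
  filter_upwards [hae', hcell] with y h1 h2
  rw [torusSection_toTorus h2] at h1
  exact h1

/-- The Fourier basis of `L²(□)`. -/
def fourierBasis : HilbertBasis (Fin 2 → ℤ) ℂ L2 :=
  HilbertBasis.mkOfOrthogonalEqBot orthonormal_fourierFun fourierFun_complete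

theorem fourierBasis_apply (k : Fin 2 → ℤ) : fourierBasis k = fourierFun k := by
  rw [fourierBasis, HilbertBasis.coe_mkOfOrthogonalEqBot]

theorem repr_fourierBasis (f : L2) (k : Fin 2 → ℤ) : fourierBasis.repr f k =
    ((2 * Real.pi : ℝ) : ℂ)⁻¹ * ∫ y, f y * expI (-latticePoint k) y ∂cellMeasure := by
  rw [HilbertBasis.repr_apply_apply, fourierBasis_apply, inner_fourierFun]

/-! ### Multiplication operators on `L²` of the cell -/

theorem memLp_mul_bounded {g : Plane → ℂ} (hg : Measurable g) (h1 : ∀ y, ‖g y‖ ≤ 1) (f : L2) :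
    MemLp (fun y => g y * f y) 2 cellMeasure := by
  refine (Lp.memLp f).mono (hg.aestronglyMeasurable.mul (Lp.aestronglyMeasurable f))
    (ae_of_all _ fun y => ?_)
  rw [norm_mul]
  exact mul_le_of_le_one_left (norm_nonneg _) (h1 y)

/-- Multiplication by a measurable function bounded by `1`. -/
def mulOp (g : Plane → ℂ) (hg : Measurable g) (h1 : ∀ y, ‖g y‖ ≤ 1) : L2 →L[ℂ] L2 :=
  LinearMap.mkContinuous
    { toFun := fun f => (memLp_mul_bounded hg h1 f).toLp
      map_add' := fun f f' => by
        refine Lp.ext ?_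
        filter_upwards [(memLp_mul_bounded hg h1 (f + f')).coeFn_toLp,
          (memLp_mul_bounded hg h1 f).coeFn_toLp, (memLp_mul_bounded hg h1 f').coeFn_toLp,
          Lp.coeFn_add f f', Lp.coeFn_add (memLp_mul_bounded hg h1 f).toLp
            (memLp_mul_bounded hg h1 f').toLp] with y e1 e2 e3 e4 e5
        rw [e1, e5, Pi.add_apply, e2, e3, e4, Pi.add_apply, mul_add]
      map_smul' := fun z f => by
        refine Lp.ext ?_
        filter_upwards [(memLp_mul_bounded hg h1 (z • f)).coeFn_toLp,
          (memLp_mul_bounded hg h1 f).coeFn_toLp, Lp.coeFn_smul z f,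
          Lp.coeFn_smul z (memLp_mul_bounded hg h1 f).toLp] with y e1 e2 e3 e4
        rw [e1, RingHom.id_apply, e4, Pi.smul_apply, e2, e3, Pi.smul_apply, smul_eq_mul,
          smul_eq_mul]
        ring }
    1 fun f => by
      rw [one_mul]
      refine Lp.norm_le_norm_of_ae_le ?_
      filter_upwards [(memLp_mul_bounded hg h1 f).coeFn_toLp] with y e
      change ‖((memLp_mul_bounded hg h1 f).toLp _) y‖ ≤ _
      rw [e, norm_mul]
      exact mul_le_of_le_one_left (norm_nonneg _) (h1 y)

theorem coeFn_mulOp {g : Plane → ℂ} (hg : Measurable g) (h1 : ∀ y, ‖g y‖ ≤ 1) (f : L2) :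
    mulOp g hg h1 f =ᵐ[cellMeasure] fun y => g y * f y :=
  (memLp_mul_bounded hg h1 f).coeFn_toLp

theorem norm_mulOp_le {g : Plane → ℂ} (hg : Measurable g) (h1 : ∀ y, ‖g y‖ ≤ 1) :
    ‖mulOp g hg h1‖ ≤ 1 :=
  LinearMap.mkContinuous_norm_le _ zero_le_one _

theorem measurable_expI (θ : Plane) : Measurable (expI θ) := (contDiff_expI θ).continuous.measurable

/-- Multiplication by `e^{iθ·y}`. -/
def expOp (θ : Plane) : L2 →L[ℂ] L2 :=
  mulOp (expI θ) (measurable_expI θ) fun y => (norm_expI θ y).le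

theorem coeFn_expOp (θ : Plane) (f : L2) : expOp θ f =ᵐ[cellMeasure] fun y => expI θ y * f y :=
  coeFn_mulOp _ _ f

theorem inner_expOp (θ : Plane) (f g : L2) : inner ℂ (expOp θ f) (expOp θ g) = inner ℂ f g := by
  rw [inner_L2_eq, inner_L2_eq]
  refine integral_congr_ae ?_
  filter_upwards [coeFn_expOp θ f, coeFn_expOp θ g] with y h1 h2
  rw [h1, h2, map_mul, ← expI_neg]
  linear_combination (g y * conj (f y)) * expI_neg_mul θ y

theorem norm_expOp (θ : Plane) (f : L2) : ‖expOp θ f‖ = ‖f‖ := by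
  rw [@norm_eq_sqrt_re_inner ℂ, @norm_eq_sqrt_re_inner ℂ _ _ _ _ f, inner_expOp]

theorem expOp_neg_expOp (θ : Plane) (f : L2) : expOp (-θ) (expOp θ f) = f := by
  refine Lp.ext ?_
  filter_upwards [coeFn_expOp (-θ) (expOp θ f), coeFn_expOp θ f] with y h1 h2
  rw [h1, h2, ← mul_assoc, expI_neg_mul, one_mul]

theorem expOp_expOp_neg (θ : Plane) (f : L2) : expOp θ (expOp (-θ) f) = f := by
  simpa using expOp_neg_expOp (-θ) f

/-- Multiplication by the indicator function of a measurable set `S`. -/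
def indOp (S : Set Plane) (hS : MeasurableSet S) : L2 →L[ℂ] L2 :=
  mulOp (S.indicator 1) (measurable_one.indicator hS) fun y => by
    by_cases h : y ∈ S <;> simp [h]

theorem coeFn_indOp {S : Set Plane} (hS : MeasurableSet S) (f : L2) :
    indOp S hS f =ᵐ[cellMeasure] fun y => S.indicator 1 y * f y :=
  coeFn_mulOp _ _ f

theorem norm_indOp_le {S : Set Plane} (hS : MeasurableSet S) : ‖indOp S hS‖ ≤ 1 :=
  norm_mulOp_le _ _

theorem indOp_indOp {S : Set Plane} (hS : MeasurableSet S) (f : L2) :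
    indOp S hS (indOp S hS f) = indOp S hS f := by
  refine Lp.ext ?_
  filter_upwards [coeFn_indOp hS (indOp S hS f), coeFn_indOp hS f] with y h1 h2
  rw [h1, h2]
  by_cases h : y ∈ S <;> simp [h]

theorem pairing_eq_inner {S : Set Plane} (hS : MeasurableSet S) (p q : L2) :
    pairing S p q = inner ℂ q (indOp S hS p) := by
  change ∫ y in S, p y * conj (q y) ∂cellMeasure = _
  rw [inner_L2_eq, ← integral_indicator hS]
  refine integral_congr_ae ?_
  filter_upwards [coeFn_indOp hS p] with y h1
  rw [h1]
  by_cases h : y ∈ S <;> simp [h]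

theorem inner_indOp_left {S : Set Plane} (hS : MeasurableSet S) (p q : L2) :
    inner ℂ (indOp S hS q) p = inner ℂ q (indOp S hS p) := by
  rw [inner_L2_eq, inner_L2_eq]
  refine integral_congr_ae ?_
  filter_upwards [coeFn_indOp hS p, coeFn_indOp hS q] with y h1 h2
  rw [h1, h2]
  by_cases h : y ∈ S <;> simp [h]

theorem inner_indOp_indOp {S : Set Plane} (hS : MeasurableSet S) (p q : L2) :
    inner ℂ (indOp S hS q) (indOp S hS p) = inner ℂ q (indOp S hS p) := by
  rw [inner_indOp_left, indOp_indOp]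

theorem indOp_cell (f : L2) : indOp cell measurableSet_cell f = f := by
  refine Lp.ext ?_
  filter_upwards [coeFn_indOp measurableSet_cell f,
    (ae_restrict_mem measurableSet_cell : ∀ᵐ y ∂cellMeasure, y ∈ cell)] with y h1 h2
  rw [h1]
  simp [h2]

theorem indOp_eq_zero_iff {S : Set Plane} (hS : MeasurableSet S) (f : L2) :
    indOp S hS f = 0 ↔ ∀ᵐ y ∂cellMeasure, y ∈ S → f y = 0 := by
  rw [Lp.eq_zero_iff_ae_eq_zero]
  constructor
  · intro h
    filter_upwards [h, coeFn_indOp hS f] with y h1 h2 hy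
    rw [h2, Pi.zero_apply] at h1
    simpa [hy] using h1
  · intro h
    filter_upwards [h, coeFn_indOp hS f] with y h1 h2
    rw [h2, Pi.zero_apply]
    by_cases hy : y ∈ S
    · simp [h1 hy]
    · simp [hy]

theorem indOp_diff_add {S : Set Plane} (hS : MeasurableSet S) (f : L2) :
    indOp (cell \ S) (measurableSet_cell.diff hS) f + indOp S hS f = f := by
  refine Lp.ext ?_
  filter_upwards [coeFn_indOp (measurableSet_cell.diff hS) f, coeFn_indOp hS f,
    Lp.coeFn_add (indOp (cell \ S) (measurableSet_cell.diff hS) f) (indOp S hS f),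
    (ae_restrict_mem measurableSet_cell : ∀ᵐ y ∂cellMeasure, y ∈ cell)] with y h1 h2 h3 h4
  rw [h3, Pi.add_apply, h1, h2]
  by_cases hy : y ∈ S <;> simp [hy, h4]

theorem indOp_diff_indOp {S : Set Plane} (hS : MeasurableSet S) (f : L2) :
    indOp (cell \ S) (measurableSet_cell.diff hS) (indOp S hS f) = 0 := by
  rw [indOp_eq_zero_iff]
  filter_upwards [coeFn_indOp hS f] with y h1 hy
  rw [h1]
  simp [hy.2]

/-! ### Weak derivatives and Fourier coefficients -/

theorem memLp_of_continuous {φ : Plane → ℂ} (h : Continuous φ) : MemLp φ 2 cellMeasure := by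
  obtain ⟨K, hK⟩ := isBounded_cell.isCompact_closure.exists_bound_of_continuousOn
    h.continuousOn
  refine MemLp.of_bound h.aestronglyMeasurable K ?_
  exact (ae_restrict_iff' measurableSet_cell).2
    (ae_of_all _ fun y hy => hK y (subset_closure hy))

theorem inner_toLp_conj {φ : Plane → ℂ} (h : Continuous φ) (f : L2) :
    inner ℂ (memLp_of_continuous (φ := fun y => conj (φ y)) (by fun_prop)).toLp f =
      ∫ y, f y * φ y ∂cellMeasure := by
  rw [inner_L2_eq]
  refine integral_congr_ae ?_
  filter_upwards [(memLp_of_continuous (φ := fun y => conj (φ y)) (by fun_prop)).coeFn_toLp]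
    with y hy
  rw [hy, Complex.conj_conj]

theorem integral_fourierBasis_mul (k : Fin 2 → ℤ) (φ : Plane → ℂ) :
    ∫ y, fourierBasis k y * φ y ∂cellMeasure =
      ((2 * Real.pi : ℝ) : ℂ)⁻¹ * ∫ y, expI (latticePoint k) y * φ y ∂cellMeasure := by
  rw [← integral_const_mul, fourierBasis_apply]
  refine integral_congr_ae ?_
  filter_upwards [coeFn_fourierFun k] with y hy
  rw [hy, mul_assoc]

theorem integrable_continuous {φ : Plane → ℂ} (h : Continuous φ) : Integrable φ cellMeasure :=
  (memLp_of_continuous h).integrable (by norm_num)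

/-- If the Fourier coefficients of `f` and `g` are related as those of a function and its partial
derivative, then integration by parts holds against all smooth functions with matching values
on opposite sides of the cell. -/
theorem integral_mul_partialD_of_repr {j : Fin 2} {f g : L2}
    (h : ∀ k, fourierBasis.repr g k = Complex.I * (k j : ℂ) * fourierBasis.repr f k)
    {φ : Plane → ℂ} (hφ : ContDiff ℝ ∞ φ) (hbd : ∀ y : Plane, y j = -Real.pi →
      φ (y + EuclideanSpace.single j (2 * Real.pi)) = φ y) :
    ∫ y, f y * partialD j φ y ∂cellMeasure = - ∫ y, g y * φ y ∂cellMeasure := by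
  have hc := hφ.continuous
  have hdc := continuous_partialD (j := j) hφ
  rw [← inner_toLp_conj hdc, ← inner_toLp_conj hc, ← inner_neg_left]
  have s1 := fourierBasis.hasSum_inner_mul_inner
    (memLp_of_continuous (φ := fun y => conj (partialD j φ y)) (by fun_prop)).toLp f
  have s2 := fourierBasis.hasSum_inner_mul_inner
    (-(memLp_of_continuous (φ := fun y => conj (φ y)) (by fun_prop)).toLp) g
  have hterm : ∀ k, inner ℂ (memLp_of_continuous (φ := fun y => conj (partialD j φ y))
        (by fun_prop)).toLp (fourierBasis k) * inner ℂ (fourierBasis k) f =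
      inner ℂ (-(memLp_of_continuous (φ := fun y => conj (φ y)) (by fun_prop)).toLp)
        (fourierBasis k) * inner ℂ (fourierBasis k) g := by
    intro k
    rw [inner_neg_left, inner_toLp_conj hdc, inner_toLp_conj hc, integral_fourierBasis_mul,
      integral_fourierBasis_mul, ← HilbertBasis.repr_apply_apply, ← HilbertBasis.repr_apply_apply,
      h k]
    have hec := (contDiff_expI (latticePoint k)).continuous
    have hparts := integral_partialD_eq_zero (j := j)
      ((contDiff_expI (latticePoint k)).mul hφ) fun y hy => by
        rw [expI_latticePoint_periodic k j y, hbd y hy]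
    simp only [partialD_mul (contDiff_expI (latticePoint k)) hφ, partialD_expI] at hparts
    rw [integral_add (integrable_continuous (by fun_prop)) (integrable_continuous (by fun_prop))]
      at hparts
    have e : ∫ y, Complex.I * (latticePoint k j : ℂ) * expI (latticePoint k) y * φ y ∂cellMeasure =
        Complex.I * (k j : ℂ) * ∫ y, expI (latticePoint k) y * φ y ∂cellMeasure := by
      rw [← integral_const_mul]
      refine integral_congr_ae (ae_of_all _ fun y => ?_)
      simp [latticePoint]
      ring
    rw [e] at hparts
    linear_combination (((2 * Real.pi : ℝ) : ℂ)⁻¹ * fourierBasis.repr f k) * hparts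
  rw [funext hterm] at s1
  exact s1.unique s2

theorem hasWeakPartial_of_repr {j : Fin 2} {f g : L2}
    (h : ∀ k, fourierBasis.repr g k = Complex.I * (k j : ℂ) * fourierBasis.repr f k) :
    HasWeakPartial j f g := fun _ h1 _ h3 =>
  integral_mul_partialD_of_repr h h1 fun _ hy => boundary_eq_of_tsupport h3 j hy

theorem hasWeakPartial_weakD (j : Fin 2) (u : H1) : HasWeakPartial j u (weakD j u) :=
  (u.2 j).choose_spec

theorem weakD_eq {j : Fin 2} {u : H1} {g : L2} (h : HasWeakPartial j u g) : weakD j u = g :=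
  (hasWeakPartial_weakD j u).unique h

/-- Testing the periodicity of `v` with exponentials gives the Fourier coefficients of `∂_j v`. -/
theorem repr_weakD_of_periodic {v : H1} (hv : IsPeriodicH1 v) (j : Fin 2) (k : Fin 2 → ℤ) :
    fourierBasis.repr (weakD j v) k = Complex.I * (k j : ℂ) * fourierBasis.repr (v : L2) k := by
  have hper : IsPeriodic (expI (-latticePoint k)) := by
    have : -latticePoint k = latticePoint (-k) := by ext i; simp [latticePoint]
    rw [this]
    exact expI_latticePoint_periodic _
  have e := hv j _ (contDiff_expI (-latticePoint k)) hper
  rw [repr_fourierBasis, repr_fourierBasis, ← neg_eq_iff_eq_neg.2 e]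
  have e2 : ∫ y, (v : L2) y * partialD j (expI (-latticePoint k)) y ∂cellMeasure =
      (-(Complex.I * (k j : ℂ))) * ∫ y, (v : L2) y * expI (-latticePoint k) y ∂cellMeasure := by
    rw [← integral_const_mul]
    refine integral_congr_ae (ae_of_all _ fun y => ?_)
    simp only [partialD_expI]
    simp [latticePoint]
    ring
  rw [e2]
  ring

/-- The product rule for `e^{iθ·y} v`. -/
theorem HasWeakPartial.expOp {j : Fin 2} {v g : L2} (θ : Plane) (h : HasWeakPartial j v g) :
    HasWeakPartial j (expOp θ v) (expOp θ (g + (Complex.I * θ j) • v)) := by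
  intro φ h1 h2 h3
  have hsub : tsupport (fun y => expI θ y * φ y) ⊆ tsupport φ :=
    tsupport_mul_subset_right
  have hs : ContDiff ℝ ∞ fun y => expI θ y * φ y := (contDiff_expI θ).mul h1
  have e := h _ hs (h2.mul_left) (hsub.trans h3)
  have hi1 : Integrable (fun y => v y * (expI θ y * partialD j φ y)) cellMeasure :=
    integrable_mul_continuous v ((contDiff_expI θ).continuous.mul (continuous_partialD h1))
  have hi2 : Integrable (fun y => v y * (Complex.I * θ j * expI θ y * φ y)) cellMeasure :=
    integrable_mul_continuous v
      ((continuous_const.mul (contDiff_expI θ).continuous).mul h1.continuous)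
  have hi3 : Integrable (fun y => g y * (expI θ y * φ y)) cellMeasure :=
    integrable_mul_continuous g ((contDiff_expI θ).continuous.mul h1.continuous)
  have e1 : ∫ y, v y * partialD j (fun y => expI θ y * φ y) y ∂cellMeasure =
      ∫ y, v y * (Complex.I * θ j * expI θ y * φ y) ∂cellMeasure +
        ∫ y, v y * (expI θ y * partialD j φ y) ∂cellMeasure := by
    rw [← integral_add hi2 hi1]
    refine integral_congr_ae (ae_of_all _ fun y => ?_)
    simp only [partialD_mul (contDiff_expI θ) h1, partialD_expI]
    ring
  have e2 : ∫ y, PCF.expOp θ v y * partialD j φ y ∂cellMeasure =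
      ∫ y, v y * (expI θ y * partialD j φ y) ∂cellMeasure := by
    refine integral_congr_ae ?_
    filter_upwards [coeFn_expOp θ v] with y hy
    rw [hy]; ring
  have e3 : ∫ y, PCF.expOp θ (g + (Complex.I * θ j) • v) y * φ y ∂cellMeasure =
      ∫ y, g y * (expI θ y * φ y) ∂cellMeasure +
        ∫ y, v y * (Complex.I * θ j * expI θ y * φ y) ∂cellMeasure := by
    rw [← integral_add hi3 hi2]
    refine integral_congr_ae ?_
    filter_upwards [coeFn_expOp θ (g + (Complex.I * θ j) • v),
      Lp.coeFn_add g ((Complex.I * θ j) • v), Lp.coeFn_smul (Complex.I * θ j) v] with y h1 h2 h3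
    rw [h1, h2, Pi.add_apply, h3, Pi.smul_apply, smul_eq_mul]; ring
  rw [e2, e3]
  rw [e1] at e
  linear_combination e

/-! ### Fourier parametrisation of the quasi-periodic Sobolev space -/

/-- The frequency `k + θ`. -/
def freq (θ : Plane) (k : Fin 2 → ℤ) (j : Fin 2) : ℝ := k j + θ j

/-- The weight `(1 + |k + θ|²)^{1/2}`. -/
def weight (θ : Plane) (k : Fin 2 → ℤ) : ℝ :=
  Real.sqrt (1 + freq θ k 0 ^ 2 + freq θ k 1 ^ 2)

theorem sq_weight (θ : Plane) (k : Fin 2 → ℤ) :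
    weight θ k ^ 2 = 1 + freq θ k 0 ^ 2 + freq θ k 1 ^ 2 :=
  Real.sq_sqrt (by positivity)

theorem weight_pos (θ : Plane) (k : Fin 2 → ℤ) : 0 < weight θ k :=
  Real.sqrt_pos.2 (by positivity)

theorem one_le_weight (θ : Plane) (k : Fin 2 → ℤ) : 1 ≤ weight θ k :=
  Real.one_le_sqrt.2 (by nlinarith [sq_nonneg (freq θ k 0), sq_nonneg (freq θ k 1)])

theorem abs_freq_le_weight (θ : Plane) (k : Fin 2 → ℤ) (j : Fin 2) : |freq θ k j| ≤ weight θ k := by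
  refine Real.abs_le_sqrt ?_
  fin_cases j <;> simp <;> nlinarith [sq_nonneg (freq θ k 0), sq_nonneg (freq θ k 1)]

/-- The symbol `(1 + |k + θ|²)^{-1/2}`. -/
def smoothSymbol (θ : Plane) (k : Fin 2 → ℤ) : ℂ := ((weight θ k)⁻¹ : ℝ)

/-- The symbol `i (k + θ)_j (1 + |k + θ|²)^{-1/2}`. -/
def derivSymbol (θ : Plane) (j : Fin 2) (k : Fin 2 → ℤ) : ℂ :=
  Complex.I * ((freq θ k j / weight θ k : ℝ) : ℂ)

theorem norm_smoothSymbol_le (θ : Plane) (k : Fin 2 → ℤ) : ‖smoothSymbol θ k‖ ≤ 1 := by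
  rw [smoothSymbol, Complex.norm_real, norm_inv, Real.norm_of_nonneg (weight_pos θ k).le]
  exact inv_le_one_of_one_le₀ (one_le_weight θ k)

theorem norm_derivSymbol_le (θ : Plane) (j : Fin 2) (k : Fin 2 → ℤ) : ‖derivSymbol θ j k‖ ≤ 1 := by
  rw [derivSymbol, norm_mul, Complex.norm_I, one_mul, Complex.norm_real, Real.norm_eq_abs, abs_div,
    abs_of_pos (weight_pos θ k)]
  exact div_le_one_of_le₀ (abs_freq_le_weight θ k j) (weight_pos θ k).le

theorem tendsto_smoothSymbol (θ : Plane) : Tendsto (smoothSymbol θ) cofinite (𝓝 0) := by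
  rw [tendsto_zero_iff_norm_tendsto_zero]
  refine tendsto_order.2 ⟨fun a ha => Eventually.of_forall fun k => ha.trans_le (norm_nonneg _),
    fun δ hδ => ?_⟩
  obtain ⟨N, hN⟩ := exists_nat_gt (δ⁻¹ + |θ 0| + |θ 1|)
  refine (Set.finite_Icc (fun _ : Fin 2 => -(N : ℤ)) (fun _ => (N : ℤ))).subset fun k hk => ?_
  have hk' : δ ≤ (weight θ k)⁻¹ := by
    have h : ¬ ‖smoothSymbol θ k‖ < δ := hk
    rw [smoothSymbol, Complex.norm_real, norm_inv, Real.norm_of_nonneg (weight_pos θ k).le] at h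
    exact not_lt.1 h
  have hw : weight θ k ≤ δ⁻¹ := (le_inv_comm₀ hδ (weight_pos θ k)).1 hk'
  have hb : ∀ i, |(k i : ℝ)| ≤ N := by
    intro i
    have h1 := (abs_freq_le_weight θ k i).trans hw
    have h2 : |(k i : ℝ)| ≤ |freq θ k i| + |θ i| := by
      have : (k i : ℝ) = freq θ k i - θ i := by rw [freq]; ring
      rw [this]
      exact abs_sub _ _
    have h3 : |θ i| ≤ |θ 0| + |θ 1| := by
      fin_cases i
      · exact le_add_of_nonneg_right (abs_nonneg _)
      · exact le_add_of_nonneg_left (abs_nonneg _)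
    linarith
  have hb' : ∀ i, |k i| ≤ (N : ℤ) := fun i => by exact_mod_cast hb i
  exact ⟨fun i => (abs_le.1 (hb' i)).1, fun i => (abs_le.1 (hb' i)).2⟩

/-- The smoothing operator of order one on periodic functions. -/
def smoothOp (θ : Plane) : L2 →L[ℂ] L2 := multiplier fourierBasis (smoothSymbol θ)

/-- The embedding of `H¹_θ(□)`, parametrised by `L²(□)`, into `L²(□)`. -/
def embedOp (θ : Plane) : L2 →L[ℂ] L2 := expOp θ ∘L smoothOp θ

/-- The partial derivative on `H¹_θ(□)`, parametrised by `L²(□)`. -/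
def derivOp (θ : Plane) (j : Fin 2) : L2 →L[ℂ] L2 :=
  expOp θ ∘L multiplier fourierBasis (derivSymbol θ j)

theorem repr_smoothOp (θ : Plane) (h : L2) (k : Fin 2 → ℤ) :
    fourierBasis.repr (smoothOp θ h) k = smoothSymbol θ k * fourierBasis.repr h k :=
  repr_multiplier fourierBasis (norm_smoothSymbol_le θ) h k

theorem repr_multiplier_derivSymbol (θ : Plane) (j : Fin 2) (h : L2) (k : Fin 2 → ℤ) :
    fourierBasis.repr (multiplier fourierBasis (derivSymbol θ j) h) k =
      derivSymbol θ j k * fourierBasis.repr h k :=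
  repr_multiplier fourierBasis (norm_derivSymbol_le θ j) h k

theorem isCompactOperator_embedOp (θ : Plane) : IsCompactOperator (embedOp θ) :=
  (isCompactOperator_multiplier fourierBasis (tendsto_smoothSymbol θ)).clm_comp (expOp θ)

/-- The parametrisation of `H¹_θ(□)` is isometric for the `H¹` norm. -/
theorem sq_norm_embedOp_add (θ : Plane) (h : L2) :
    ‖embedOp θ h‖ ^ 2 + (‖derivOp θ 0 h‖ ^ 2 + ‖derivOp θ 1 h‖ ^ 2) = ‖h‖ ^ 2 := by
  simp only [embedOp, derivOp, ContinuousLinearMap.comp_apply, norm_expOp]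
  refine ((hasSum_sq_norm_repr fourierBasis _).add ((hasSum_sq_norm_repr fourierBasis _).add
    (hasSum_sq_norm_repr fourierBasis _))).unique ?_
  convert hasSum_sq_norm_repr fourierBasis h using 2 with k
  rw [repr_smoothOp, repr_multiplier_derivSymbol, repr_multiplier_derivSymbol]
  simp only [norm_mul, mul_pow, smoothSymbol, derivSymbol, Complex.norm_I, Complex.norm_real,
    Real.norm_eq_abs, sq_abs, one_mul]
  rw [← add_mul, ← add_mul]
  have hw := (weight_pos θ k).ne'
  have : (weight θ k)⁻¹ ^ 2 + ((freq θ k 0 / weight θ k) ^ 2 + (freq θ k 1 / weight θ k) ^ 2) = 1 := by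
    field_simp
    rw [sq_weight]; ring
  rw [this, one_mul]

theorem embedOp_injective (θ : Plane) : Function.Injective (embedOp θ) := by
  refine (injective_iff_map_eq_zero _).2 fun h hh => ?_
  have h1 : smoothOp θ h = 0 := by
    rw [← expOp_neg_expOp θ (smoothOp θ h)]
    change expOp (-θ) (embedOp θ h) = 0
    rw [hh, map_zero]
  refine ext_repr fourierBasis fun k => ?_
  have h2 := repr_smoothOp θ h k
  rw [h1, map_zero] at h2
  have h3 : smoothSymbol θ k ≠ 0 := by
    rw [smoothSymbol]
    exact_mod_cast inv_ne_zero (weight_pos θ k).ne'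
  rw [map_zero]
  exact (mul_eq_zero.1 h2.symm).resolve_left h3

/-- The derivative of the periodic function `smoothOp θ h`. -/
def periodicDeriv (θ : Plane) (j : Fin 2) (h : L2) : L2 :=
  multiplier fourierBasis (derivSymbol θ j) h - (Complex.I * θ j) • smoothOp θ h

theorem repr_periodicDeriv (θ : Plane) (j : Fin 2) (h : L2) (k : Fin 2 → ℤ) :
    fourierBasis.repr (periodicDeriv θ j h) k =
      Complex.I * (k j : ℂ) * fourierBasis.repr (smoothOp θ h) k := by
  rw [periodicDeriv, map_sub, map_smul, lp.coeFn_sub, lp.coeFn_smul, Pi.sub_apply, Pi.smul_apply,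
    repr_multiplier_derivSymbol, repr_smoothOp, derivSymbol, smoothSymbol, freq]
  push_cast
  simp only [smul_eq_mul, div_eq_mul_inv]
  ring

theorem smoothOp_mem_H1 (θ : Plane) (h : L2) : smoothOp θ h ∈ H1 := fun j =>
  ⟨_, hasWeakPartial_of_repr (repr_periodicDeriv θ j h)⟩

theorem isPeriodicH1_smoothOp (θ : Plane) (h : L2) :
    IsPeriodicH1 ⟨smoothOp θ h, smoothOp_mem_H1 θ h⟩ := by
  intro j φ h1 h2
  rw [weakD_eq (u := ⟨smoothOp θ h, smoothOp_mem_H1 θ h⟩)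
    (hasWeakPartial_of_repr (repr_periodicDeriv θ j h))]
  exact integral_mul_partialD_of_repr (repr_periodicDeriv θ j h) h1 fun y _ => h2 j y

theorem hasWeakPartial_embedOp (θ : Plane) (j : Fin 2) (h : L2) :
    HasWeakPartial j (embedOp θ h) (derivOp θ j h) := by
  have := (hasWeakPartial_of_repr (repr_periodicDeriv θ j h)).expOp θ
  rw [periodicDeriv, sub_add_cancel] at this
  exact this

/-- The parametrisation of `H¹_θ(□)` by `L²(□)`. -/
def embedH1 (θ : Plane) : L2 →ₗ[ℂ] H1 :=
  (embedOp θ).toLinearMap.codRestrict H1 fun h j => ⟨_, hasWeakPartial_embedOp θ j h⟩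

theorem coe_embedH1 (θ : Plane) (h : L2) : (embedH1 θ h : L2) = embedOp θ h := rfl

theorem weakD_embedH1 (θ : Plane) (j : Fin 2) (h : L2) : weakD j (embedH1 θ h) = derivOp θ j h :=
  weakD_eq (hasWeakPartial_embedOp θ j h)

theorem isQuasiPeriodicH1_embedH1 (θ : Plane) (h : L2) : IsQuasiPeriodicH1 θ (embedH1 θ h) :=
  ⟨_, isPeriodicH1_smoothOp θ h, coeFn_expOp θ (smoothOp θ h)⟩

theorem exists_embedH1_eq {θ : Plane} {u : H1} (hu : IsQuasiPeriodicH1 θ u) :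
    ∃ h, embedH1 θ h = u := by
  obtain ⟨v, hv, huv⟩ := hu
  let h : L2 := smoothOp θ v - ∑ j, multiplier fourierBasis (derivSymbol θ j)
    (weakD j v + (Complex.I * θ j) • (v : L2))
  have hrepr : ∀ k, fourierBasis.repr h k = (weight θ k : ℂ) * fourierBasis.repr (v : L2) k := by
    intro k
    have hw : (weight θ k : ℂ) ≠ 0 := by exact_mod_cast (weight_pos θ k).ne'
    have hsq : (weight θ k : ℂ) ^ 2 = 1 + (freq θ k 0 : ℂ) ^ 2 + (freq θ k 1 : ℂ) ^ 2 := by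
      exact_mod_cast sq_weight θ k
    simp only [h, Fin.sum_univ_two, map_sub, map_add, lp.coeFn_sub, lp.coeFn_add, Pi.sub_apply,
      Pi.add_apply, repr_smoothOp, repr_multiplier_derivSymbol, map_smul, lp.coeFn_smul,
      Pi.smul_apply, smul_eq_mul, repr_weakD_of_periodic hv]
    have hf : ∀ j, ((k j : ℂ)) + θ j = (freq θ k j : ℂ) := fun j => by rw [freq]; push_cast; rfl
    have e : ∀ j, derivSymbol θ j k * (Complex.I * (k j : ℂ) * fourierBasis.repr (v : L2) k) +
        derivSymbol θ j k * (Complex.I * θ j * fourierBasis.repr (v : L2) k) =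
        -((freq θ k j : ℂ) ^ 2 / weight θ k) * fourierBasis.repr (v : L2) k := by
      intro j
      rw [derivSymbol, ← mul_add, ← add_mul, ← mul_add, hf]
      push_cast
      linear_combination ((freq θ k j : ℂ) ^ 2 / weight θ k * fourierBasis.repr (v : L2) k) * Complex.I_sq
    have key : (weight θ k : ℂ)⁻¹ + (freq θ k 0 : ℂ) ^ 2 / weight θ k +
        (freq θ k 1 : ℂ) ^ 2 / weight θ k = weight θ k := by
      field_simp
      rw [hsq]
    rw [smoothSymbol, Complex.ofReal_inv]
    linear_combination fourierBasis.repr (v : L2) k * key - e 0 - e 1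
  have hsm : smoothOp θ h = v := by
    refine ext_repr fourierBasis fun k => ?_
    rw [repr_smoothOp, hrepr, smoothSymbol, Complex.ofReal_inv,
      inv_mul_cancel_left₀ (by exact_mod_cast (weight_pos θ k).ne')]
  refine ⟨h, Subtype.ext ?_⟩
  rw [coe_embedH1]
  refine Lp.ext ?_
  filter_upwards [huv, coeFn_expOp θ (smoothOp θ h)] with y h1 h2
  rw [h1]
  change expOp θ (smoothOp θ h) y = _
  rw [h2, hsm, expI]

/-! ### Vector fields and the operators representing the forms -/

/-- `L²(□; ℂ²)` with its Hilbert space structure. -/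
abbrev Field2 : Type := PiLp 2 fun _ : Fin 2 => L2

open ContinuousLinearMap (adjoint adjoint_inner_left adjoint_inner_right)

theorem inner_self_eq_ofReal {H : Type*} [NormedAddCommGroup H] [InnerProductSpace ℂ H] (x : H) :
    inner ℂ x x = ((‖x‖ ^ 2 : ℝ) : ℂ) := by
  rw [inner_self_eq_norm_sq_to_K, Complex.ofReal_pow]
  rfl

/-- The `i`-th component of a field. -/
def component (i : Fin 2) : Field2 →L[ℂ] L2 := PiLp.proj 2 (fun _ : Fin 2 => L2) i

theorem sq_norm_field (h : Field2) : ‖h‖ ^ 2 = ‖h 0‖ ^ 2 + ‖h 1‖ ^ 2 := by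
  rw [PiLp.norm_sq_eq_of_L2, Fin.sum_univ_two]

theorem inner_field (g h : Field2) : inner ℂ g h = inner ℂ (g 0) (h 0) + inner ℂ (g 1) (h 1) := by
  rw [PiLp.inner_apply, Fin.sum_univ_two]

/-- The parametrisation of `H¹_θ(□; ℂ²)` by `L²(□; ℂ²)`. -/
def embedV (θ : Plane) : Field2 →ₗ[ℂ] H1V :=
  LinearMap.pi fun i => embedH1 θ ∘ₗ (component i).toLinearMap

theorem mem_H1qp_iff (θ : Plane) (v : H1V) : v ∈ H1qp θ ↔ ∃ h, embedV θ h = v := by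
  constructor
  · intro hv
    choose h hh using fun i => exists_embedH1_eq (hv i)
    exact ⟨WithLp.toLp 2 h, funext hh⟩
  · rintro ⟨h, rfl⟩ i
    exact isQuasiPeriodicH1_embedH1 θ (h i)

/-- The partial derivative `∂_j u_i` of the field `u` with parameter `h`. -/
def partialOp (θ : Plane) (i j : Fin 2) : Field2 →L[ℂ] L2 := derivOp θ j ∘L component i

theorem partialOp_apply (θ : Plane) (i j : Fin 2) (h : Field2) :
    partialOp θ i j h = derivOp θ j (h i) := rfl

theorem weakD_embedV (θ : Plane) (i j : Fin 2) (h : Field2) :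
    weakD j (embedV θ h i) = partialOp θ i j h := weakD_embedH1 θ j (h i)

theorem norm_derivOp_apply_le (θ : Plane) (j : Fin 2) (f : L2) : ‖derivOp θ j f‖ ≤ ‖f‖ := by
  have := sq_norm_embedOp_add θ f
  refine le_of_sq_le_sq ?_ (norm_nonneg _)
  fin_cases j <;> simp only [Fin.zero_eta, Fin.mk_one] <;>
    nlinarith [sq_nonneg ‖embedOp θ f‖, sq_nonneg ‖derivOp θ 0 f‖, sq_nonneg ‖derivOp θ 1 f‖]

theorem norm_partialOp_le (θ : Plane) (i j : Fin 2) : ‖partialOp θ i j‖ ≤ 1 :=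
  ContinuousLinearMap.opNorm_le_bound _ zero_le_one fun h => by
    rw [one_mul, partialOp_apply]
    exact (norm_derivOp_apply_le θ j _).trans (PiLp.norm_apply_le h i)

/-- The divergence. -/
def divOp (θ : Plane) : Field2 →L[ℂ] L2 := partialOp θ 0 0 + partialOp θ 1 1

/-- The curl. -/
def curlOp (θ : Plane) : Field2 →L[ℂ] L2 := partialOp θ 1 0 - partialOp θ 0 1

theorem divOp_apply (θ : Plane) (h : Field2) :
    divOp θ h = partialOp θ 0 0 h + partialOp θ 1 1 h := rfl

theorem curlOp_apply (θ : Plane) (h : Field2) :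
    curlOp θ h = partialOp θ 1 0 h - partialOp θ 0 1 h := rfl

theorem divV_embedV (θ : Plane) (h : Field2) : divV (embedV θ h) = divOp θ h := by
  rw [divOp_apply, ← weakD_embedV, ← weakD_embedV]; rfl

theorem curlV_embedV (θ : Plane) (h : Field2) : curlV (embedV θ h) = curlOp θ h := by
  rw [curlOp_apply, ← weakD_embedV, ← weakD_embedV]; rfl

section Gram

variable {S : Set Plane} (hS : MeasurableSet S)

/-- The operator representing the form `(u, φ) ↦ ∫_{□ ∩ S} P u conj (Q φ)`. -/
def gramOp (P Q : Field2 →L[ℂ] L2) : Field2 →L[ℂ] Field2 := adjoint Q ∘L indOp S hS ∘L P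

theorem inner_gramOp (P Q : Field2 →L[ℂ] L2) (g h : Field2) :
    inner ℂ g (gramOp hS P Q h) = pairing S (P h) (Q g) := by
  rw [gramOp, ContinuousLinearMap.comp_apply, adjoint_inner_right, pairing_eq_inner hS]; rfl

theorem inner_gramOp_eq (P Q : Field2 →L[ℂ] L2) (g h : Field2) :
    inner ℂ g (gramOp hS P Q h) = inner ℂ (indOp S hS (Q g)) (indOp S hS (P h)) := by
  rw [inner_gramOp, pairing_eq_inner hS, inner_indOp_indOp]

theorem gramOp_symm (P Q : Field2 →L[ℂ] L2) (g h : Field2) :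
    inner ℂ (gramOp hS P Q g) h = inner ℂ g (gramOp hS Q P h) := by
  rw [← inner_conj_symm, inner_gramOp_eq, inner_gramOp_eq, inner_conj_symm]

theorem norm_gramOp_le {P Q : Field2 →L[ℂ] L2} (hP : ‖P‖ ≤ 1) (hQ : ‖Q‖ ≤ 1) :
    ‖gramOp hS P Q‖ ≤ 1 := by
  have hQ' : ‖adjoint Q‖ ≤ 1 := by rwa [LinearIsometryEquiv.norm_map]
  have h1 : ‖indOp S hS ∘L P‖ ≤ 1 :=
    ((indOp S hS).opNorm_comp_le P).trans (mul_le_one₀ (norm_indOp_le hS) (norm_nonneg _) hP)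
  exact ((adjoint Q).opNorm_comp_le _).trans (mul_le_one₀ hQ' (norm_nonneg _) h1)

/-- The operator representing `∫_{□ ∩ S} ∇u_i · conj ∇φ_i`. -/
def gradOp (θ : Plane) (i : Fin 2) : Field2 →L[ℂ] Field2 :=
  gramOp hS (partialOp θ i 0) (partialOp θ i 0) + gramOp hS (partialOp θ i 1) (partialOp θ i 1)

/-- The operator representing `crossOn S`. -/
def crossOp (θ : Plane) : Field2 →L[ℂ] Field2 :=
  gramOp hS (partialOp θ 0 0) (partialOp θ 1 1) + gramOp hS (partialOp θ 1 1) (partialOp θ 0 0) -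
    (gramOp hS (partialOp θ 0 1) (partialOp θ 1 0) + gramOp hS (partialOp θ 1 0) (partialOp θ 0 1))

/-- The operator representing `∫_{□ ∩ S} (div u conj (div φ) + curl u conj (curl φ))`. -/
def divCurlOp (θ : Plane) : Field2 →L[ℂ] Field2 :=
  gramOp hS (divOp θ) (divOp θ) + gramOp hS (curlOp θ) (curlOp θ)

theorem inner_gradOp (θ : Plane) (i : Fin 2) (g h : Field2) : inner ℂ g (gradOp hS θ i h) =
    dotOn S (grad (embedV θ h i)) (grad (embedV θ g i)) := by
  rw [gradOp, add_apply, inner_add_right, inner_gramOp, inner_gramOp]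
  simp only [← weakD_embedV]; rfl

theorem inner_crossOp (θ : Plane) (g h : Field2) :
    inner ℂ g (crossOp hS θ h) = crossOn S (embedV θ h) (embedV θ g) := by
  rw [crossOp, sub_apply, add_apply, add_apply, inner_sub_right, inner_add_right, inner_add_right,
    inner_gramOp, inner_gramOp, inner_gramOp, inner_gramOp]
  simp only [← weakD_embedV]
  simp only [crossOn, dotOn, grad, gradPerp, Matrix.cons_val_zero, Matrix.cons_val_one, map_neg,
    LinearMap.neg_apply]
  ring

theorem gradOp_symm (θ : Plane) (i : Fin 2) (g h : Field2) :
    inner ℂ (gradOp hS θ i g) h = inner ℂ g (gradOp hS θ i h) := by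
  simp only [gradOp, add_apply, inner_add_left, inner_add_right, gramOp_symm]

theorem crossOp_symm (θ : Plane) (g h : Field2) :
    inner ℂ (crossOp hS θ g) h = inner ℂ g (crossOp hS θ h) := by
  simp only [crossOp, add_apply, sub_apply, inner_add_left, inner_add_right, inner_sub_left,
    inner_sub_right, gramOp_symm]
  ring

theorem divCurlOp_symm (θ : Plane) (g h : Field2) :
    inner ℂ (divCurlOp hS θ g) h = inner ℂ g (divCurlOp hS θ h) := by
  simp only [divCurlOp, add_apply, inner_add_left, inner_add_right, gramOp_symm]

theorem norm_gradOp_le (θ : Plane) (i : Fin 2) : ‖gradOp hS θ i‖ ≤ 2 := by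
  have h0 := norm_gramOp_le hS (norm_partialOp_le θ i 0) (norm_partialOp_le θ i 0)
  have h1 := norm_gramOp_le hS (norm_partialOp_le θ i 1) (norm_partialOp_le θ i 1)
  exact (norm_add_le _ _).trans (by linarith)

theorem norm_crossOp_le (θ : Plane) : ‖crossOp hS θ‖ ≤ 4 := by
  have h0 := norm_gramOp_le hS (norm_partialOp_le θ 0 0) (norm_partialOp_le θ 1 1)
  have h1 := norm_gramOp_le hS (norm_partialOp_le θ 1 1) (norm_partialOp_le θ 0 0)
  have h2 := norm_gramOp_le hS (norm_partialOp_le θ 0 1) (norm_partialOp_le θ 1 0)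
  have h3 := norm_gramOp_le hS (norm_partialOp_le θ 1 0) (norm_partialOp_le θ 0 1)
  refine (norm_sub_le _ _).trans ?_
  linarith [norm_add_le (gramOp hS (partialOp θ 0 0) (partialOp θ 1 1))
      (gramOp hS (partialOp θ 1 1) (partialOp θ 0 0)),
    norm_add_le (gramOp hS (partialOp θ 0 1) (partialOp θ 1 0))
      (gramOp hS (partialOp θ 1 0) (partialOp θ 0 1))]

theorem re_inner_gramOp_self (P : Field2 →L[ℂ] L2) (h : Field2) :
    (inner ℂ h (gramOp hS P P h)).re = ‖indOp S hS (P h)‖ ^ 2 := by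
  rw [inner_gramOp_eq, inner_self_eq_ofReal, Complex.ofReal_re]

theorem re_inner_gradOp (θ : Plane) (i : Fin 2) (h : Field2) :
    (inner ℂ h (gradOp hS θ i h)).re =
      ‖indOp S hS (partialOp θ i 0 h)‖ ^ 2 + ‖indOp S hS (partialOp θ i 1 h)‖ ^ 2 := by
  rw [gradOp, add_apply, inner_add_right, Complex.add_re, re_inner_gramOp_self,
    re_inner_gramOp_self]

theorem re_inner_crossOp (θ : Plane) (h : Field2) : (inner ℂ h (crossOp hS θ h)).re =
    2 * (inner ℂ (indOp S hS (partialOp θ 0 0 h)) (indOp S hS (partialOp θ 1 1 h))).re -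
      2 * (inner ℂ (indOp S hS (partialOp θ 0 1 h)) (indOp S hS (partialOp θ 1 0 h))).re := by
  have hsym : ∀ x y : L2, (inner ℂ x y).re = (inner ℂ y x).re := fun x y => by
    rw [← inner_conj_symm, Complex.conj_re]
  simp only [crossOp, add_apply, sub_apply, inner_add_right, inner_sub_right, inner_gramOp_eq,
    Complex.add_re, Complex.sub_re]
  rw [hsym (indOp S hS (partialOp θ 1 1 h)), hsym (indOp S hS (partialOp θ 1 0 h))]
  ring

theorem re_inner_divCurlOp (θ : Plane) (h : Field2) : (inner ℂ h (divCurlOp hS θ h)).re =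
    ‖indOp S hS (divOp θ h)‖ ^ 2 + ‖indOp S hS (curlOp θ h)‖ ^ 2 := by
  rw [divCurlOp, add_apply, inner_add_right, Complex.add_re, re_inner_gramOp_self,
    re_inner_gramOp_self]

/-- The pointwise identity `|div u|² + |curl u|² = |∇u|² + X(u, u)`. -/
theorem re_inner_divCurlOp_eq (θ : Plane) (h : Field2) : (inner ℂ h (divCurlOp hS θ h)).re =
    (inner ℂ h (gradOp hS θ 0 h)).re + (inner ℂ h (gradOp hS θ 1 h)).re +
      (inner ℂ h (crossOp hS θ h)).re := by
  rw [re_inner_divCurlOp, re_inner_gradOp, re_inner_gradOp, re_inner_crossOp, divOp_apply,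
    curlOp_apply, map_add, map_sub, @norm_add_sq ℂ, @norm_sub_sq ℂ]
  have hsym : ∀ x y : L2, (inner ℂ x y).re = (inner ℂ y x).re := fun x y => by
    rw [← inner_conj_symm, Complex.conj_re]
  rw [hsym (indOp S hS (partialOp θ 0 1 h))]
  simp only [RCLike.re_to_complex]
  ring

theorem abs_re_inner_crossOp_le (θ : Plane) (h : Field2) : |(inner ℂ h (crossOp hS θ h)).re| ≤
    2 * (‖indOp S hS (partialOp θ 0 0 h)‖ * ‖indOp S hS (partialOp θ 1 1 h)‖) +
      2 * (‖indOp S hS (partialOp θ 0 1 h)‖ * ‖indOp S hS (partialOp θ 1 0 h)‖) := by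
  have h1 := (Complex.abs_re_le_norm _).trans (norm_inner_le_norm (𝕜 := ℂ)
    (indOp S hS (partialOp θ 0 0 h)) (indOp S hS (partialOp θ 1 1 h)))
  have h2 := (Complex.abs_re_le_norm _).trans (norm_inner_le_norm (𝕜 := ℂ)
    (indOp S hS (partialOp θ 0 1 h)) (indOp S hS (partialOp θ 1 0 h)))
  rw [re_inner_crossOp]
  rw [abs_le] at *
  constructor <;> linarith [h1.1, h1.2, h2.1, h2.2]

end Gram

section Forms

variable {R : Set Plane} (hR : MeasurableSet R) (ε₀ : ℝ)

/-- Multiplication by the square root `1 + (√ε₀ - 1) χ_R` of the weight in the second component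
of `c`. -/
def weightOp : L2 →L[ℂ] L2 := ContinuousLinearMap.id ℂ L2 + ((Real.sqrt ε₀ - 1 : ℝ) : ℂ) • indOp R hR

theorem inner_weightOp (hε₀ : 0 ≤ ε₀) (p q : L2) :
    inner ℂ (weightOp hR ε₀ q) (weightOp hR ε₀ p) =
      inner ℂ q p + ((ε₀ - 1 : ℝ) : ℂ) * pairing R p q := by
  have hs : ((Real.sqrt ε₀ : ℝ) : ℂ) ^ 2 = ε₀ := by exact_mod_cast Real.sq_sqrt hε₀
  simp only [weightOp, add_apply, smul_apply, ContinuousLinearMap.id_apply, inner_add_left,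
    inner_add_right, inner_smul_left, inner_smul_right, Complex.conj_ofReal,
    pairing_eq_inner hR, inner_indOp_left, indOp_indOp]
  push_cast
  linear_combination (inner ℂ q (indOp R hR p)) * hs

/-- The map `u ↦ (u₁, (1 + (√ε₀ - 1) χ_R) u₂)`, which turns `c` into the standard inner
product. -/
def weightV : L2V →ₗ[ℂ] Field2 where
  toFun u := WithLp.toLp 2 ![u 0, weightOp hR ε₀ (u 1)]
  map_add' u v := by
    ext1 i
    fin_cases i <;> simp
  map_smul' z u := by
    ext1 i
    fin_cases i <;> simp

theorem weightV_zero (u : L2V) : weightV hR ε₀ u 0 = u 0 := rfl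

theorem weightV_one (u : L2V) : weightV hR ε₀ u 1 = weightOp hR ε₀ (u 1) := rfl

theorem cForm_eq_inner (hε₀ : 0 ≤ ε₀) (u φ : L2V) :
    cForm R ε₀ u φ = inner ℂ (weightV hR ε₀ φ) (weightV hR ε₀ u) := by
  rw [inner_field, weightV_zero, weightV_zero, weightV_one, weightV_one, inner_weightOp hR ε₀ hε₀,
    cForm, dotOn, pairing_eq_inner measurableSet_cell, pairing_eq_inner measurableSet_cell,
    indOp_cell, indOp_cell, add_assoc]

theorem sq_norm_weightOp (hε₀ : 0 ≤ ε₀) (p : L2) :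
    ‖weightOp hR ε₀ p‖ ^ 2 = ‖p‖ ^ 2 + (ε₀ - 1) * ‖indOp R hR p‖ ^ 2 := by
  have h := inner_weightOp hR ε₀ hε₀ p p
  rw [pairing_eq_inner hR, ← inner_indOp_indOp hR, inner_self_eq_ofReal,
    inner_self_eq_ofReal, inner_self_eq_ofReal] at h
  exact_mod_cast h

theorem weightV_injective (hε₀ : 1 ≤ ε₀) : Function.Injective (weightV hR ε₀) := by
  refine (injective_iff_map_eq_zero _).2 fun u hu => ?_
  have h0 : u 0 = 0 := by rw [← weightV_zero hR ε₀ u, hu]; rfl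
  have h1 : weightOp hR ε₀ (u 1) = 0 := by rw [← weightV_one hR ε₀ u, hu]; rfl
  have h2 := sq_norm_weightOp hR ε₀ (by linarith) (u 1)
  rw [h1, norm_zero] at h2
  have h3 : ‖u 1‖ ^ 2 ≤ 0 := by
    nlinarith [mul_nonneg (sub_nonneg.2 hε₀) (sq_nonneg ‖indOp R hR (u 1)‖)]
  have h4 : u 1 = 0 := by simpa using le_antisymm h3 (sq_nonneg _)
  ext1 i
  fin_cases i
  · exact h0
  · exact h4

/-- The embedding of the form domain, parametrised by `L²(□; ℂ²)`, into the Hilbert space with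
inner product `c`. -/
def embedC (θ : Plane) : Field2 →L[ℂ] Field2 :=
  (PiLp.continuousLinearEquiv 2 ℂ (fun _ : Fin 2 => L2)).symm.toContinuousLinearMap ∘L
    ContinuousLinearMap.pi ![embedOp θ ∘L component 0,
      weightOp hR ε₀ ∘L embedOp θ ∘L component 1]

theorem embedC_eq (θ : Plane) (h : Field2) :
    embedC hR ε₀ θ h = weightV hR ε₀ (inclV (embedV θ h)) := by
  ext1 i
  fin_cases i <;> rfl

theorem embedC_zero (θ : Plane) (h : Field2) : embedC hR ε₀ θ h 0 = embedOp θ (h 0) := rfl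

theorem embedC_one (θ : Plane) (h : Field2) :
    embedC hR ε₀ θ h 1 = weightOp hR ε₀ (embedOp θ (h 1)) := rfl

theorem embedC_injective (hε₀ : 1 ≤ ε₀) (θ : Plane) : Function.Injective (embedC hR ε₀ θ) := by
  intro g h hgh
  rw [embedC_eq, embedC_eq] at hgh
  have h1 := weightV_injective hR ε₀ hε₀ hgh
  ext1 i
  exact embedOp_injective θ (congrFun h1 i)

theorem isCompactOperator_embedC (θ : Plane) : IsCompactOperator (embedC hR ε₀ θ) := by
  let ι : Fin 2 → L2 →L[ℂ] Field2 := fun i =>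
    (PiLp.continuousLinearEquiv 2 ℂ (fun _ : Fin 2 => L2)).symm.toContinuousLinearMap ∘L
      ContinuousLinearMap.single ℂ (fun _ : Fin 2 => L2) i
  have h0 : IsCompactOperator ((ι 0) ∘L embedOp θ ∘L component 0) :=
    ((isCompactOperator_embedOp θ).comp_clm (component 0)).clm_comp (ι 0)
  have h1 : IsCompactOperator ((ι 1 ∘L weightOp hR ε₀) ∘L embedOp θ ∘L component 1) :=
    ((isCompactOperator_embedOp θ).comp_clm (component 1)).clm_comp (ι 1 ∘L weightOp hR ε₀)
  have h2 : embedC hR ε₀ θ = (ι 0) ∘L embedOp θ ∘L component 0 +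
      (ι 1 ∘L weightOp hR ε₀) ∘L embedOp θ ∘L component 1 := by
    ext1 h
    refine PiLp.ext (Fin.forall_fin_two.2 ⟨?_, ?_⟩)
    · change embedOp θ (h 0) = (Pi.single 0 (embedOp θ (h 0)) : Fin 2 → L2) 0 +
        (Pi.single 1 (weightOp hR ε₀ (embedOp θ (h 1))) : Fin 2 → L2) 0
      simp
    · change weightOp hR ε₀ (embedOp θ (h 1)) = (Pi.single 0 (embedOp θ (h 0)) : Fin 2 → L2) 1 +
        (Pi.single 1 (weightOp hR ε₀ (embedOp θ (h 1))) : Fin 2 → L2) 1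
      simp
  rw [h2]
  exact h0.add h1

theorem sq_norm_embedC (hε₀ : 0 ≤ ε₀) (θ : Plane) (h : Field2) : ‖embedC hR ε₀ θ h‖ ^ 2 =
    ‖embedOp θ (h 0)‖ ^ 2 + ‖embedOp θ (h 1)‖ ^ 2 +
      (ε₀ - 1) * ‖indOp R hR (embedOp θ (h 1))‖ ^ 2 := by
  rw [sq_norm_field, embedC_zero, embedC_one, sq_norm_weightOp hR ε₀ hε₀, add_assoc]

theorem norm_embedC_le (hε₀ : 1 ≤ ε₀) (θ : Plane) : ‖embedC hR ε₀ θ‖ ≤ ε₀ := by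
  refine ContinuousLinearMap.opNorm_le_bound _ (by linarith) fun h => ?_
  refine le_of_sq_le_sq ?_ (by positivity)
  have h1 : ‖indOp R hR (embedOp θ (h 1))‖ ^ 2 ≤ ‖embedOp θ (h 1)‖ ^ 2 := by
    refine pow_le_pow_left₀ (norm_nonneg _) ?_ 2
    refine ((indOp R hR).le_opNorm _).trans ?_
    exact mul_le_of_le_one_left (norm_nonneg _) (norm_indOp_le hR)
  have h2 := sq_norm_embedOp_add θ (h 0)
  have h3 := sq_norm_embedOp_add θ (h 1)
  have h4 : ‖embedC hR ε₀ θ h‖ ^ 2 ≤ ε₀ * ‖h‖ ^ 2 := by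
    rw [sq_norm_embedC hR ε₀ (by linarith), sq_norm_field h]
    nlinarith [mul_le_mul_of_nonneg_left h1 (sub_nonneg.2 hε₀), sq_nonneg ‖derivOp θ 0 (h 0)‖,
      sq_nonneg ‖derivOp θ 1 (h 0)‖, sq_nonneg ‖derivOp θ 0 (h 1)‖, sq_nonneg ‖derivOp θ 1 (h 1)‖,
      sq_nonneg ‖embedOp θ (h 0)‖]
  rw [mul_pow]
  nlinarith [sq_nonneg ‖h‖]

/-- The common shape `-s X_{□ \ R} + c₁ (|∇u₁|² + ε₀ |∇u₂|²)_R + c₂ X_R` of the operators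
representing `b` and `b_ε`. -/
def bOp (θ : Plane) (s c₁ c₂ : ℝ) : Field2 →L[ℂ] Field2 :=
  ((-s : ℝ) : ℂ) • crossOp (measurableSet_cell.diff hR) θ +
    ((c₁ : ℂ) • (gradOp hR θ 0 + (ε₀ : ℂ) • gradOp hR θ 1) + (c₂ : ℂ) • crossOp hR θ)

theorem bForm_eq_inner (θ : Plane) (g h : Field2) :
    bForm R ε₀ (embedV θ h) (embedV θ g) =
      inner ℂ g (bOp hR ε₀ θ (1 / 2) (1 / (ε₀ - 1)) (1 / (ε₀ - 1)) h) := by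
  simp only [bOp, bForm, add_apply, smul_apply, inner_add_right, inner_smul_right, inner_crossOp,
    inner_gradOp]
  push_cast
  ring

theorem bEpsForm_eq_inner (ε : ℝ) (θ : Plane) (g h : Field2) :
    bEpsForm R ε₀ ε (embedV θ h) (embedV θ g) =
      inner ℂ g (bOp hR ε₀ θ ((1 - Real.sqrt (1 - ε)) / ε) (1 / (ε₀ - 1 + ε))
        (Real.sqrt (1 - ε) / (ε₀ - 1 + ε)) h) := by
  simp only [bOp, bEpsForm, add_apply, smul_apply, inner_add_right, inner_smul_right,
    inner_crossOp, inner_gradOp]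
  push_cast
  ring

theorem aForm_eq_inner (θ : Plane) (g h : Field2) :
    aForm R (embedV θ h) (embedV θ g) =
      inner ℂ g (divCurlOp (measurableSet_cell.diff hR) θ h) := by
  rw [divCurlOp, add_apply, inner_add_right, inner_gramOp, inner_gramOp, aForm, divV_embedV,
    divV_embedV, curlV_embedV, curlV_embedV]

theorem bOp_symm (θ : Plane) (s c₁ c₂ : ℝ) (g h : Field2) :
    inner ℂ (bOp hR ε₀ θ s c₁ c₂ g) h = inner ℂ g (bOp hR ε₀ θ s c₁ c₂ h) := by
  simp only [bOp, add_apply, smul_apply, inner_add_left, inner_add_right, inner_smul_left,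
    inner_smul_right, Complex.conj_ofReal, crossOp_symm, gradOp_symm]

theorem bOp_sub (θ : Plane) (s c₁ c₂ s' c₁' c₂' : ℝ) :
    bOp hR ε₀ θ s c₁ c₂ - bOp hR ε₀ θ s' c₁' c₂' =
      bOp hR ε₀ θ (s - s') (c₁ - c₁') (c₂ - c₂') := by
  simp only [bOp]
  push_cast
  module

theorem norm_bOp_le (hε₀ : 0 ≤ ε₀) (θ : Plane) (s c₁ c₂ : ℝ) :
    ‖bOp hR ε₀ θ s c₁ c₂‖ ≤ 4 * |s| + (2 + 2 * ε₀) * |c₁| + 4 * |c₂| := by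
  have h1 := norm_crossOp_le (measurableSet_cell.diff hR) θ
  have h2 := norm_crossOp_le hR θ
  have h3 := norm_gradOp_le hR θ 0
  have h4 := norm_gradOp_le hR θ 1
  have h5 : ‖gradOp hR θ 0 + (ε₀ : ℂ) • gradOp hR θ 1‖ ≤ 2 + 2 * ε₀ := by
    refine (norm_add_le _ _).trans ?_
    rw [norm_smul, Complex.norm_real, Real.norm_of_nonneg hε₀]
    nlinarith
  refine (norm_add_le _ _).trans ?_
  refine (add_le_add_right (norm_add_le _ _) _).trans ?_
  rw [norm_smul, norm_smul, norm_smul, Complex.norm_real, Complex.norm_real, Complex.norm_real,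
    Real.norm_eq_abs, Real.norm_eq_abs, Real.norm_eq_abs, abs_neg]
  nlinarith [mul_le_mul_of_nonneg_left h1 (abs_nonneg s),
    mul_le_mul_of_nonneg_left h5 (abs_nonneg c₁), mul_le_mul_of_nonneg_left h2 (abs_nonneg c₂)]

/-- The coercivity constant of the forms. -/
def coercConst : ℝ := (ε₀ - 1) / (ε₀ + 1) / (2 * ε₀)

theorem coercConst_pos (hε₀ : 1 < ε₀) : 0 < coercConst ε₀ := by
  have : 0 < ε₀ - 1 := by linarith
  rw [coercConst]; positivity

theorem coercConst_le (hε₀ : 1 < ε₀) : coercConst ε₀ ≤ 1 / 4 := by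
  rw [coercConst, div_div, div_le_iff₀ (by positivity)]
  nlinarith

/-- The quadratic form `x² + ε₀ y² - 2xy` is positive definite because `ε₀ > 1`. -/
theorem quadratic_lower_bound (hε₀ : 1 < ε₀) (x y : ℝ) :
    (ε₀ - 1) / (ε₀ + 1) * (x ^ 2 + y ^ 2) ≤ x ^ 2 + ε₀ * y ^ 2 - 2 * (x * y) := by
  rw [div_mul_eq_mul_div, div_le_iff₀ (by linarith)]
  nlinarith [sq_nonneg (2 * x - (ε₀ + 1) * y), sq_nonneg ((ε₀ - 1) * y)]

theorem le_gradient_add_cross (hε₀ : 1 < ε₀) {x y z w X c₁ c₂ : ℝ} (hx : 0 ≤ x) (hy : 0 ≤ y)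
    (hz : 0 ≤ z) (hw : 0 ≤ w) (hX : -(2 * (x * w) + 2 * (y * z)) ≤ X) (hc₂ : 0 ≤ c₂)
    (hc : c₂ ≤ c₁) (hc₁ : 1 / ε₀ ≤ c₁) :
    2 * coercConst ε₀ * (x ^ 2 + y ^ 2 + (z ^ 2 + w ^ 2)) ≤
      c₁ * (x ^ 2 + y ^ 2 + ε₀ * (z ^ 2 + w ^ 2)) + c₂ * X := by
  have q1 := quadratic_lower_bound ε₀ hε₀ x w
  have q2 := quadratic_lower_bound ε₀ hε₀ y z
  have hB : 0 ≤ 2 * (x * w) + 2 * (y * z) := by positivity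
  have h1 : -(c₁ * (2 * (x * w) + 2 * (y * z))) ≤ c₂ * X := by
    have e1 := mul_le_mul_of_nonneg_left hX hc₂
    have e2 := mul_le_mul_of_nonneg_right hc hB
    linarith
  have ht0 : 0 ≤ (ε₀ - 1) / (ε₀ + 1) * (x ^ 2 + y ^ 2 + (z ^ 2 + w ^ 2)) :=
    mul_nonneg (div_nonneg (by linarith) (by linarith)) (by positivity)
  have h2 := mul_le_mul_of_nonneg_right hc₁ ht0
  have h3 : 2 * coercConst ε₀ * (x ^ 2 + y ^ 2 + (z ^ 2 + w ^ 2)) =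
      1 / ε₀ * ((ε₀ - 1) / (ε₀ + 1) * (x ^ 2 + y ^ 2 + (z ^ 2 + w ^ 2))) := by
    rw [coercConst]
    have : ε₀ ≠ 0 := by linarith
    have : ε₀ + 1 ≠ 0 := by linarith
    field_simp
  have h4 : 0 ≤ c₁ := hc₂.trans hc
  have h5 := mul_le_mul_of_nonneg_left (add_le_add q1 q2) h4
  rw [h3]
  refine h2.trans ?_
  linarith

/-- Coercivity in the gradient: outside `R` the term `α a` with `α ≥ s` completes `-s X` to
`s |∇u|²`, and on `R` the integrand is positive definite as `ε₀ > 1`. -/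
theorem le_re_inner_add_bOp (hε₀ : 1 < ε₀) (θ : Plane) {α s c₁ c₂ : ℝ} (hs : 1 / 2 ≤ s)
    (hα : s ≤ α) (hc₂ : 0 ≤ c₂) (hc : c₂ ≤ c₁) (hc₁ : 1 / ε₀ ≤ c₁) (h : Field2) :
    coercConst ε₀ * (‖partialOp θ 0 0 h‖ ^ 2 + ‖partialOp θ 0 1 h‖ ^ 2 +
        (‖partialOp θ 1 0 h‖ ^ 2 + ‖partialOp θ 1 1 h‖ ^ 2)) ≤
      α * (inner ℂ h (divCurlOp (measurableSet_cell.diff hR) θ h)).re +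
        (inner ℂ h (bOp hR ε₀ θ s c₁ c₂ h)).re := by
  set hR' := measurableSet_cell.diff hR
  have hsplit : ∀ f : L2, ‖f‖ ^ 2 ≤ 2 * ‖indOp (cell \ R) hR' f‖ ^ 2 + 2 * ‖indOp R hR f‖ ^ 2 := by
    intro f
    have e := norm_add_le (indOp (cell \ R) hR' f) (indOp R hR f)
    rw [indOp_diff_add hR] at e
    nlinarith [norm_nonneg f, sq_nonneg (‖indOp (cell \ R) hR' f‖ - ‖indOp R hR f‖)]
  have hA := re_inner_divCurlOp_eq hR' θ h
  have hA0 : 0 ≤ (inner ℂ h (divCurlOp hR' θ h)).re := by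
    rw [re_inner_divCurlOp]; positivity
  have hb : (inner ℂ h (bOp hR ε₀ θ s c₁ c₂ h)).re =
      -s * (inner ℂ h (crossOp hR' θ h)).re +
        (c₁ * ((inner ℂ h (gradOp hR θ 0 h)).re + ε₀ * (inner ℂ h (gradOp hR θ 1 h)).re) +
          c₂ * (inner ℂ h (crossOp hR θ h)).re) := by
    simp only [bOp, add_apply, smul_apply, inner_add_right, inner_smul_right, Complex.add_re,
      Complex.re_ofReal_mul]
  have hX := abs_le.1 (abs_re_inner_crossOp_le hR θ h)
  have hout : 1 / 2 * ((inner ℂ h (gradOp hR' θ 0 h)).re + (inner ℂ h (gradOp hR' θ 1 h)).re) ≤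
      α * (inner ℂ h (divCurlOp hR' θ h)).re - s * (inner ℂ h (crossOp hR' θ h)).re := by
    have h1 := mul_le_mul_of_nonneg_right hα hA0
    have h2 : 0 ≤ (inner ℂ h (gradOp hR' θ 0 h)).re + (inner ℂ h (gradOp hR' θ 1 h)).re := by
      rw [re_inner_gradOp, re_inner_gradOp]; positivity
    have h3 := mul_le_mul_of_nonneg_right hs h2
    have h4 : s * (inner ℂ h (divCurlOp hR' θ h)).re =
        s * ((inner ℂ h (gradOp hR' θ 0 h)).re + (inner ℂ h (gradOp hR' θ 1 h)).re) +
          s * (inner ℂ h (crossOp hR' θ h)).re := by rw [hA]; ring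
    linarith
  rw [re_inner_gradOp, re_inner_gradOp] at hout hb
  have d00 := hsplit (partialOp θ 0 0 h)
  have d01 := hsplit (partialOp θ 0 1 h)
  have d10 := hsplit (partialOp θ 1 0 h)
  have d11 := hsplit (partialOp θ 1 1 h)
  set x := ‖indOp R hR (partialOp θ 0 0 h)‖
  set y := ‖indOp R hR (partialOp θ 0 1 h)‖
  set z := ‖indOp R hR (partialOp θ 1 0 h)‖
  set w := ‖indOp R hR (partialOp θ 1 1 h)‖
  set X := (inner ℂ h (crossOp hR θ h)).re
  have hin := le_gradient_add_cross ε₀ hε₀ (norm_nonneg _) (norm_nonneg _) (norm_nonneg _)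
    (norm_nonneg _) hX.1 hc₂ hc hc₁
  have hκ := coercConst_le ε₀ hε₀
  have hκ0 := (coercConst_pos ε₀ hε₀).le
  set κ := coercConst ε₀
  rw [hb]
  have hsum := mul_le_mul_of_nonneg_left (add_le_add (add_le_add d00 d01) (add_le_add d10 d11)) hκ0
  refine hsum.trans ?_
  have hout' := mul_le_mul_of_nonneg_right hκ
    (by positivity : 0 ≤ ‖indOp (cell \ R) hR' (partialOp θ 0 0 h)‖ ^ 2 +
      ‖indOp (cell \ R) hR' (partialOp θ 0 1 h)‖ ^ 2 +
      (‖indOp (cell \ R) hR' (partialOp θ 1 0 h)‖ ^ 2 +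
      ‖indOp (cell \ R) hR' (partialOp θ 1 1 h)‖ ^ 2))
  linarith

end Forms

/-! ### The div-curl problem -/

theorem sq_freq_lower (θ : Plane) (hθ : θ ∈ dualCell) {k : Fin 2 → ℤ} (hk : k ≠ 0) :
    1 / 4 ≤ freq θ k 0 ^ 2 + freq θ k 1 ^ 2 := by
  obtain ⟨j, hj⟩ := Function.ne_iff.1 hk
  have h1 : (1 : ℝ) ≤ |(k j : ℝ)| := by exact_mod_cast Int.one_le_abs hj
  have h2 : |θ j| ≤ 1 / 2 := abs_le.2 ⟨(hθ j).1, (hθ j).2.le⟩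
  have h3 : 1 / 2 ≤ |freq θ k j| := by
    have := abs_sub_abs_le_abs_sub (k j : ℝ) (-θ j)
    rw [abs_neg, sub_neg_eq_add] at this
    rw [freq]
    linarith
  have h4 : 1 / 4 ≤ freq θ k j ^ 2 := by
    rw [← sq_abs]
    nlinarith
  have h5 : freq θ k j ^ 2 ≤ freq θ k 0 ^ 2 + freq θ k 1 ^ 2 := by
    fin_cases j
    · exact le_add_of_nonneg_right (sq_nonneg _)
    · exact le_add_of_nonneg_left (sq_nonneg _)
  exact h4.trans h5

open Classical in
/-- The symbol `-i (k + θ)_j (1 + |k + θ|²)^{1/2} / |k + θ|²` of the `j`-th component of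
`∇ Δ⁻¹` in the parametrisation of `H¹_θ`; the zero mode, where it is not bounded uniformly in
`θ`, is left out. -/
def invSymbol (θ : Plane) (j : Fin 2) (k : Fin 2 → ℤ) : ℂ :=
  if k = 0 then 0 else
    -Complex.I * ((freq θ k j * weight θ k / (freq θ k 0 ^ 2 + freq θ k 1 ^ 2) : ℝ) : ℂ)

theorem norm_invSymbol_le {θ : Plane} (hθ : θ ∈ dualCell) (j : Fin 2) (k : Fin 2 → ℤ) :
    ‖invSymbol θ j k‖ ≤ 3 := by
  rw [invSymbol]
  split_ifs with hk
  · simp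
  have hpos := sq_freq_lower θ hθ hk
  rw [norm_mul, norm_neg, Complex.norm_I, one_mul, Complex.norm_real, Real.norm_eq_abs, abs_div,
    abs_of_nonneg (by positivity : 0 ≤ freq θ k 0 ^ 2 + freq θ k 1 ^ 2),
    div_le_iff₀ (by linarith)]
  refine abs_le_of_sq_le_sq ?_ (by positivity)
  rw [mul_pow, sq_weight]
  have hj : freq θ k j ^ 2 ≤ freq θ k 0 ^ 2 + freq θ k 1 ^ 2 := by
    fin_cases j
    · exact le_add_of_nonneg_right (sq_nonneg _)
    · exact le_add_of_nonneg_left (sq_nonneg _)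
  have h2 : 1 + freq θ k 0 ^ 2 + freq θ k 1 ^ 2 ≤ 5 * (freq θ k 0 ^ 2 + freq θ k 1 ^ 2) := by
    linarith
  calc freq θ k j ^ 2 * (1 + freq θ k 0 ^ 2 + freq θ k 1 ^ 2)
      ≤ (freq θ k 0 ^ 2 + freq θ k 1 ^ 2) * (5 * (freq θ k 0 ^ 2 + freq θ k 1 ^ 2)) :=
        mul_le_mul hj h2 (by positivity) (by positivity)
    _ ≤ _ := by nlinarith [sq_nonneg (freq θ k 0 ^ 2 + freq θ k 1 ^ 2)]

/-- The operator with symbol `invSymbol θ j`. -/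
def invOp (θ : Plane) (j : Fin 2) : L2 →L[ℂ] L2 := multiplier fourierBasis (invSymbol θ j)

/-- The lowest Bloch mode `(2π)⁻¹ e^{iθ·y}`. -/
def blochMode (θ : Plane) : L2 := expOp θ (fourierBasis 0)

theorem inner_blochMode (θ : Plane) (F : L2) :
    inner ℂ (blochMode θ) F = fourierBasis.repr (expOp (-θ) F) 0 := by
  rw [HilbertBasis.repr_apply_apply, ← inner_expOp θ (fourierBasis 0), expOp_expOp_neg, blochMode]

theorem derivOp_invOp {θ : Plane} (hθ : θ ∈ dualCell) (i j : Fin 2) (F : L2) (k : Fin 2 → ℤ) :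
    fourierBasis.repr (expOp (-θ) (derivOp θ i (invOp θ j F))) k =
      derivSymbol θ i k * invSymbol θ j k * fourierBasis.repr F k := by
  rw [derivOp, ContinuousLinearMap.comp_apply, expOp_neg_expOp, repr_multiplier_derivSymbol, invOp,
    repr_multiplier fourierBasis (norm_invSymbol_le hθ j), mul_assoc]

theorem derivSymbol_mul_invSymbol (θ : Plane) (i j : Fin 2) {k : Fin 2 → ℤ} (hk : k ≠ 0) :
    derivSymbol θ i k * invSymbol θ j k =
      ((freq θ k i * freq θ k j / (freq θ k 0 ^ 2 + freq θ k 1 ^ 2) : ℝ) : ℂ) := by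
  have hw : (weight θ k : ℂ) ≠ 0 := by exact_mod_cast (weight_pos θ k).ne'
  rw [invSymbol, if_neg hk, derivSymbol]
  have e : (freq θ k i / weight θ k) * (freq θ k j * weight θ k /
      (freq θ k 0 ^ 2 + freq θ k 1 ^ 2)) =
      freq θ k i * freq θ k j / (freq θ k 0 ^ 2 + freq θ k 1 ^ 2) := by
    have := (weight_pos θ k).ne'
    field_simp
  rw [← e, Complex.ofReal_mul]
  linear_combination (-(((freq θ k i / weight θ k : ℝ) : ℂ)) * ((freq θ k j * weight θ k /
      (freq θ k 0 ^ 2 + freq θ k 1 ^ 2) : ℝ) : ℂ)) * Complex.I_sq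

/-- The symbols of `div` and `curl` applied to `∇ Δ⁻¹ f` and `∇^⊥ Δ⁻¹ g`. -/
theorem sum_derivSymbol_mul_invSymbol {θ : Plane} (hθ : θ ∈ dualCell) {k : Fin 2 → ℤ}
    (hk : k ≠ 0) : derivSymbol θ 0 k * invSymbol θ 0 k + derivSymbol θ 1 k * invSymbol θ 1 k = 1 := by
  have := sq_freq_lower θ hθ hk
  have h0 : freq θ k 0 ^ 2 + freq θ k 1 ^ 2 ≠ 0 := by linarith
  rw [derivSymbol_mul_invSymbol θ 0 0 hk, derivSymbol_mul_invSymbol θ 1 1 hk, ← Complex.ofReal_add,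
    ← add_div, ← sq, ← sq, div_self h0, Complex.ofReal_one]

theorem derivSymbol_mul_invSymbol_comm (θ : Plane) (k : Fin 2 → ℤ) :
    derivSymbol θ 0 k * invSymbol θ 1 k = derivSymbol θ 1 k * invSymbol θ 0 k := by
  rcases eq_or_ne k 0 with hk | hk
  · simp [invSymbol, hk]
  · rw [derivSymbol_mul_invSymbol θ 0 1 hk, derivSymbol_mul_invSymbol θ 1 0 hk, mul_comm (freq θ k 0)]

theorem expOp_injective (θ : Plane) : Function.Injective (expOp θ) := fun f g h => by
  rw [← expOp_neg_expOp θ f, h, expOp_neg_expOp]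

/-- The div-curl problem on the torus is solvable, with a bound uniform in `θ`, for right-hand
sides orthogonal to the lowest Bloch mode. -/
theorem exists_divOp_curlOp_eq {θ : Plane} (hθ : θ ∈ dualCell) {F G : L2}
    (hF : inner ℂ (blochMode θ) F = 0) (hG : inner ℂ (blochMode θ) G = 0) :
    ∃ h : Field2, divOp θ h = F ∧ curlOp θ h = G ∧ ‖h‖ ^ 2 ≤ 36 * (‖F‖ ^ 2 + ‖G‖ ^ 2) := by
  rw [inner_blochMode] at hF hG
  set F' := expOp (-θ) F with hF'
  set G' := expOp (-θ) G with hG'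
  let h : Field2 := WithLp.toLp 2 ![invOp θ 0 F' - invOp θ 1 G', invOp θ 1 F' + invOp θ 0 G']
  have h0 : h 0 = invOp θ 0 F' - invOp θ 1 G' := rfl
  have h1 : h 1 = invOp θ 1 F' + invOp θ 0 G' := rfl
  refine ⟨h, ?_, ?_, ?_⟩
  · refine expOp_injective (-θ) (ext_repr fourierBasis fun k => ?_)
    rw [← hF', divOp_apply, partialOp_apply, partialOp_apply, h0, h1]
    simp only [map_add, map_sub, lp.coeFn_add, lp.coeFn_sub, Pi.add_apply, Pi.sub_apply,
      derivOp_invOp hθ]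
    rcases eq_or_ne k 0 with rfl | hk
    · rw [hF]; simp [invSymbol]
    · linear_combination fourierBasis.repr F' k * sum_derivSymbol_mul_invSymbol hθ hk -
        fourierBasis.repr G' k * derivSymbol_mul_invSymbol_comm θ k
  · refine expOp_injective (-θ) (ext_repr fourierBasis fun k => ?_)
    rw [← hG', curlOp_apply, partialOp_apply, partialOp_apply, h0, h1]
    simp only [map_add, map_sub, lp.coeFn_add, lp.coeFn_sub, Pi.add_apply, Pi.sub_apply,
      derivOp_invOp hθ]
    rcases eq_or_ne k 0 with rfl | hk
    · rw [hG]; simp [invSymbol]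
    · linear_combination fourierBasis.repr G' k * sum_derivSymbol_mul_invSymbol hθ hk +
        fourierBasis.repr F' k * derivSymbol_mul_invSymbol_comm θ k
  · have hb : ∀ j f, ‖invOp θ j f‖ ≤ 3 * ‖f‖ := fun j f =>
      ((invOp θ j).le_opNorm f).trans (mul_le_mul_of_nonneg_right
        (norm_multiplier_le fourierBasis (by norm_num) (norm_invSymbol_le hθ j)) (norm_nonneg f))
    have e0 : ‖h 0‖ ≤ 3 * (‖F‖ + ‖G‖) := by
      rw [h0]
      have a := hb 0 F'
      have b := hb 1 G'
      rw [hF', norm_expOp] at a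
      rw [hG', norm_expOp] at b
      linarith [norm_sub_le (invOp θ 0 F') (invOp θ 1 G')]
    have e1 : ‖h 1‖ ≤ 3 * (‖F‖ + ‖G‖) := by
      rw [h1]
      have a := hb 1 F'
      have b := hb 0 G'
      rw [hF', norm_expOp] at a
      rw [hG', norm_expOp] at b
      linarith [norm_add_le (invOp θ 1 F') (invOp θ 0 G')]
    rw [sq_norm_field]
    have s0 := pow_le_pow_left₀ (norm_nonneg _) e0 2
    have s1 := pow_le_pow_left₀ (norm_nonneg _) e1 2
    nlinarith [sq_nonneg (‖F‖ - ‖G‖)]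

section Correction

variable {R : Set Plane} (hR : MeasurableSet R)

theorem indOp_expOp {S : Set Plane} (hS : MeasurableSet S) (θ : Plane) (f : L2) :
    indOp S hS (expOp θ f) = expOp θ (indOp S hS f) := by
  refine Lp.ext ?_
  filter_upwards [coeFn_indOp hS (expOp θ f), coeFn_indOp hS f, coeFn_expOp θ f,
    coeFn_expOp θ (indOp S hS f)] with y h1 h2 h3 h4
  rw [h1, h3, h4, h2]
  ring

/-- The relative measure `(2π)⁻² |R ∩ □|` of `R` in the cell. -/
def massR : ℝ := ‖indOp R hR (fourierBasis 0)‖ ^ 2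

theorem indOp_fourierBasis_zero_ne_zero {S : Set Plane} (hS : IsOpen S) (hne : S.Nonempty)
    (hcell : S ⊆ cell) : indOp S hS.measurableSet (fourierBasis 0) ≠ 0 := by
  rw [Ne, indOp_eq_zero_iff, fourierBasis_apply]
  intro h
  have h1 : ∀ᵐ y ∂cellMeasure, y ∉ S := by
    filter_upwards [h, coeFn_fourierFun 0] with y h2 h3 hy
    have h4 := h2 hy
    rw [h3] at h4
    have h5 : ‖expI (latticePoint 0) y‖ ≠ 0 := by rw [norm_expI]; exact one_ne_zero
    have h6 : ((2 * Real.pi : ℝ) : ℂ)⁻¹ ≠ 0 :=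
      inv_ne_zero (by exact_mod_cast (by positivity : 2 * Real.pi ≠ 0))
    exact (mul_ne_zero h6 (norm_ne_zero_iff.1 h5)) h4
  have h2 : cellMeasure S = 0 := by
    have := ae_iff.1 h1
    simpa using this
  rw [cellMeasure, Measure.restrict_apply hS.measurableSet, Set.inter_eq_left.2 hcell] at h2
  exact (hS.measure_pos volume hne).ne' h2

theorem massR_pos (hRo : IsOpen R) (hne : R.Nonempty) (hcell : R ⊆ cell) :
    0 < massR hRo.measurableSet := by
  have := norm_pos_iff.2 (indOp_fourierBasis_zero_ne_zero hRo hne hcell)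
  rw [massR]; positivity

theorem massR_le_one : massR hR ≤ 1 := by
  have h : ‖indOp R hR (fourierBasis 0)‖ ≤ 1 := by
    refine ((indOp R hR).le_opNorm _).trans ?_
    rw [fourierBasis.orthonormal.1 0, mul_one]
    exact norm_indOp_le hR
  exact pow_le_one₀ (norm_nonneg _) h

/-- `f` corrected in `R` by a multiple of the lowest Bloch mode, so as to be orthogonal to it. -/
def correction (θ : Plane) (f : L2) : L2 :=
  f - (inner ℂ (blochMode θ) f / (massR hR : ℂ)) • indOp R hR (blochMode θ)

theorem sq_norm_indOp_blochMode (θ : Plane) : ‖indOp R hR (blochMode θ)‖ ^ 2 = massR hR := by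
  rw [blochMode, indOp_expOp, norm_expOp, massR]

theorem inner_correction (h0 : 0 < massR hR) (θ : Plane) (f : L2) :
    inner ℂ (blochMode θ) (correction hR θ f) = 0 := by
  rw [correction, inner_sub_right, inner_smul_right, ← inner_indOp_indOp hR, inner_self_eq_ofReal,
    sq_norm_indOp_blochMode, div_mul_cancel₀ _ (by exact_mod_cast h0.ne'), sub_self]

theorem norm_blochMode (θ : Plane) : ‖blochMode θ‖ = 1 := by
  rw [blochMode, norm_expOp, fourierBasis.orthonormal.1 0]

theorem norm_correction_le (h0 : 0 < massR hR) (θ : Plane) (f : L2) :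
    ‖correction hR θ f‖ ≤ (1 + (massR hR)⁻¹) * ‖f‖ := by
  refine (norm_sub_le _ _).trans ?_
  rw [norm_smul, norm_div, Complex.norm_real, Real.norm_of_nonneg h0.le, add_mul, one_mul]
  have h1 : ‖inner ℂ (blochMode θ) f‖ ≤ ‖f‖ := by
    refine (norm_inner_le_norm _ _).trans ?_
    rw [norm_blochMode, one_mul]
  have h2 : ‖indOp R hR (blochMode θ)‖ ≤ 1 := by
    have := sq_norm_indOp_blochMode hR θ
    nlinarith [massR_le_one hR, norm_nonneg (indOp R hR (blochMode θ))]
  refine add_le_add_right ?_ _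
  rw [div_eq_inv_mul, mul_assoc]
  refine mul_le_mul_of_nonneg_left ?_ (inv_nonneg.2 h0.le)
  calc ‖inner ℂ (blochMode θ) f‖ * ‖indOp R hR (blochMode θ)‖ ≤ ‖f‖ * 1 :=
        mul_le_mul h1 h2 (norm_nonneg _) (norm_nonneg _)
    _ = ‖f‖ := mul_one _

theorem indOp_diff_correction (θ : Plane) (f : L2) :
    indOp (cell \ R) (measurableSet_cell.diff hR) (correction hR θ f) =
      indOp (cell \ R) (measurableSet_cell.diff hR) f := by
  rw [correction, map_sub, map_smul, indOp_diff_indOp, smul_zero, sub_zero]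

/-- The parameters of the fields in `V(θ)`. -/
def constrainedSub (θ : Plane) : Submodule ℂ Field2 :=
  LinearMap.ker (indOp (cell \ R) (measurableSet_cell.diff hR) ∘L divOp θ).toLinearMap ⊓
    LinearMap.ker (indOp (cell \ R) (measurableSet_cell.diff hR) ∘L curlOp θ).toLinearMap

theorem mem_constrainedSub {θ : Plane} {h : Field2} : h ∈ constrainedSub hR θ ↔
    indOp (cell \ R) (measurableSet_cell.diff hR) (divOp θ h) = 0 ∧
      indOp (cell \ R) (measurableSet_cell.diff hR) (curlOp θ h) = 0 := Iff.rfl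

theorem isClosed_constrainedSub (θ : Plane) : IsClosed (constrainedSub hR θ : Set Field2) :=
  (ContinuousLinearMap.isClosed_ker _).inter (ContinuousLinearMap.isClosed_ker _)

theorem mem_constrained_iff (θ : Plane) (v : H1V) :
    v ∈ constrained R θ ↔ ∃ h ∈ constrainedSub hR θ, embedV θ h = v := by
  have hc : ∀ h, (∀ᵐ y ∂cellMeasure, y ∈ cell \ R →
      divV (embedV θ h) y = 0 ∧ curlV (embedV θ h) y = 0) ↔ h ∈ constrainedSub hR θ := by
    intro h
    rw [mem_constrainedSub, indOp_eq_zero_iff, indOp_eq_zero_iff, divV_embedV, curlV_embedV,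
      ← eventually_and]
    simp only [imp_and]
  constructor
  · rintro ⟨hv, hv'⟩
    obtain ⟨h, rfl⟩ := (mem_H1qp_iff θ v).1 hv
    exact ⟨h, (hc h).1 hv', rfl⟩
  · rintro ⟨h, hh, rfl⟩
    exact ⟨(mem_H1qp_iff θ _).2 ⟨h, rfl⟩, (hc h).2 hh⟩

theorem divCurlOp_eq_zero {θ : Plane} {k : Field2} (hk : k ∈ constrainedSub hR θ) :
    divCurlOp (measurableSet_cell.diff hR) θ k = 0 := by
  refine ext_inner_left ℂ fun g => ?_
  rw [mem_constrainedSub] at hk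
  rw [divCurlOp, add_apply, inner_add_right, inner_gramOp_eq, inner_gramOp_eq, hk.1, hk.2,
    inner_zero_right, inner_zero_right, add_zero, inner_zero_right]

/-- `a` controls the squared distance to the constrained fields, uniformly in `θ`: a field is
corrected by a solution of the div-curl problem on the torus, whose right-hand side agrees with
its divergence and curl outside `R` and is adjusted inside `R` so that the lowest Bloch mode
vanishes. -/
theorem exists_constrained_near (h0 : 0 < massR hR) {θ : Plane} (hθ : θ ∈ dualCell) (h : Field2) :
    ∃ k ∈ constrainedSub hR θ, ‖h - k‖ ^ 2 ≤ 36 * (1 + (massR hR)⁻¹) ^ 2 *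
      (inner ℂ h (divCurlOp (measurableSet_cell.diff hR) θ h)).re := by
  set hR' := measurableSet_cell.diff hR
  set f := indOp (cell \ R) hR' (divOp θ h) with hf
  set g := indOp (cell \ R) hR' (curlOp θ h) with hg
  obtain ⟨w, hw1, hw2, hw3⟩ := exists_divOp_curlOp_eq hθ (inner_correction hR h0 θ f)
    (inner_correction hR h0 θ g)
  refine ⟨h - w, ?_, ?_⟩
  · rw [mem_constrainedSub]
    refine ⟨?_, ?_⟩
    · rw [map_sub, hw1, map_sub, indOp_diff_correction, hf, indOp_indOp, sub_self]
    · rw [map_sub, hw2, map_sub, indOp_diff_correction, hg, indOp_indOp, sub_self]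
  · rw [sub_sub_cancel, re_inner_divCurlOp]
    have h1 := pow_le_pow_left₀ (norm_nonneg _) (norm_correction_le hR h0 θ f) 2
    have h2 := pow_le_pow_left₀ (norm_nonneg _) (norm_correction_le hR h0 θ g) 2
    rw [mul_pow] at h1 h2
    refine hw3.trans ?_
    rw [mul_assoc]
    refine mul_le_mul_of_nonneg_left ?_ (by norm_num)
    rw [mul_add]
    exact add_le_add h1 h2

/-- `L²(R)` is infinite-dimensional: disjoint open shells in `R` carry orthogonal functions. -/
theorem not_finiteDimensional_range_indOp (hRo : IsOpen R) (hne : R.Nonempty) (hcell : R ⊆ cell) :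
    ¬ FiniteDimensional ℂ (LinearMap.range (indOp R hR).toLinearMap) := by
  intro hfd
  obtain ⟨x, hx⟩ := hne
  obtain ⟨r, hr, hball⟩ := Metric.isOpen_iff.1 hRo x hx
  let A : ℕ → Set Plane := fun n =>
    Metric.ball x (r / (n + 1)) \ Metric.closedBall x (r / (n + 2))
  have hAo : ∀ n, IsOpen (A n) := fun n => Metric.isOpen_ball.sdiff Metric.isClosed_closedBall
  have hlt : ∀ n : ℕ, r / (n + 2) < r / (n + 1) := fun n =>
    div_lt_div_of_pos_left hr (by positivity) (by linarith)
  have hAsub : ∀ n, A n ⊆ R := by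
    intro n y hy
    refine hball (Metric.ball_subset_ball ?_ hy.1)
    exact div_le_self hr.le (by linarith [(Nat.cast_nonneg n : (0 : ℝ) ≤ n)])
  have hAne : ∀ n, (A n).Nonempty := by
    intro n
    obtain ⟨s, hs1, hs2⟩ := exists_between (hlt n)
    have hs0 : 0 < s := lt_trans (by positivity) hs1
    refine ⟨x + EuclideanSpace.single 0 s, ?_, ?_⟩
    · rw [Metric.mem_ball, dist_self_add_left, PiLp.norm_single, Real.norm_of_nonneg hs0.le]
      exact hs2
    · rw [Metric.mem_closedBall, dist_self_add_left, PiLp.norm_single,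
        Real.norm_of_nonneg hs0.le, not_le]
      exact hs1
  have hAdisj : ∀ m n, m < n → Disjoint (A m) (A n) := by
    intro m n hmn
    rw [Set.disjoint_left]
    rintro y ⟨-, hy⟩ ⟨hy', -⟩
    refine hy (Metric.ball_subset_closedBall (Metric.ball_subset_ball ?_ hy'))
    have : (m : ℝ) + 1 ≤ n := by exact_mod_cast hmn
    exact div_le_div_of_nonneg_left hr.le (by positivity) (by linarith)
  let F : ℕ → L2 := fun n => indOp (A n) (hAo n).measurableSet (fourierBasis 0)
  have hF0 : ∀ n, F n ≠ 0 := fun n =>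
    indOp_fourierBasis_zero_ne_zero (hAo n) (hAne n) ((hAsub n).trans hcell)
  have hForth : ∀ m n, m ≠ n → inner ℂ (F m) (F n) = 0 := by
    intro m n hmn
    have hd : Disjoint (A m) (A n) := by
      rcases lt_or_gt_of_ne hmn with h | h
      · exact hAdisj m n h
      · exact (hAdisj n m h).symm
    rw [inner_L2_eq, ← integral_zero Plane ℂ (μ := cellMeasure)]
    refine integral_congr_ae ?_
    filter_upwards [coeFn_indOp (hAo m).measurableSet (fourierBasis 0),
      coeFn_indOp (hAo n).measurableSet (fourierBasis 0)] with y h1 h2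
    simp only [F]
    rw [h1, h2]
    by_cases hy : y ∈ A m
    · have : y ∉ A n := Set.disjoint_left.1 hd hy
      simp [this]
    · simp [hy]
  have hli : LinearIndependent ℂ F := linearIndependent_of_ne_zero_of_inner_eq_zero hF0
    fun m n hmn => hForth m n hmn
  have hFR : ∀ n, F n ∈ LinearMap.range (indOp R hR).toLinearMap := by
    intro n
    refine ⟨F n, ?_⟩
    change indOp R hR (F n) = F n
    refine Lp.ext ?_
    filter_upwards [coeFn_indOp hR (F n),
      coeFn_indOp (hAo n).measurableSet (fourierBasis 0)] with y h1 h2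
    rw [h1]
    by_cases hy : y ∈ R
    · simp [hy]
    · have : y ∉ A n := fun h => hy (hAsub n h)
      simp only [F]
      rw [h2]
      simp [this]
  have hli' : LinearIndependent ℂ fun n => (⟨F n, hFR n⟩ : LinearMap.range (indOp R hR).toLinearMap) :=
    LinearIndependent.of_comp (LinearMap.range (indOp R hR).toLinearMap).subtype hli
  have := hli'.finite
  exact not_finite ℕ

/-- `V(θ)` is infinite-dimensional: the divergences of its elements exhaust the functions in
`L²(R)` orthogonal to the lowest Bloch mode. -/
theorem not_finiteDimensional_constrainedSub (hRo : IsOpen R) (hne : R.Nonempty)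
    (hcell : R ⊆ cell) {θ : Plane} (hθ : θ ∈ dualCell) :
    ¬ FiniteDimensional ℂ (constrainedSub hR θ) := by
  intro hfd
  have h0 : 0 < massR hR := massR_pos hRo hne hcell
  refine not_finiteDimensional_range_indOp hR hRo hne hcell ?_
  have hfd1 : FiniteDimensional ℂ ((constrainedSub hR θ).map (divOp θ).toLinearMap) := inferInstance
  have hfd2 : FiniteDimensional ℂ (((constrainedSub hR θ).map (divOp θ).toLinearMap ⊔
      ℂ ∙ indOp R hR (blochMode θ) : Submodule ℂ L2)) := inferInstance
  refine Submodule.finiteDimensional_of_le (S₂ := (constrainedSub hR θ).map (divOp θ).toLinearMap ⊔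
      ℂ ∙ indOp R hR (blochMode θ)) ?_
  rintro _ ⟨f, rfl⟩
  change indOp R hR f ∈ _
  obtain ⟨w, hw1, hw2, -⟩ := exists_divOp_curlOp_eq hθ (inner_correction hR h0 θ (indOp R hR f))
    (inner_zero_right (blochMode θ))
  have hmem : w ∈ constrainedSub hR θ := by
    rw [mem_constrainedSub, hw1, hw2, indOp_diff_correction, indOp_diff_indOp, map_zero]
    exact ⟨rfl, rfl⟩
  have e : indOp R hR f = divOp θ w +
      (inner ℂ (blochMode θ) (indOp R hR f) / (massR hR : ℂ)) • indOp R hR (blochMode θ) := by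
    rw [hw1, correction, sub_add_cancel]
  rw [e]
  exact Submodule.add_mem_sup ⟨w, hmem, rfl⟩
    (Submodule.smul_mem _ _ (Submodule.mem_span_singleton_self _))

end Correction

/-! ### Uniform coercivity and the norm estimate for the solution operators -/

open ContinuousLinearMap (adjoint adjoint_inner_left adjoint_inner_right)

section Coefficients

variable {ε : ℝ}

theorem one_sub_sqrt_div_eq (hε : ε ∈ Set.Ioo (0 : ℝ) 1) :
    (1 - Real.sqrt (1 - ε)) / ε = 1 / (1 + Real.sqrt (1 - ε)) := by
  have h1 : Real.sqrt (1 - ε) ^ 2 = 1 - ε := Real.sq_sqrt (by linarith [hε.2])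
  have h2 := Real.sqrt_nonneg (1 - ε)
  rw [div_eq_div_iff hε.1.ne' (by positivity)]
  linarith

theorem sqrt_one_sub_le_one (hε : ε ∈ Set.Ioo (0 : ℝ) 1) : Real.sqrt (1 - ε) ≤ 1 :=
  Real.sqrt_le_one.2 (by linarith [hε.1])

theorem one_sub_le_sqrt (hε : ε ∈ Set.Ioo (0 : ℝ) 1) : 1 - ε ≤ Real.sqrt (1 - ε) :=
  Real.le_sqrt_of_sq_le (by nlinarith [hε.1, hε.2])

theorem half_le_one_sub_sqrt_div (hε : ε ∈ Set.Ioo (0 : ℝ) 1) :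
    1 / 2 ≤ (1 - Real.sqrt (1 - ε)) / ε := by
  rw [one_sub_sqrt_div_eq hε]
  exact one_div_le_one_div_of_le (by linarith [Real.sqrt_nonneg (1 - ε)])
    (by linarith [sqrt_one_sub_le_one hε])

theorem one_sub_sqrt_div_le_one (hε : ε ∈ Set.Ioo (0 : ℝ) 1) :
    (1 - Real.sqrt (1 - ε)) / ε ≤ 1 := by
  rw [div_le_one hε.1]
  linarith [one_sub_le_sqrt hε]

theorem abs_half_sub_le (hε : ε ∈ Set.Ioo (0 : ℝ) 1) :
    |1 / 2 - (1 - Real.sqrt (1 - ε)) / ε| ≤ ε := by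
  have h2 := Real.sqrt_nonneg (1 - ε)
  rw [abs_sub_comm, abs_of_nonneg (by linarith [half_le_one_sub_sqrt_div hε]),
    one_sub_sqrt_div_eq hε, sub_le_iff_le_add, div_le_iff₀ (by positivity)]
  nlinarith [one_sub_le_sqrt hε, hε.1]

variable {ε₀ : ℝ}

theorem abs_one_div_sub_le (hε₀ : 1 < ε₀) (hε : ε ∈ Set.Ioo (0 : ℝ) 1) :
    |1 / (ε₀ - 1) - 1 / (ε₀ - 1 + ε)| ≤ ε₀ / (ε₀ - 1) ^ 2 * ε := by
  have hγ : 0 < ε₀ - 1 := by linarith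
  have hε' := hε.1
  have h : 1 / (ε₀ - 1) - 1 / (ε₀ - 1 + ε) = ε / ((ε₀ - 1) * (ε₀ - 1 + ε)) := by
    field_simp
    ring
  rw [h, abs_of_nonneg (by positivity), div_mul_eq_mul_div]
  refine div_le_div₀ (by nlinarith) (by nlinarith) (by positivity) ?_
  nlinarith

theorem abs_one_div_sub_sqrt_div_le (hε₀ : 1 < ε₀) (hε : ε ∈ Set.Ioo (0 : ℝ) 1) :
    |1 / (ε₀ - 1) - Real.sqrt (1 - ε) / (ε₀ - 1 + ε)| ≤ ε₀ / (ε₀ - 1) ^ 2 * ε := by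
  have hγ : 0 < ε₀ - 1 := by linarith
  have hε' := hε.1
  have h1 := one_sub_le_sqrt hε
  have h2 := sqrt_one_sub_le_one hε
  have h : 1 / (ε₀ - 1) - Real.sqrt (1 - ε) / (ε₀ - 1 + ε) =
      ((ε₀ - 1) * (1 - Real.sqrt (1 - ε)) + ε) / ((ε₀ - 1) * (ε₀ - 1 + ε)) := by
    field_simp
    ring
  have h3 : 0 ≤ (ε₀ - 1) * (1 - Real.sqrt (1 - ε)) + ε := by
    have := mul_nonneg hγ.le (sub_nonneg.2 h2)
    linarith
  rw [h, abs_of_nonneg (by positivity), div_mul_eq_mul_div]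
  refine div_le_div₀ (by nlinarith) ?_ (by positivity) (by nlinarith)
  nlinarith

theorem one_div_le_one_div_add (hε₀ : 1 < ε₀) (hε : ε ∈ Set.Ioo (0 : ℝ) 1) :
    1 / ε₀ ≤ 1 / (ε₀ - 1 + ε) :=
  one_div_le_one_div_of_le (by linarith [hε.1]) (by linarith [hε.2])

theorem one_div_add_le (hε₀ : 1 < ε₀) (hε : ε ∈ Set.Ioo (0 : ℝ) 1) :
    1 / (ε₀ - 1 + ε) ≤ 1 / (ε₀ - 1) :=
  one_div_le_one_div_of_le (by linarith) (by linarith [hε.1])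

theorem sqrt_div_nonneg (hε₀ : 1 < ε₀) (hε : ε ∈ Set.Ioo (0 : ℝ) 1) :
    0 ≤ Real.sqrt (1 - ε) / (ε₀ - 1 + ε) :=
  div_nonneg (Real.sqrt_nonneg _) (by linarith [hε.1])

theorem sqrt_div_le (hε₀ : 1 < ε₀) (hε : ε ∈ Set.Ioo (0 : ℝ) 1) :
    Real.sqrt (1 - ε) / (ε₀ - 1 + ε) ≤ 1 / (ε₀ - 1 + ε) :=
  div_le_div_of_nonneg_right (sqrt_one_sub_le_one hε) (by linarith [hε.1])

end Coefficients

variable {R : Set Plane} (hR : MeasurableSet R) (ε₀ : ℝ)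

/-- The operator representing `b`. -/
def critOp (θ : Plane) : Field2 →L[ℂ] Field2 :=
  bOp hR ε₀ θ (1 / 2) (1 / (ε₀ - 1)) (1 / (ε₀ - 1))

/-- The operator representing `b_ε`. -/
def epsOp (ε : ℝ) (θ : Plane) : Field2 →L[ℂ] Field2 :=
  bOp hR ε₀ θ ((1 - Real.sqrt (1 - ε)) / ε) (1 / (ε₀ - 1 + ε))
    (Real.sqrt (1 - ε) / (ε₀ - 1 + ε))

/-- The operator representing `ε⁻¹ a + b_ε + c` on `H¹_θ(□; ℂ²)`. -/
def aboveOp (ε : ℝ) (θ : Plane) : Field2 →L[ℂ] Field2 :=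
  (ε : ℂ)⁻¹ • divCurlOp (measurableSet_cell.diff hR) θ + epsOp hR ε₀ ε θ +
    adjoint (embedC hR ε₀ θ) ∘L embedC hR ε₀ θ

instance completeSpace_constrainedSub (θ : Plane) : CompleteSpace (constrainedSub hR θ) :=
  (isClosed_constrainedSub hR θ).completeSpace_coe

/-- The embedding of `V(θ)` into `L²(□; ℂ²)`. -/
def critEmbed (θ : Plane) : constrainedSub hR θ →L[ℂ] Field2 :=
  embedC hR ε₀ θ ∘L (constrainedSub hR θ).subtypeL

/-- The operator representing `b + c` on `V(θ)`. -/
def critOnOp (θ : Plane) : constrainedSub hR θ →L[ℂ] constrainedSub hR θ :=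
  adjoint (constrainedSub hR θ).subtypeL ∘L
    (critOp hR ε₀ θ + adjoint (embedC hR ε₀ θ) ∘L embedC hR ε₀ θ) ∘L
      (constrainedSub hR θ).subtypeL

theorem inner_aboveOp (ε : ℝ) (θ : Plane) (g h : Field2) :
    inner ℂ g (aboveOp hR ε₀ ε θ h) =
      (ε : ℂ)⁻¹ * inner ℂ g (divCurlOp (measurableSet_cell.diff hR) θ h) +
        inner ℂ g (epsOp hR ε₀ ε θ h) + inner ℂ (embedC hR ε₀ θ g) (embedC hR ε₀ θ h) := by
  rw [aboveOp, add_apply, add_apply, smul_apply, inner_add_right, inner_add_right,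
    inner_smul_right, ContinuousLinearMap.comp_apply, adjoint_inner_right]

theorem inner_critOnOp (θ : Plane) (g h : constrainedSub hR θ) :
    inner ℂ g (critOnOp hR ε₀ θ h) = inner ℂ (g : Field2) (critOp hR ε₀ θ h) +
      inner ℂ (critEmbed hR ε₀ θ g) (critEmbed hR ε₀ θ h) := by
  rw [critOnOp, ContinuousLinearMap.comp_apply, adjoint_inner_right,
    ContinuousLinearMap.comp_apply, add_apply, inner_add_right, ContinuousLinearMap.comp_apply,
    adjoint_inner_right]
  rfl

theorem re_inner_aboveOp (ε : ℝ) (θ : Plane) (h : Field2) :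
    (inner ℂ h (aboveOp hR ε₀ ε θ h)).re =
      ε⁻¹ * (inner ℂ h (divCurlOp (measurableSet_cell.diff hR) θ h)).re +
        (inner ℂ h (epsOp hR ε₀ ε θ h)).re + ‖embedC hR ε₀ θ h‖ ^ 2 := by
  rw [inner_aboveOp, inner_self_eq_ofReal, Complex.add_re, Complex.add_re, Complex.ofReal_re,
    ← Complex.ofReal_inv, Complex.re_ofReal_mul]

/-- The gradients and the `L²` norm control the norm of the parameter. -/
theorem coercConst_mul_sq_norm_le (hε₀ : 1 < ε₀) (θ : Plane) (h : Field2) :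
    coercConst ε₀ * ‖h‖ ^ 2 ≤
      coercConst ε₀ * (‖partialOp θ 0 0 h‖ ^ 2 + ‖partialOp θ 0 1 h‖ ^ 2 +
        (‖partialOp θ 1 0 h‖ ^ 2 + ‖partialOp θ 1 1 h‖ ^ 2)) + ‖embedC hR ε₀ θ h‖ ^ 2 := by
  have h0 := sq_norm_embedOp_add θ (h 0)
  have h1 := sq_norm_embedOp_add θ (h 1)
  have hc := coercConst_pos ε₀ hε₀
  have hc' := coercConst_le ε₀ hε₀
  have e0 : 0 ≤ ‖embedOp θ (h 0)‖ ^ 2 := sq_nonneg _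
  have e1 : 0 ≤ ‖embedOp θ (h 1)‖ ^ 2 := sq_nonneg _
  have e2 : 0 ≤ (ε₀ - 1) * ‖indOp R hR (embedOp θ (h 1))‖ ^ 2 :=
    mul_nonneg (by linarith) (sq_nonneg _)
  rw [sq_norm_embedC hR ε₀ (by linarith), sq_norm_field, ← h0, ← h1]
  simp only [partialOp_apply]
  nlinarith

theorem gradient_sum_nonneg (hε₀ : 1 < ε₀) (θ : Plane) (h : Field2) :
    0 ≤ coercConst ε₀ * (‖partialOp θ 0 0 h‖ ^ 2 + ‖partialOp θ 0 1 h‖ ^ 2 +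
        (‖partialOp θ 1 0 h‖ ^ 2 + ‖partialOp θ 1 1 h‖ ^ 2)) :=
  mul_nonneg (coercConst_pos ε₀ hε₀).le (by positivity)

theorem le_re_inner_above (hε₀ : 1 < ε₀) {ε : ℝ} (hε : ε ∈ Set.Ioo (0 : ℝ) 1) (θ : Plane)
    (h : Field2) :
    coercConst ε₀ * (‖partialOp θ 0 0 h‖ ^ 2 + ‖partialOp θ 0 1 h‖ ^ 2 +
        (‖partialOp θ 1 0 h‖ ^ 2 + ‖partialOp θ 1 1 h‖ ^ 2)) ≤
      ε⁻¹ * (inner ℂ h (divCurlOp (measurableSet_cell.diff hR) θ h)).re +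
        (inner ℂ h (epsOp hR ε₀ ε θ h)).re :=
  le_re_inner_add_bOp hR ε₀ hε₀ θ (half_le_one_sub_sqrt_div hε)
    ((one_sub_sqrt_div_le_one hε).trans ((one_le_inv₀ hε.1).2 hε.2.le))
    (sqrt_div_nonneg hε₀ hε) (sqrt_div_le hε₀ hε) (one_div_le_one_div_add hε₀ hε) h

theorem le_re_inner_crit (hε₀ : 1 < ε₀) {θ : Plane} {k : Field2}
    (hk : k ∈ constrainedSub hR θ) :
    coercConst ε₀ * (‖partialOp θ 0 0 k‖ ^ 2 + ‖partialOp θ 0 1 k‖ ^ 2 +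
        (‖partialOp θ 1 0 k‖ ^ 2 + ‖partialOp θ 1 1 k‖ ^ 2)) ≤
      (inner ℂ k (critOp hR ε₀ θ k)).re := by
  have hγ : 0 < ε₀ - 1 := by linarith
  have h := le_re_inner_add_bOp hR ε₀ hε₀ θ (α := 1 / 2) le_rfl le_rfl
    (one_div_pos.2 hγ).le le_rfl (one_div_le_one_div_of_le hγ (by linarith)) k
  rwa [divCurlOp_eq_zero hR hk, inner_zero_right, Complex.zero_re, mul_zero, zero_add] at h

theorem isCoercivePair_above (hε₀ : 1 < ε₀) {ε : ℝ} (hε : ε ∈ Set.Ioo (0 : ℝ) 1) (θ : Plane) :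
    IsCoercivePair (embedC hR ε₀ θ) (aboveOp hR ε₀ ε θ) where
  compact := isCompactOperator_embedC hR ε₀ θ
  symm g h := by
    change inner ℂ (aboveOp hR ε₀ ε θ g) h = inner ℂ g (aboveOp hR ε₀ ε θ h)
    rw [← inner_conj_symm, inner_aboveOp, inner_aboveOp, map_add, map_add, map_mul,
      inner_conj_symm, inner_conj_symm, inner_conj_symm, divCurlOp_symm, epsOp, bOp_symm,
      ← Complex.ofReal_inv, Complex.conj_ofReal]
  coercive := ⟨coercConst ε₀, coercConst_pos ε₀ hε₀, fun h => by
    rw [re_inner_aboveOp]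
    linarith [coercConst_mul_sq_norm_le hR ε₀ hε₀ θ h, le_re_inner_above hR ε₀ hε₀ hε θ h]⟩
  dominates h := by
    rw [re_inner_aboveOp]
    linarith [gradient_sum_nonneg ε₀ hε₀ θ h, le_re_inner_above hR ε₀ hε₀ hε θ h]

theorem isCoercivePair_crit (hε₀ : 1 < ε₀) (θ : Plane) :
    IsCoercivePair (critEmbed hR ε₀ θ) (critOnOp hR ε₀ θ) where
  compact := (isCompactOperator_embedC hR ε₀ θ).comp_clm _
  symm g h := by
    change inner ℂ (critOnOp hR ε₀ θ g) h = inner ℂ g (critOnOp hR ε₀ θ h)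
    rw [← inner_conj_symm (critOnOp hR ε₀ θ g) h, inner_critOnOp, inner_critOnOp, map_add, inner_conj_symm,
      inner_conj_symm, critOp, bOp_symm]
  coercive := ⟨coercConst ε₀, coercConst_pos ε₀ hε₀, fun k => by
    rw [inner_critOnOp, inner_self_eq_ofReal, Complex.add_re, Complex.ofReal_re]
    exact (coercConst_mul_sq_norm_le hR ε₀ hε₀ θ k).trans
      (add_le_add_left (le_re_inner_crit hR ε₀ hε₀ k.2) _)⟩
  dominates k := by
    rw [inner_critOnOp, inner_self_eq_ofReal, Complex.add_re, Complex.ofReal_re]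
    linarith [gradient_sum_nonneg ε₀ hε₀ θ k, le_re_inner_crit hR ε₀ hε₀ k.2]

/-- A common bound for the norms of the operators representing the forms, for the constant in the
correction to a constrained field, and for the rate at which `b_ε` tends to `b`. -/
def dataBound : ℝ :=
  36 * (1 + (massR hR)⁻¹) ^ 2 + ε₀ + (4 + (6 + 2 * ε₀) / (ε₀ - 1)) +
    (4 + (6 + 2 * ε₀) * (ε₀ / (ε₀ - 1) ^ 2))

theorem norm_bOp_le_of_le (hε₀ : 0 ≤ ε₀) (θ : Plane) {s c₁ c₂ p q : ℝ} (hs : |s| ≤ p)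
    (h₁ : |c₁| ≤ q) (h₂ : |c₂| ≤ q) :
    ‖bOp hR ε₀ θ s c₁ c₂‖ ≤ 4 * p + (6 + 2 * ε₀) * q := by
  refine (norm_bOp_le hR ε₀ hε₀ θ s c₁ c₂).trans ?_
  have := mul_le_mul_of_nonneg_left h₁ (by linarith : 0 ≤ 2 + 2 * ε₀)
  linarith

theorem norm_critOp_le (hε₀ : 1 < ε₀) (θ : Plane) :
    ‖critOp hR ε₀ θ‖ ≤ 4 + (6 + 2 * ε₀) / (ε₀ - 1) := by
  have hγ : 0 < ε₀ - 1 := by linarith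
  have h1 : |1 / (ε₀ - 1)| ≤ 1 / (ε₀ - 1) := (abs_of_pos (one_div_pos.2 hγ)).le
  refine (norm_bOp_le_of_le hR ε₀ (by linarith) θ (p := 1) (by norm_num [abs_of_pos]) h1 h1).trans_eq ?_
  ring

theorem norm_epsOp_le (hε₀ : 1 < ε₀) {ε : ℝ} (hε : ε ∈ Set.Ioo (0 : ℝ) 1) (θ : Plane) :
    ‖epsOp hR ε₀ ε θ‖ ≤ 4 + (6 + 2 * ε₀) / (ε₀ - 1) := by
  have hs := half_le_one_sub_sqrt_div hε
  have hγ : 0 < ε₀ - 1 + ε := by linarith [hε.1]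
  refine (norm_bOp_le_of_le hR ε₀ (by linarith) θ (p := 1) (q := 1 / (ε₀ - 1)) ?_ ?_ ?_).trans_eq ?_
  · rw [abs_of_nonneg (by linarith)]
    exact one_sub_sqrt_div_le_one hε
  · rw [abs_of_pos (one_div_pos.2 hγ)]
    exact one_div_add_le hε₀ hε
  · rw [abs_of_nonneg (sqrt_div_nonneg hε₀ hε)]
    exact (sqrt_div_le hε₀ hε).trans (one_div_add_le hε₀ hε)
  · ring

theorem norm_critOp_sub_epsOp_le (hε₀ : 1 < ε₀) {ε : ℝ} (hε : ε ∈ Set.Ioo (0 : ℝ) 1)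
    (θ : Plane) :
    ‖critOp hR ε₀ θ - epsOp hR ε₀ ε θ‖ ≤ (4 + (6 + 2 * ε₀) * (ε₀ / (ε₀ - 1) ^ 2)) * ε := by
  rw [critOp, epsOp, bOp_sub]
  refine (norm_bOp_le_of_le hR ε₀ (by linarith) θ (abs_half_sub_le hε)
    (abs_one_div_sub_le hε₀ hε) (abs_one_div_sub_sqrt_div_le hε₀ hε)).trans_eq ?_
  ring

/-- The solution operators on and above the critical line differ by `O(ε)` in norm, uniformly in
`θ`. -/
theorem norm_solutionOp_above_sub_crit_le (hε₀ : 1 < ε₀) (h0 : 0 < massR hR) {θ : Plane}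
    (hθ : θ ∈ dualCell) {ε : ℝ} (hε : ε ∈ Set.Ioo (0 : ℝ) 1) :
    ‖solutionOp (embedC hR ε₀ θ) (aboveOp hR ε₀ ε θ) -
      solutionOp (critEmbed hR ε₀ θ) (critOnOp hR ε₀ θ)‖ ≤
      perturbationConst (coercConst ε₀) (dataBound hR ε₀) * ε := by
  have hγ : 0 < ε₀ - 1 := by linarith
  have p1 : 0 ≤ 36 * (1 + (massR hR)⁻¹) ^ 2 := by positivity
  have p2 : 0 ≤ 4 + (6 + 2 * ε₀) / (ε₀ - 1) := by positivity
  have p3 : 0 ≤ 4 + (6 + 2 * ε₀) * (ε₀ / (ε₀ - 1) ^ 2) := by positivity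
  refine norm_solutionOp_sub_le (embedC hR ε₀ θ) (divCurlOp (measurableSet_cell.diff hR) θ)
    (critOp hR ε₀ θ) (epsOp hR ε₀ ε θ) (constrainedSub hR θ) (coercConst_pos ε₀ hε₀) hε.1
    (fun g h => divCurlOp_symm _ θ g h) (fun k hk => divCurlOp_eq_zero hR hk) ?_ ?_ ?_ ?_ ?_ ?_ ?_
  · intro h
    obtain ⟨k, hk, hhk⟩ := exists_constrained_near hR h0 hθ h
    refine ⟨k, hk, hhk.trans (mul_le_mul_of_nonneg_right ?_ ?_)⟩
    · rw [dataBound]; linarith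
    · rw [re_inner_divCurlOp]; positivity
  · intro h
    have e := re_inner_aboveOp hR ε₀ ε θ h
    rw [aboveOp] at e
    rw [e]
    linarith [coercConst_mul_sq_norm_le hR ε₀ hε₀ θ h, le_re_inner_above hR ε₀ hε₀ hε θ h]
  · intro k hk
    rw [add_apply, inner_add_right, ContinuousLinearMap.comp_apply, adjoint_inner_right,
      inner_self_eq_ofReal, Complex.add_re, Complex.ofReal_re]
    linarith [coercConst_mul_sq_norm_le hR ε₀ hε₀ θ k, le_re_inner_crit hR ε₀ hε₀ hk]
  · refine (norm_embedC_le hR ε₀ hε₀.le θ).trans ?_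
    rw [dataBound]; linarith
  · refine (norm_critOp_le hR ε₀ hε₀ θ).trans ?_
    rw [dataBound]; linarith
  · refine (norm_epsOp_le hR ε₀ hε₀ hε θ).trans ?_
    rw [dataBound]; linarith
  · refine (norm_critOp_sub_epsOp_le hR ε₀ hε₀ hε θ).trans
      (mul_le_mul_of_nonneg_right ?_ hε.1.le)
    rw [dataBound]; linarith

/-! ### Eigenvalue sequences of operators generated by forms -/

section Eigenvalues

variable {W : Type*} [NormedAddCommGroup W] [InnerProductSpace ℂ W]

/-- The numbers `1 / s_n - 1`, where `s_n` are the approximation numbers of the solution operator: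
the eigenvalues of the operator whose resolvent at `-1` this is, in increasing order. -/
def eigenvalueSeq [CompleteSpace W] (J : W →L[ℂ] Field2)
    (A : W →L[ℂ] W) (n : ℕ) : ℝ :=
  1 / approxNumber (solutionOp J A) n - 1

theorem one_div_eigenvalueSeq_add_one [CompleteSpace W] (J : W →L[ℂ] Field2)
    (A : W →L[ℂ] W) (n : ℕ) :
    1 / (eigenvalueSeq J A n + 1) = approxNumber (solutionOp J A) n := by
  rw [eigenvalueSeq, sub_add_cancel, one_div_one_div]

variable {R : Set Plane} (hR : MeasurableSet R) (ε₀ : ℝ)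

/-- The form `β` on the form domain `D` is represented on the Hilbert space `W`: `Φ` parametrises
`D`, `J` is the corresponding embedding into `L²(□; ℂ²)` with the inner product `c`, and `A`
represents `β + c`. -/
structure IsFormRealization (D : Submodule ℂ H1V) (β : H1V → H1V → ℂ) (Φ : W →ₗ[ℂ] H1V)
    (J : W →L[ℂ] Field2) (A : W →L[ℂ] W) : Prop where
  mem_iff : ∀ v, v ∈ D ↔ ∃ h, Φ h = v
  embed : ∀ h, J h = weightV hR ε₀ (inclV (Φ h))
  form : ∀ g h, inner ℂ g (A h) = β (Φ h) (Φ g) + inner ℂ (J g) (J h)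
  injective : Function.Injective J
  coercivePair : IsCoercivePair J A

namespace IsFormRealization

variable {hR ε₀} {D : Submodule ℂ H1V} {β : H1V → H1V → ℂ} {Φ : W →ₗ[ℂ] H1V}
  {J : W →L[ℂ] Field2} {A : W →L[ℂ] W}

/-- Eigenvectors of the operator generated by `β` solve the eigenvalue problem of the form `β + c`
in the parameter space, shifted by one; they lie in the closure of the form domain since they
belong to the form domain itself. -/
theorem mem_eigenspace_iff (h : IsFormRealization hR ε₀ D β Φ J A) (hε₀ : 0 ≤ ε₀)
    (hβ : IsLinearFst β) (μ : ℝ) (u : L2V) :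
    u ∈ eigenspace (formOperator R ε₀ D β hβ) μ ↔ ∃ x, inclV (Φ x) = u ∧
      ∀ g, inner ℂ g (A x) = ((μ + 1 : ℝ) : ℂ) * inner ℂ (J g) (J x) := by
  have hc : ∀ g x, cForm R ε₀ ((μ : ℂ) • inclV (Φ x)) (inclV (Φ g)) =
      (μ : ℂ) * inner ℂ (J g) (J x) := by
    intro g x
    rw [cForm_eq_inner hR ε₀ hε₀, map_smul, inner_smul_right, ← h.embed, ← h.embed]
  change (∃ v ∈ D, inclV v = u ∧ (μ : ℂ) • u ∈ (D.map inclV).topologicalClosure ∧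
    ∀ w ∈ D, β v w = cForm R ε₀ ((μ : ℂ) • u) (inclV w)) ↔ _
  constructor
  · rintro ⟨v, hv, rfl, -, hw⟩
    obtain ⟨x, rfl⟩ := (h.mem_iff v).1 hv
    refine ⟨x, rfl, fun g => ?_⟩
    rw [h.form, hw _ ((h.mem_iff _).2 ⟨g, rfl⟩), hc]
    push_cast
    ring
  · rintro ⟨x, rfl, hx⟩
    have hmem : Φ x ∈ D := (h.mem_iff _).2 ⟨x, rfl⟩
    refine ⟨Φ x, hmem, rfl, Submodule.smul_mem _ _ (Submodule.le_topologicalClosure _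
      (Submodule.mem_map_of_mem hmem)), fun w hw => ?_⟩
    obtain ⟨g, rfl⟩ := (h.mem_iff w).1 hw
    have e := hx g
    rw [h.form] at e
    rw [hc, eq_sub_of_add_eq e]
    push_cast
    ring

theorem eigenspace_eq_bot (h : IsFormRealization hR ε₀ D β Φ J A) (hε₀ : 0 ≤ ε₀)
    (hβ : IsLinearFst β) {μ : ℝ} (hμ : μ < 0) :
    eigenspace (formOperator R ε₀ D β hβ) μ = ⊥ := by
  refine (Submodule.eq_bot_iff _).2 fun u hu => ?_
  obtain ⟨x, rfl, hx⟩ := (h.mem_eigenspace_iff hε₀ hβ μ u).1 hu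
  have h1 := h.coercivePair.dominates x
  rw [hx, inner_self_eq_ofReal, ← Complex.ofReal_mul, Complex.ofReal_re] at h1
  have h2 : J x = 0 := by
    have : ‖J x‖ ^ 2 ≤ 0 := by nlinarith [sq_nonneg ‖J x‖]
    simpa using le_antisymm this (sq_nonneg _)
  have h3 : x = 0 := h.injective (h2.trans (map_zero J).symm)
  rw [h3, map_zero, map_zero]

variable [CompleteSpace W]

/-- The eigenspaces at `μ` correspond to those of the solution operator at `1 / (μ + 1)`. -/
theorem map_eigenspace (h : IsFormRealization hR ε₀ D β Φ J A) (hε₀ : 0 ≤ ε₀)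
    (hβ : IsLinearFst β) {μ : ℝ} (hμ : 0 ≤ μ) :
    (eigenspace (formOperator R ε₀ D β hβ) μ).map (weightV hR ε₀) =
      Module.End.eigenspace (solutionOp J A : Field2 →ₗ[ℂ] Field2) ((1 / (μ + 1) : ℝ) : ℂ) := by
  have hν : ((1 / (μ + 1) : ℝ) : ℂ) ≠ 0 := by
    rw [Complex.ofReal_ne_zero]
    positivity
  have hinv : (((1 / (μ + 1) : ℝ) : ℂ))⁻¹ = ((μ + 1 : ℝ) : ℂ) := by
    rw [← Complex.ofReal_inv, one_div, inv_inv]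
  ext f
  rw [h.coercivePair.mem_eigenspace_solutionOp hν, hinv, Submodule.mem_map]
  constructor
  · rintro ⟨u, hu, rfl⟩
    obtain ⟨x, rfl, hx⟩ := (h.mem_eigenspace_iff hε₀ hβ μ u).1 hu
    exact ⟨x, (h.embed x).symm, hx⟩
  · rintro ⟨x, rfl, hx⟩
    exact ⟨_, (h.mem_eigenspace_iff hε₀ hβ μ _).2 ⟨x, rfl, hx⟩, (h.embed x).symm⟩

theorem eigenvalueSeq_nonneg (h : IsFormRealization hR ε₀ D β Φ J A)
    (hW : ¬ FiniteDimensional ℂ W) (n : ℕ) : 0 ≤ eigenvalueSeq J A n := by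
  have h1 := h.coercivePair.approxNumber_solutionOp_pos h.injective hW n
  have h2 := (approxNumber_le_norm (solutionOp J A) n).trans h.coercivePair.norm_solutionOp_le_one
  rw [eigenvalueSeq, sub_nonneg, le_div_iff₀ h1, one_mul]
  exact h2

/-- The eigenvalues of the operator generated by `β` are read off from the approximation numbers of
the solution operator. -/
theorem isEigenvalueSeq (h : IsFormRealization hR ε₀ D β Φ J A) (hε₀ : 1 ≤ ε₀)
    (hβ : IsLinearFst β) (hW : ¬ FiniteDimensional ℂ W) :
    IsEigenvalueSeq (formOperator R ε₀ D β hβ) (eigenvalueSeq J A) := by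
  have hpos := h.coercivePair.approxNumber_solutionOp_pos h.injective hW
  have hcpt := h.coercivePair.isCompactOperator_solutionOp
  have hsymm := h.coercivePair.isSymmetric_solutionOp
  have hε₀' : 0 ≤ ε₀ := by linarith
  have hinj := weightV_injective hR ε₀ hε₀
  refine ⟨fun m n hmn => ?_, ?_, fun μ => ?_, fun μ => ?_⟩
  · exact sub_le_sub_right (one_div_le_one_div_of_le (hpos n) (approxNumber_antitone _ hmn)) 1
  · have h1 : Tendsto (approxNumber (solutionOp J A)) atTop (𝓝[>] 0) :=
      tendsto_nhdsWithin_iff.2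
        ⟨tendsto_approxNumber _ hsymm hcpt h.coercivePair.solutionOp_nonneg,
          Eventually.of_forall hpos⟩
    have h2 := (tendsto_inv_nhdsGT_zero.comp h1).atTop_add
      (tendsto_const_nhds (x := (-1 : ℝ)))
    refine h2.congr fun n => ?_
    rw [eigenvalueSeq, one_div, sub_eq_add_neg]
    rfl
  · rcases lt_or_ge μ 0 with hμ | hμ
    · rw [h.eigenspace_eq_bot hε₀' hβ hμ]
      infer_instance
    · have hfin : FiniteDimensional ℂ ((eigenspace (formOperator R ε₀ D β hβ) μ).map
          (weightV hR ε₀)) := by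
        rw [h.map_eigenspace hε₀' hβ hμ]
        refine ContinuousLinearMap.finite_dimensional_eigenspace hcpt _ ?_
        rw [Complex.ofReal_ne_zero]
        positivity
      exact LinearEquiv.finiteDimensional (Submodule.equivMapOfInjective _ hinj _).symm
  · rcases lt_or_ge μ 0 with hμ | hμ
    · have : {n | eigenvalueSeq J A n = μ} = ∅ :=
        Set.eq_empty_of_forall_notMem fun n hn =>
          (hμ.trans_le (h.eigenvalueSeq_nonneg hW n)).ne' hn
      rw [h.eigenspace_eq_bot hε₀' hβ hμ, this, Set.ncard_empty, finrank_bot]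
    · rw [(Submodule.equivMapOfInjective _ hinj _).finrank_eq, h.map_eigenspace hε₀' hβ hμ,
        ← ncard_approxNumber_eq _ hsymm hcpt h.coercivePair.solutionOp_nonneg (by positivity)]
      congr 1
      ext n
      have hμ' : 0 < μ + 1 := by linarith
      change 1 / approxNumber (solutionOp J A) n - 1 = μ ↔
        approxNumber (solutionOp J A) n = 1 / (μ + 1)
      rw [sub_eq_iff_eq_add, div_eq_iff (hpos n).ne', eq_div_iff hμ'.ne', mul_comm, eq_comm]

end IsFormRealization

end Eigenvalues

theorem IsEigenvalueSeq.finite_setOf_eq {T : Submodule ℂ (L2V × L2V)} {l : ℕ → ℝ}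
    (h : IsEigenvalueSeq T l) (μ : ℝ) : {n | l n = μ}.Finite := by
  obtain ⟨N, hN⟩ := eventually_atTop.1 (h.tendsto.eventually_gt_atTop μ)
  exact (Set.finite_lt_nat N).subset fun n hn => not_le.1 fun hle => (hN n hle).ne' hn

/-- Multiplicities in an eigenvalue sequence are finite, so a value of multiplicity zero is not
taken. -/
theorem IsEigenvalueSeq.setOf_eigenspace_ne_bot {T : Submodule ℂ (L2V × L2V)} {l : ℕ → ℝ}
    (h : IsEigenvalueSeq T l) : {μ : ℝ | eigenspace T μ ≠ ⊥} = Set.range l := by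
  ext μ
  have := h.finite μ
  change eigenspace T μ ≠ ⊥ ↔ _
  rw [Ne, ← Submodule.finrank_eq_zero (R := ℂ), ← h.mult,
    Set.ncard_eq_zero (h.finite_setOf_eq μ), ← Ne, ← Set.nonempty_iff_ne_empty]
  rfl

/-! ### The two families of operators -/

section Families

variable {R : Set Plane} (hR : MeasurableSet R) (ε₀ : ℝ)

theorem isFormRealization_above (hε₀ : 1 < ε₀) {ε : ℝ} (hε : ε ∈ Set.Ioo (0 : ℝ) 1)
    (θ : Plane) :
    IsFormRealization hR ε₀ (H1qp θ) (aboveForm R ε₀ ε) (embedV θ) (embedC hR ε₀ θ)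
      (aboveOp hR ε₀ ε θ) where
  mem_iff := mem_H1qp_iff θ
  embed := embedC_eq hR ε₀ θ
  form g h := by
    rw [inner_aboveOp, aboveForm, aForm_eq_inner hR, bEpsForm_eq_inner hR]
    rfl
  injective := embedC_injective hR ε₀ hε₀.le θ
  coercivePair := isCoercivePair_above hR ε₀ hε₀ hε θ

theorem isFormRealization_crit (hε₀ : 1 < ε₀) (θ : Plane) :
    IsFormRealization hR ε₀ (constrained R θ) (bForm R ε₀)
      (embedV θ ∘ₗ (constrainedSub hR θ).subtype) (critEmbed hR ε₀ θ) (critOnOp hR ε₀ θ) where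
  mem_iff v := by
    rw [mem_constrained_iff hR]
    exact ⟨fun ⟨h, hh, e⟩ => ⟨⟨h, hh⟩, e⟩, fun ⟨h, e⟩ => ⟨h, h.2, e⟩⟩
  embed h := embedC_eq hR ε₀ θ h
  form g h := by
    rw [inner_critOnOp, critOp, ← bForm_eq_inner]
    rfl
  injective := (embedC_injective hR ε₀ hε₀.le θ).comp Subtype.val_injective
  coercivePair := isCoercivePair_crit hR ε₀ hε₀ θ

theorem not_finiteDimensional_field2 (hRo : IsOpen R) (hne : R.Nonempty) (hcell : R ⊆ cell)
    {θ : Plane} (hθ : θ ∈ dualCell) : ¬ FiniteDimensional ℂ Field2 := fun _ =>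
  not_finiteDimensional_constrainedSub hRo.measurableSet hRo hne hcell hθ inferInstance

theorem gramOp_apply_eq_zero {S : Set Plane} (hS : MeasurableSet S) {P : Field2 →L[ℂ] L2}
    (Q : Field2 →L[ℂ] L2) {h : Field2} (hP : P h = 0) : gramOp hS P Q h = 0 := by
  rw [gramOp, ContinuousLinearMap.comp_apply, ContinuousLinearMap.comp_apply, hP, map_zero,
    map_zero]

theorem bOp_apply_eq_zero {θ : Plane} {h : Field2} (hh : ∀ i j, partialOp θ i j h = 0)
    (s c₁ c₂ : ℝ) : bOp hR ε₀ θ s c₁ c₂ h = 0 := by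
  simp only [bOp, crossOp, gradOp, add_apply, sub_apply, smul_apply,
    gramOp_apply_eq_zero _ _ (hh _ _), add_zero, sub_zero, smul_zero]

/-- The parameter of a non-zero constant field. -/
def constField : Field2 := WithLp.toLp 2 ![fourierBasis 0, 0]

theorem constField_ne_zero : constField ≠ 0 := fun h =>
  fourierBasis.orthonormal.ne_zero 0 (congrArg (fun f : Field2 => f 0) h)

theorem derivOp_zero_fourierBasis_zero (j : Fin 2) :
    derivOp 0 j (fourierBasis 0) = 0 := by
  have h : multiplier fourierBasis (derivSymbol 0 j) (fourierBasis 0) = 0 := by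
    refine fourierBasis.repr.injective (lp.ext (funext fun k => ?_))
    rw [repr_multiplier_derivSymbol, HilbertBasis.repr_apply_apply,
      orthonormal_iff_ite.1 fourierBasis.orthonormal, map_zero]
    split_ifs with hk
    · rw [hk, derivSymbol, freq]
      simp
    · rw [mul_zero]
      rfl
  rw [derivOp, ContinuousLinearMap.comp_apply, h, map_zero]

theorem partialOp_constField (i j : Fin 2) : partialOp 0 i j constField = 0 := by
  rw [partialOp_apply]
  fin_cases i
  · exact derivOp_zero_fourierBasis_zero j
  · exact map_zero _

theorem constField_mem_constrainedSub : constField ∈ constrainedSub hR 0 := by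
  rw [mem_constrainedSub, divOp_apply, curlOp_apply]
  simp only [partialOp_constField, add_zero, sub_zero, map_zero, and_self]

theorem inclV_embedV_constField_ne_zero : inclV (embedV 0 constField) ≠ 0 := by
  intro h
  refine constField_ne_zero (PiLp.ext fun i => embedOp_injective 0 ?_)
  rw [PiLp.zero_apply, map_zero]
  exact congrFun h i

/-- Constant fields are periodic, and all the forms vanish on them. -/
theorem eigenspace_opAbove_zero_ne_bot (hR : MeasurableSet R) (ε₀ : ℝ) (hε₀ : 1 < ε₀) {ε : ℝ}
    (hε : ε ∈ Set.Ioo (0 : ℝ) 1) : eigenspace (opAbove R ε₀ ε 0) 0 ≠ ⊥ := by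
  refine (Submodule.ne_bot_iff _).2 ⟨inclV (embedV 0 constField), ?_,
    inclV_embedV_constField_ne_zero⟩
  refine ((isFormRealization_above hR ε₀ hε₀ hε 0).mem_eigenspace_iff (by linarith) _ 0 _).2
    ⟨constField, rfl, fun g => ?_⟩
  rw [inner_aboveOp, divCurlOp_eq_zero hR (constField_mem_constrainedSub hR), epsOp,
    bOp_apply_eq_zero hR ε₀ partialOp_constField]
  simp

theorem eigenspace_opCritical_zero_ne_bot (hR : MeasurableSet R) (ε₀ : ℝ) (hε₀ : 1 < ε₀) :
    eigenspace (opCritical R ε₀ 0) 0 ≠ ⊥ := by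
  refine (Submodule.ne_bot_iff _).2 ⟨inclV (embedV 0 constField), ?_,
    inclV_embedV_constField_ne_zero⟩
  refine ((isFormRealization_crit hR ε₀ hε₀ 0).mem_eigenspace_iff (by linarith) _ 0 _).2
    ⟨⟨constField, constField_mem_constrainedSub hR⟩, rfl, fun g => ?_⟩
  rw [inner_critOnOp, critOp, bOp_apply_eq_zero hR ε₀ partialOp_constField]
  simp

theorem zero_mem_dualCell : (0 : Plane) ∈ dualCell := fun i => by
  change (0 : ℝ) ∈ Set.Ico (-(1 / 2)) (1 / 2)
  norm_num

theorem zero_mem_blochSpectrum {T : Plane → Submodule ℂ (L2V × L2V)}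
    (hT : eigenspace (T 0) 0 ≠ ⊥) : (0 : ℝ) ∈ ⋃ θ ∈ dualCell, {μ : ℝ | eigenspace (T θ) μ ≠ ⊥} :=
  Set.mem_biUnion zero_mem_dualCell hT

end Families

/-! ### Local distance of spectra with close resolvents -/

/-- If every `s ∈ S` has a partner `t ∈ T` with `|1 / (s + 1) - 1 / (t + 1)| ≤ δ`, the points of
the closure of `S` below `b` have distance `O(δ)` to the closure of `T`. For large `δ` this holds
because `0 ∈ T`. -/
theorem infDist_closure_le {S T : Set ℝ} (hS : ∀ s ∈ S, 0 ≤ s) (hT : ∀ t ∈ T, 0 ≤ t)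
    (h0 : (0 : ℝ) ∈ T) {δ : ℝ}
    (h : ∀ s ∈ S, ∃ t ∈ T, |1 / (s + 1) - 1 / (t + 1)| ≤ δ) {b x : ℝ}
    (hx : x ∈ closure S) (hxb : x ≤ b) :
    Metric.infDist x (closure T) ≤ 2 * (|b| + 2) ^ 2 * δ := by
  rw [Metric.infDist_closure]
  set B := |b| + 2 with hB
  have hB2 : 2 ≤ B := by linarith [abs_nonneg b]
  have hbB : b + 2 ≤ B := by linarith [le_abs_self b]
  rcases le_or_gt (δ * (2 * B)) 1 with hsmall | hlarge
  · refine le_of_forall_pos_le_add fun η hη => ?_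
    obtain ⟨s, hs, hsx⟩ := Metric.mem_closure_iff.1 hx (min η 1) (by positivity)
    obtain ⟨t, ht, hst⟩ := h s hs
    have hs0 := hS s hs
    have ht0 := hT t ht
    rw [Real.dist_eq, abs_sub_comm] at hsx
    have hsB : s + 1 ≤ B := by
      have := (le_abs_self _).trans (hsx.le.trans (min_le_right _ _))
      linarith
    have h1 : 1 / B ≤ 1 / (s + 1) := one_div_le_one_div_of_le (by linarith) hsB
    have h2 : δ ≤ 1 / B / 2 := by
      rw [div_div, le_div_iff₀ (by positivity)]
      linarith
    have h3 : 1 / (2 * B) ≤ 1 / (t + 1) := by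
      have e : 1 / (2 * B) = 1 / B - 1 / B / 2 := by field_simp; norm_num
      rw [e]
      linarith [(le_abs_self _).trans hst]
    have htB : t + 1 ≤ 2 * B := (one_div_le_one_div (by linarith) (by linarith)).1 h3
    have hdist : |s - t| ≤ 2 * B ^ 2 * δ := by
      have e : s - t = (s + 1) * (t + 1) * -(1 / (s + 1) - 1 / (t + 1)) := by
        field_simp
        ring
      rw [e, abs_mul, abs_neg, abs_of_nonneg (by positivity)]
      refine mul_le_mul ?_ hst (abs_nonneg _) (by positivity)
      calc (s + 1) * (t + 1) ≤ B * (2 * B) := mul_le_mul hsB htB (by linarith) (by linarith)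
        _ = 2 * B ^ 2 := by ring
    calc Metric.infDist x T ≤ dist x t := Metric.infDist_le_dist_of_mem ht
      _ ≤ dist x s + dist s t := dist_triangle _ _ _
      _ ≤ 2 * B ^ 2 * δ + η := by
        rw [Real.dist_eq, Real.dist_eq, abs_sub_comm x s]
        linarith [hsx.le.trans (min_le_left η 1)]
  · have hx0 : 0 ≤ x := closure_minimal (fun s hs => hS s hs) isClosed_Ici hx
    refine (Metric.infDist_le_dist_of_mem h0).trans ?_
    rw [Real.dist_eq, sub_zero, abs_of_nonneg hx0]
    nlinarith

theorem localDist_closure_le {S T : Set ℝ} (hS : ∀ s ∈ S, 0 ≤ s) (hT : ∀ t ∈ T, 0 ≤ t)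
    (hS0 : (0 : ℝ) ∈ S) (hT0 : (0 : ℝ) ∈ T) {δ : ℝ}
    (h : ∀ s ∈ S, ∃ t ∈ T, |1 / (s + 1) - 1 / (t + 1)| ≤ δ)
    (h' : ∀ t ∈ T, ∃ s ∈ S, |1 / (t + 1) - 1 / (s + 1)| ≤ δ) (a b : ℝ) :
    localDist a b (closure S) (closure T) ≤ ENNReal.ofReal (2 * (|b| + 2) ^ 2 * δ) :=
  max_le
    (iSup₂_le fun _ hx =>
      ENNReal.ofReal_le_ofReal (infDist_closure_le hS hT hT0 h hx.2 hx.1.2))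
    (iSup₂_le fun _ hx =>
      ENNReal.ofReal_le_ofReal (infDist_closure_le hT hS hS0 h' hx.2 hx.1.2))

/-- Two families whose eigenvalue sequences have uniformly close resolvent values have close
Bloch spectra. -/
theorem localDist_blochSpectrum_le {T T' : Plane → Submodule ℂ (L2V × L2V)}
    {l l' : Plane → ℕ → ℝ} {δ : ℝ}
    (hl : ∀ θ ∈ dualCell, 0 ≤ l θ 0 ∧ IsEigenvalueSeq (T θ) (l θ))
    (hl' : ∀ θ ∈ dualCell, 0 ≤ l' θ 0 ∧ IsEigenvalueSeq (T' θ) (l' θ))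
    (hT : eigenspace (T 0) 0 ≠ ⊥) (hT' : eigenspace (T' 0) 0 ≠ ⊥)
    (h : ∀ n, ∀ θ ∈ dualCell, |1 / (l θ n + 1) - 1 / (l' θ n + 1)| ≤ δ) (a b : ℝ) :
    localDist a b (blochSpectrum T) (blochSpectrum T') ≤
      ENNReal.ofReal (2 * (|b| + 2) ^ 2 * δ) := by
  have key : ∀ {T : Plane → Submodule ℂ (L2V × L2V)} {l : Plane → ℕ → ℝ},
      (∀ θ ∈ dualCell, 0 ≤ l θ 0 ∧ IsEigenvalueSeq (T θ) (l θ)) → ∀ s : ℝ,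
      s ∈ (⋃ θ ∈ dualCell, {μ : ℝ | eigenspace (T θ) μ ≠ ⊥}) ↔
        ∃ θ ∈ dualCell, ∃ n, l θ n = s := by
    intro T l hl s
    rw [Set.mem_iUnion₂]
    constructor
    · rintro ⟨θ, hθ, hs⟩
      rw [(hl θ hθ).2.setOf_eigenspace_ne_bot] at hs
      exact ⟨θ, hθ, hs⟩
    · rintro ⟨θ, hθ, hs⟩
      refine ⟨θ, hθ, ?_⟩
      rw [(hl θ hθ).2.setOf_eigenspace_ne_bot]
      exact hs
  have nonneg : ∀ {T : Plane → Submodule ℂ (L2V × L2V)} {l : Plane → ℕ → ℝ},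
      (∀ θ ∈ dualCell, 0 ≤ l θ 0 ∧ IsEigenvalueSeq (T θ) (l θ)) →
      ∀ s ∈ (⋃ θ ∈ dualCell, {μ : ℝ | eigenspace (T θ) μ ≠ ⊥}), 0 ≤ s := by
    intro T l hl s hs
    obtain ⟨θ, hθ, n, rfl⟩ := (key hl s).1 hs
    exact (hl θ hθ).1.trans ((hl θ hθ).2.mono (Nat.zero_le n))
  refine localDist_closure_le (nonneg hl) (nonneg hl') (zero_mem_blochSpectrum hT)
    (zero_mem_blochSpectrum hT') ?_ ?_ a b
  · intro s hs
    obtain ⟨θ, hθ, n, rfl⟩ := (key hl s).1 hs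
    exact ⟨l' θ n, (key hl' _).2 ⟨θ, hθ, n, rfl⟩, h n θ hθ⟩
  · intro s hs
    obtain ⟨θ, hθ, n, rfl⟩ := (key hl' s).1 hs
    refine ⟨l θ n, (key hl _).2 ⟨θ, hθ, n, rfl⟩, ?_⟩
    rw [abs_sub_comm]
    exact h n θ hθ

end PCF

end

theorem mainTheorem3 (ε₀ : ℝ) (hε₀ : 1 < ε₀) (R : Set PCF.Plane) (hRo : IsOpen R)
    (hRne : R.Nonempty) (hRcell : closure R ⊆ PCF.cell) :
    (∃ (lam : PCF.Plane → ℕ → ℝ) (lamEps : ℝ → PCF.Plane → ℕ → ℝ),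
      (∀ θ ∈ PCF.dualCell,
        0 ≤ lam θ 0 ∧ PCF.IsEigenvalueSeq (PCF.opCritical R ε₀ θ) (lam θ)) ∧
      (∀ ε ∈ Set.Ioo (0 : ℝ) 1, ∀ θ ∈ PCF.dualCell,
        0 ≤ lamEps ε θ 0 ∧ PCF.IsEigenvalueSeq (PCF.opAbove R ε₀ ε θ) (lamEps ε θ)) ∧
      ∃ C : ℝ, 0 < C ∧ ∀ n : ℕ, ∀ θ ∈ PCF.dualCell, ∀ ε ∈ Set.Ioo (0 : ℝ) 1,
        |1 / (lamEps ε θ n + 1) - 1 / (lam θ n + 1)| ≤ C * ε) ∧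
    ∀ b : ℝ, ∃ Cb : ℝ, 0 < Cb ∧ ∀ a : ℝ, a ≤ b → ∀ ε ∈ Set.Ioo (0 : ℝ) 1,
      PCF.localDist a b (PCF.blochSpectrum (PCF.opAbove R ε₀ ε))
        (PCF.blochSpectrum (PCF.opCritical R ε₀)) ≤ ENNReal.ofReal (Cb * ε) := by
  open PCF in
  have hR := hRo.measurableSet
  have hcell : R ⊆ cell := subset_closure.trans hRcell
  have hm : 0 < massR hR := massR_pos hRo hRne hcell
  let lam : Plane → ℕ → ℝ := fun θ => eigenvalueSeq (critEmbed hR ε₀ θ) (critOnOp hR ε₀ θ)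
  let lamEps : ℝ → Plane → ℕ → ℝ := fun ε θ =>
    eigenvalueSeq (embedC hR ε₀ θ) (aboveOp hR ε₀ ε θ)
  have hlam : ∀ θ ∈ dualCell, 0 ≤ lam θ 0 ∧ IsEigenvalueSeq (opCritical R ε₀ θ) (lam θ) := by
    intro θ hθ
    have hW := not_finiteDimensional_constrainedSub hR hRo hRne hcell hθ
    have h := isFormRealization_crit hR ε₀ hε₀ θ
    exact ⟨h.eigenvalueSeq_nonneg hW 0, h.isEigenvalueSeq hε₀.le _ hW⟩
  have hlamEps : ∀ ε ∈ Set.Ioo (0 : ℝ) 1, ∀ θ ∈ dualCell,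
      0 ≤ lamEps ε θ 0 ∧ IsEigenvalueSeq (opAbove R ε₀ ε θ) (lamEps ε θ) := by
    intro ε hε θ hθ
    have hW := not_finiteDimensional_field2 hRo hRne hcell hθ
    have h := isFormRealization_above hR ε₀ hε₀ hε θ
    exact ⟨h.eigenvalueSeq_nonneg hW 0, h.isEigenvalueSeq hε₀.le _ hW⟩
  let C : ℝ := |perturbationConst (coercConst ε₀) (dataBound hR ε₀)| + 1
  have hC : 0 < C := by positivity
  have hdiff : ∀ n : ℕ, ∀ θ ∈ dualCell, ∀ ε ∈ Set.Ioo (0 : ℝ) 1,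
      |1 / (lamEps ε θ n + 1) - 1 / (lam θ n + 1)| ≤ C * ε := by
    intro n θ hθ ε hε
    simp only [lam, lamEps, one_div_eigenvalueSeq_add_one]
    refine (abs_approxNumber_sub_le _ _ n).trans
      ((norm_solutionOp_above_sub_crit_le hR ε₀ hε₀ hm hθ hε).trans ?_)
    exact mul_le_mul_of_nonneg_right ((le_abs_self _).trans (le_add_of_nonneg_right zero_le_one))
      hε.1.le
  refine ⟨⟨lam, lamEps, hlam, hlamEps, C, hC, hdiff⟩, fun b => ?_⟩
  refine ⟨2 * (|b| + 2) ^ 2 * C, by positivity, fun a _ ε hε => ?_⟩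
  rw [mul_assoc _ C ε]
  exact localDist_blochSpectrum_le (hlamEps ε hε) hlam
    (eigenspace_opAbove_zero_ne_bot hR ε₀ hε₀ hε) (eigenspace_opCritical_zero_ne_bot hR ε₀ hε₀)
    (fun n θ hθ => hdiff n θ hθ ε hε) a b
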